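/- **Setting.** Let $K$ be a complete discretely valued extension of $\mathbb{Q}_p$; "noetherian" means left and right noetherian. A *triangular decomposition* of a noetherian $\mathbb{Z}$-graded $K$-algebra $R=\bigoplus_n R_n$ is a tuple $(A,B,H,\partial)$ with $A,B,H\subset R$ graded subalgebras and $\partial\in R_0$ such that: multiplication gives $R=A\otimes_KH\otimes_KB$; $BH=HB$ and $HA=AH$; $A=\bigoplus_{n\ge 0}A_n$, $B=\bigoplus_{n\le 0}B_n$, $A_0=B_0=K$, $H\subset R_0$; all $A_n,B_n$ are finite dimensional; $H$ is a finite dimensional split semisimple $K$-algebra; $R_n=\{x\in R : [\partial,x]=nx\}$ for all $n\in\mathbb{Z}$. Let $\mathcal{O}$ be the full subcategory of $\operatorname{Mod}(R)$ of the finitely generated modules $M$ such that for every $m\in M$ there is $n\geq 0$ with $B_{-k}m=0$ for all $k>n$. Let $\operatorname{Irr}(H)$ be the set of isomorphism classes of irreducible $H$-modules, and for $W\in \operatorname{Irr}(H)$ let $\Delta(W)=R\otimes_{BH}W$, where $BH$ acts on $W$ through the surjection $BH\to H$ that kills $B_{<0}=\bigoplus_{n<0}B_n$. Write $\partial=\partial'-\partial_0$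 with $\partial'\in A\otimes H\otimes B_{<0}$ and $\partial_0\in Z(H)$, and let $c(W)\in K$ be the scalar by which $\partial_0$ acts on $W$. For a $K$-linear endomorphism $D$ of a $K$-vector space $V$ and $\lambda\in K$ put $V^{\lambda}=\{v : (D-\lambda)^nv=0 \text{ for } n\gg 0\}$, $\Lambda(V)=\{\lambda : V^\lambda\neq 0\}$ and $V^{\operatorname{ws}}=\bigoplus_{\lambda}V^\lambda$. If $V$ is a topological vector space and $D$ is continuous, $V$ *admits a weight space decomposition* for $D$ if there is $I\subset\Lambda(V)$ such that every $v\in V$ is a convergent sum $v=\sum_{\lambda\in I}v_\lambda$ with $v_\lambda\in V^\lambda$; it is *semi-simple* if moreover $D$ acts on $V^\lambda$ as $\lambda$ for all $\lambda\in I$. A *triangular decomposition* $(R,A,B,H,\partial)$ of a noetherian (non-archimedean) Banach $K$-algebra $\mathscr{R}$ consists of a dense subalgebra $R\subset\mathscr{R}$, which is noetherian and graded, and a triangular decomposition $(A,B,H,\partial)$ of $R$ such that, with $\mathscr{A},\mathscr{B}$ the closures of $A,B$ in $\mathscr{R}$: multiplication induces an isomorphism of Banach spaces $\mathscr{A}\widehat\otimes_KH\widehat\otimes_K\mathscr{B}\cong\mathscr{R}$;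 and $\mathscr{A}$ and $\mathscr{B}$ have semi-simple weight space decompositions for $\operatorname{ad}(\partial)=[\partial,-]$ with $\mathscr{A}^{\operatorname{ws}}=A$ and $\mathscr{B}^{\operatorname{ws}}=B$. **Theorem.** Let $\mathscr{R}$ be a noetherian Banach $K$-algebra with a triangular decomposition $(R,A,B,H,\partial)$ such that $\mathscr{A}$ and $\mathscr{B}$ are noetherian. Let $\widehat{\mathcal{O}}$ be the full subcategory of the category $\operatorname{Mod}(\mathscr{R})$ of finitely generated $\mathscr{R}$-modules, given by the modules $M$ that are finite over $\mathscr{A}$ and admit a weight space decomposition for the action of $\partial$, where $M$ carries its canonical topology (the quotient topology of any surjection $\mathscr{R}^r\to M$). Then: 1. $\widehat{\mathcal{O}}$ is a full abelian subcategory of $\operatorname{Mod}(\mathscr{R})$, i.e. it is abelian and its inclusion is exact. 2. $\widehat{\mathcal{O}}$ is closed under $\mathscr{R}$-submodules and finite direct sums. 3. $\mathscr{R}\otimes_R-$ sends $\mathcal{O}$ to $\widehat{\mathcal{O}}$, $(-)^{\operatorname{ws}}$ (for the action of $\partial$) sends $\widehat{\mathcal{O}}$ to $\mathcal{O}$, and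 they are mutually inverse equivalences of abelian categories $\mathcal{O}\leftrightarrows\widehat{\mathcal{O}}$; explicitly the natural maps $M\to(\mathscr{R}\otimes_RM)^{\operatorname{ws}}$, $m\mapsto 1\otimes m$, for $M\in\mathcal{O}$ and $\mathscr{R}\otimes_RM^{\operatorname{ws}}\to M$, $x\otimes m\mapsto xm$, for $M\in\widehat{\mathcal{O}}$ are isomorphisms. 4. $\widehat{\mathcal{O}}$ is a highest weight category with standard objects $\mathscr{R}\otimes_R\Delta(W)$, $W\in\operatorname{Irr}(H)$, for the partial order on $\operatorname{Irr}(H)$ given by $W<E$ if and only if $c(E)-c(W)\in\mathbb{Z}^{>0}$. That is: $\widehat{\mathcal{O}}$ is a $K$-linear abelian category in which all objects have finite length and all Hom spaces are finite dimensional, the order has finite intervals, and there are simple objects $\widehat L(W)$, representing each isomorphism class of simple objects exactly once, with projective covers $\widehat P(W)$ in $\widehat{\mathcal{O}}$, such that $\widehat L(W)$ is a quotient of $\mathscr{R}\otimes_R\Delta(W)$ whose kernel has only composition factors $\widehat L(E)$ with $E<W$, and $\mathscr{R}\otimes_R\Delta(W)$ is a quotient of $\widehat P(W)$ whose kernel has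 a finite filtration with subquotients of the form $\mathscr{R}\otimes_R\Delta(E)$ with $E>W$. -/

import Mathlib

open CategoryTheory CategoryTheory.Limits
open scoped TensorProduct

universe w u

noncomputable section

namespace TriO

/-! ### Weight space decompositions -/

section Weights

variable {K : Type*} [Field K] {V : Type*} [AddCommGroup V] [Module K V]

/-- The set `Λ(V)` of weights of an endomorphism `D` of `V`, that is the set of those `c` with
`V^c = {v | (D - c)^n v = 0 for n ≫ 0} ≠ 0`. -/
def weights (D : Module.End K V) : Set K := {c | D.maxGenEigenspace c ≠ ⊥}

/-- `V^ws`, the (automatically direct) sum of all generalized weight spaces. -/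
def ws (D : Module.End K V) : Submodule K V := ⨆ c : K, D.maxGenEigenspace c

/-- `V` admits a weight space decomposition for `D` with respect to `I ⊆ Λ(V)`: every vector is a
convergent sum of generalized weight vectors with weights in `I`. -/
def HasWeightDecompositionWrt [TopologicalSpace V] (D : Module.End K V) (I : Set K) : Prop :=
  I ⊆ weights D ∧
    ∀ v : V, ∃ f : I → V, (∀ c : I, f c ∈ D.maxGenEigenspace (c : K)) ∧ HasSum f v

/-- `V` admits a weight space decomposition for `D`. -/
def HasWeightDecomposition [TopologicalSpace V] (D : Module.End K V) : Prop :=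
  ∃ I : Set K, HasWeightDecompositionWrt D I

/-- `V` admits a semi-simple weight space decomposition for `D`: in addition `D` acts on each
`V^c`, `c ∈ I`, as multiplication by `c`. -/
def HasSemisimpleWeightDecomposition [TopologicalSpace V] (D : Module.End K V) : Prop :=
  ∃ I : Set K, HasWeightDecompositionWrt D I ∧
    ∀ c ∈ I, ∀ v ∈ D.maxGenEigenspace c, D v = c • v

end Weights

/-! ### The completed tensor product of non-archimedean normed spaces -/

section CompletedTensor

variable (K : Type*) [NormedField K]
variable (V W : Type*) [SeminormedAddCommGroup V] [NormedSpace K V]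
  [SeminormedAddCommGroup W] [NormedSpace K W]

/-- The algebraic tensor product, to be equipped with the non-archimedean projective tensor
seminorm `‖t‖ = inf max_i ‖v_i‖ ‖w_i‖` over all presentations `t = ∑ v_i ⊗ w_i`. -/
def ProjTensor : Type _ := V ⊗[K] W

instance : AddCommGroup (ProjTensor K V W) := inferInstanceAs (AddCommGroup (V ⊗[K] W))
instance : Module K (ProjTensor K V W) := inferInstanceAs (Module K (V ⊗[K] W))

variable {K V W}

/-- The pure tensor `v ⊗ w`. -/
def ProjTensor.tmul (v : V) (w : W) : ProjTensor K V W := (v ⊗ₜ[K] w : V ⊗[K] W)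

/-- The upper bounds of `max_i ‖v_i‖ ‖w_i‖` for the presentations `t = ∑ v_i ⊗ w_i`. -/
def ProjTensor.bounds (t : ProjTensor K V W) : Set ℝ :=
  {r | 0 ≤ r ∧ ∃ (n : ℕ) (v : Fin n → V) (w : Fin n → W),
    t = ∑ i, ProjTensor.tmul (K := K) (v i) (w i) ∧ ∀ i, ‖v i‖ * ‖w i‖ ≤ r}

lemma ProjTensor.bounds_nonempty (t : ProjTensor K V W) : (bounds t).Nonempty := by
  have key : ∀ s : V ⊗[K] W, ∃ (n : ℕ) (v : Fin n → V) (w : Fin n → W),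
      s = ∑ i, (v i) ⊗ₜ[K] (w i) := by
    intro s
    induction s using TensorProduct.induction_on with
    | zero => exact ⟨0, Fin.elim0, Fin.elim0, by simp⟩
    | tmul x y => exact ⟨1, fun _ => x, fun _ => y, by simp⟩
    | add x y hx hy =>
      obtain ⟨n, v, w, rfl⟩ := hx
      obtain ⟨m, v', w', rfl⟩ := hy
      exact ⟨n + m, Fin.append v v', Fin.append w w', by simp [Fin.sum_univ_add]⟩
  obtain ⟨n, v, w, h⟩ := key t
  exact ⟨∑ i, ‖v i‖ * ‖w i‖, Finset.sum_nonneg fun i _ => by positivity, n, v, w, h,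
    fun i => Finset.single_le_sum (f := fun i => ‖v i‖ * ‖w i‖)
      (fun i _ => by positivity) (Finset.mem_univ i)⟩

lemma ProjTensor.bounds_bddBelow (t : ProjTensor K V W) : BddBelow (bounds t) :=
  ⟨0, fun _ h => h.1⟩

lemma ProjTensor.bounds_add {s t : ProjTensor K V W} {a b : ℝ} (ha : a ∈ bounds s)
    (hb : b ∈ bounds t) : max a b ∈ bounds (s + t) := by
  obtain ⟨ha0, n, v, w, rfl, h⟩ := ha
  obtain ⟨hb0, m, v', w', rfl, h'⟩ := hb
  refine ⟨le_max_of_le_left ha0, n + m, Fin.append v v', Fin.append w w', ?_, ?_⟩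
  · simp [Fin.sum_univ_add]
  · intro i
    refine Fin.addCases (fun i => ?_) (fun i => ?_) i
    · simpa using Or.inl (h i)
    · simpa using Or.inr (h' i)

lemma ProjTensor.bounds_smul {t : ProjTensor K V W} {a : ℝ} (c : K) (ha : a ∈ bounds t) :
    ‖c‖ * a ∈ bounds (c • t) := by
  obtain ⟨ha0, n, v, w, rfl, h⟩ := ha
  refine ⟨by positivity, n, fun i => c • v i, w, ?_, fun i => ?_⟩
  · rw [Finset.smul_sum]
    rfl
  · rw [norm_smul, mul_assoc]
    exact mul_le_mul_of_nonneg_left (h i) (norm_nonneg c)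

/-- The non-archimedean projective tensor seminorm. -/
def ProjTensor.seminorm : Seminorm K (ProjTensor K V W) :=
  Seminorm.ofSMulLE (fun t => sInf (bounds t))
    (le_antisymm
      (csInf_le (bounds_bddBelow _) ⟨le_refl _, 0, Fin.elim0, Fin.elim0, by simp, fun i => i.elim0⟩)
      (le_csInf (bounds_nonempty _) fun _ h => h.1))
    (fun s t => by
      refine le_of_forall_pos_le_add fun ε hε => ?_
      obtain ⟨a, ha, ha'⟩ := exists_lt_of_csInf_lt (bounds_nonempty s)
        (lt_add_of_pos_right (sInf (bounds s)) (half_pos hε))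
      obtain ⟨b, hb, hb'⟩ := exists_lt_of_csInf_lt (bounds_nonempty t)
        (lt_add_of_pos_right (sInf (bounds t)) (half_pos hε))
      have h1 := csInf_le (bounds_bddBelow _) (bounds_add ha hb)
      have h2 : max a b ≤ a + b := max_le (by linarith [hb.1]) (by linarith [ha.1])
      linarith)
    (fun c t => by
      rcases eq_or_ne c 0 with rfl | hc
      · obtain ⟨a, ha⟩ := bounds_nonempty t
        simpa using csInf_le (bounds_bddBelow _) (bounds_smul (0 : K) ha)
      · have hc' : 0 < ‖c‖ := norm_pos_iff.mpr hc
        rw [← div_le_iff₀' hc']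
        refine le_csInf (bounds_nonempty t) fun a ha => ?_
        rw [div_le_iff₀' hc']
        exact csInf_le (bounds_bddBelow _) (bounds_smul c ha))

instance : SeminormedAddCommGroup (ProjTensor K V W) :=
  ProjTensor.seminorm.toAddGroupSeminorm.toSeminormedAddCommGroup

instance : NormedSpace K (ProjTensor K V W) where
  norm_smul_le c t := (map_smul_eq_mul (ProjTensor.seminorm (K := K) (V := V) (W := W)) c t).le

end CompletedTensor

/-- The completed tensor product `U ⊗̂ V ⊗̂ W` over `K`. -/
abbrev CompletedTensor₃ (K : Type*) [NormedField K] (U V W : Type*)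
    [SeminormedAddCommGroup U] [NormedSpace K U] [SeminormedAddCommGroup V] [NormedSpace K V]
    [SeminormedAddCommGroup W] [NormedSpace K W] : Type _ :=
  UniformSpace.Completion (ProjTensor K (ProjTensor K U V) W)

/-! ### Extension of scalars along a homomorphism of (non-commutative) rings -/

section BaseChange

variable {R S : Type u} [Ring R] [Ring S] (f : R →+* S)

/-- The `S`-submodule of `S ⊗_ℤ M` generated by the elements `s f(r) ⊗ m - s ⊗ r m`. -/
def balanced (M : Type u) [AddCommGroup M] [Module R M] : Submodule S (S ⊗[ℤ] M) :=
  Submodule.span S {t | ∃ (s : S) (r : R) (m : M), t = (s * f r) ⊗ₜ[ℤ] m - s ⊗ₜ[ℤ] (r • m)}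

/-- The left `S`-module `S ⊗_R M`. -/
abbrev BaseChange (M : Type u) [AddCommGroup M] [Module R M] : Type u :=
  (S ⊗[ℤ] M) ⧸ balanced f M

/-- The element `s ⊗ m` of `S ⊗_R M`. -/
def btmul {M : Type u} [AddCommGroup M] [Module R M] (s : S) (m : M) : BaseChange f M :=
  (balanced f M).mkQ (s ⊗ₜ[ℤ] m)

/-- The map `S ⊗_R M → S ⊗_R N` induced by an `R`-linear map `M → N`. -/
def baseChangeMap {M N : Type u} [AddCommGroup M] [Module R M] [AddCommGroup N] [Module R N]
    (g : M →ₗ[R] N) : BaseChange f M →ₗ[S] BaseChange f N :=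
  Submodule.mapQ _ _
    (TensorProduct.AlgebraTensorModule.map (LinearMap.id : S →ₗ[S] S) (g.restrictScalars ℤ)) <| by
    rw [balanced, Submodule.span_le]
    rintro _ ⟨s, r, m, rfl⟩
    refine Submodule.subset_span ⟨s, r, g m, ?_⟩
    simp [map_sub]

/-- The functor `S ⊗_R - : Mod(R) ⥤ Mod(S)`. -/
def baseChange : ModuleCat.{u} R ⥤ ModuleCat.{u} S where
  obj M := ModuleCat.of S (BaseChange f M)
  map g := ModuleCat.ofHom (baseChangeMap f g.hom)
  map_id M := by
    refine ModuleCat.hom_ext (Submodule.linearMap_qext _ (TensorProduct.AlgebraTensorModule.ext ?_))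
    intro s m
    rfl
  map_comp g h := by
    refine ModuleCat.hom_ext (Submodule.linearMap_qext _ (TensorProduct.AlgebraTensorModule.ext ?_))
    intro s m
    rfl

end BaseChange

/-! ### Algebras with a triangular decomposition and their category `O` -/

/-- A triangular decomposition `(A, B, H, ∂)` of a graded `K`-algebra `R = ⨁ R_n`. -/
structure TriangularDecomposition (K : Type w) [Field K] (R : Type u) [Ring R] [Algebra K R] where
  /-- The graded pieces `R_n` of `R`. -/
  gr : ℤ → Submodule K R
  graded_one : (1 : R) ∈ gr 0
  graded_mul : ∀ {m n : ℤ} {x y : R}, x ∈ gr m → y ∈ gr n → x * y ∈ gr (m + n)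
  isInternal : DirectSum.IsInternal gr
  A : Subalgebra K R
  B : Subalgebra K R
  H : Subalgebra K R
  /-- The element `∂`. -/
  del : R
  /-- `R = A ⊗ H ⊗ B`, through the multiplication map. -/
  bijective_mul : Function.Bijective
    (TensorProduct.lift
      ((LinearMap.mul K R).compl₂ B.val.toLinearMap ∘ₗ
        TensorProduct.lift ((LinearMap.mul K R).compl₁₂ A.val.toLinearMap H.val.toLinearMap)) :
      (A ⊗[K] H) ⊗[K] B →ₗ[K] R)
  B_mul_H : Subalgebra.toSubmodule B * Subalgebra.toSubmodule H =
    Subalgebra.toSubmodule H * Subalgebra.toSubmodule B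
  H_mul_A : Subalgebra.toSubmodule H * Subalgebra.toSubmodule A =
    Subalgebra.toSubmodule A * Subalgebra.toSubmodule H
  /-- `A` is a graded subalgebra, concentrated in non-negative degrees. -/
  A_graded : Subalgebra.toSubmodule A ≤ ⨆ n : ℕ, Subalgebra.toSubmodule A ⊓ gr n
  /-- `B` is a graded subalgebra, concentrated in non-positive degrees. -/
  B_graded : Subalgebra.toSubmodule B ≤ ⨆ n : ℕ, Subalgebra.toSubmodule B ⊓ gr (-n)
  A_zero : Subalgebra.toSubmodule A ⊓ gr 0 = 1
  B_zero : Subalgebra.toSubmodule B ⊓ gr 0 = 1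
  /-- `H ⊆ R_0`; in particular `H` is a graded subalgebra. -/
  H_le : Subalgebra.toSubmodule H ≤ gr 0
  A_finite : ∀ n : ℤ, Module.Finite K ↥(Subalgebra.toSubmodule A ⊓ gr n)
  B_finite : ∀ n : ℤ, Module.Finite K ↥(Subalgebra.toSubmodule B ⊓ gr n)
  /-- `H` is a finite dimensional split semi-simple algebra, i.e. a finite product of matrix
  algebras over `K`. -/
  H_split : ∃ (k : ℕ) (d : Fin k → ℕ),
    Nonempty (H ≃ₐ[K] (∀ i, Matrix (Fin (d i)) (Fin (d i)) K))
  /-- The grading is inner, given by `∂`. -/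
  mem_gr : ∀ (n : ℤ) (x : R), x ∈ gr n ↔ del * x - x * del = n • x

/-- `K`-linear endomorphism of an `E`-module `M` given by the action of `x ∈ E`. -/
def act (K : Type w) [Field K] {E : Type u} [Ring E] [Algebra K E] (x : E) (M : Type u)
    [AddCommGroup M] [Module E M] [Module K M] [IsScalarTower K E M] : Module.End K M :=
  Algebra.lsmul K K M x

/-- The commutator `ad(x) = [x, -]` on `E`. -/
def ad (K : Type w) [Field K] {E : Type u} [Ring E] [Algebra K E] (x : E) : Module.End K E :=
  LinearMap.mulLeft K x - LinearMap.mulRight K x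

namespace TriangularDecomposition

variable {K : Type w} [Field K] {R : Type u} [Ring R] [Algebra K R]
  (T : TriangularDecomposition K R)

/-- The subspace `⨁_{n < 0} B_n` of `B`. -/
def Bneg : Submodule K R := ⨆ n : ℕ, Subalgebra.toSubmodule T.B ⊓ T.gr (-(n + 1))

/-- The category `O`: finitely generated `R`-modules `M` on which `B` acts locally nilpotently,
i.e. for every `m` there is `n ≥ 0` such that `B_{-k} m = 0` for all `k > n`. -/
def catO : ObjectProperty (ModuleCat.{u} R) := fun M =>
  Module.Finite R M ∧
    ∀ m : M, ∃ n : ℕ, ∀ k : ℕ, n < k → ∀ b ∈ T.B, b ∈ T.gr (-k) → b • m = 0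

/-- The set `Irr(H)` of isomorphism classes of irreducible `H`-modules. -/
def Irr : Type (u + 1) :=
  {W : Skeleton (ModuleCat.{u} T.H) // IsSimpleModule T.H ((fromSkeleton (ModuleCat.{u} T.H)).obj W)}

/-- A representative of an isomorphism class of irreducible `H`-modules. -/
def Irr.rep {T : TriangularDecomposition K R} (W : T.Irr) : ModuleCat.{u} T.H :=
  (fromSkeleton (ModuleCat.{u} T.H)).obj W.1

/-- The Verma module `Δ(W) = R ⊗_{BH} W`, where `BH` acts on `W` through the surjection `BH → H`
that kills `⨁_{n < 0} B_n`; it is presented as the quotient of `R ⊗_H W` by the `R`-submodule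
generated by the elements `b ⊗ w` with `b ∈ ⨁_{n < 0} B_n`. -/
def verma (W : ModuleCat.{u} T.H) : ModuleCat.{u} R :=
  ModuleCat.of R (BaseChange (T.H.val : T.H →+* R) W ⧸
    Submodule.span R {x | ∃ b ∈ T.Bneg, ∃ w : W, x = btmul (T.H.val : T.H →+* R) b w})

open Classical in
/-- The scalar `c(W)` by which `∂₀` acts on `W`, where `∂ = ∂' - ∂₀` with `∂'` in
`A ⊗ H ⊗ (⨁_{n < 0} B_n)` and `∂₀ ∈ H` (which is then unique, and central in `H`). -/
def c (W : T.Irr) : K :=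
  if h : ∃ a : K, ∃ d₀ : T.H,
      T.del + (d₀ : R) ∈ Subalgebra.toSubmodule T.A * Subalgebra.toSubmodule T.H * T.Bneg ∧
      ∀ v : W.rep, d₀ • v = algebraMap K T.H a • v
  then h.choose else 0

/-- The order on `Irr(H)`: `W < E` if and only if `c(E) - c(W)` is a positive integer. -/
def lt (W E : T.Irr) : Prop := ∃ n : ℕ, 0 < n ∧ T.c E - T.c W = n

lemma ad_mem {S : Subalgebra K R} {d : ℕ → ℤ}
    (hS : Subalgebra.toSubmodule S ≤ ⨆ n : ℕ, Subalgebra.toSubmodule S ⊓ T.gr (d n))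
    {x : R} (hx : x ∈ S) : T.del * x - x * T.del ∈ S := by
  have h : Subalgebra.toSubmodule S ≤ (Subalgebra.toSubmodule S).comap (ad K T.del) := by
    refine hS.trans (iSup_le fun n y hy => ?_)
    have := (T.mem_gr (d n) y).mp hy.2
    simp only [Submodule.mem_comap, ad, LinearMap.sub_apply, LinearMap.mulLeft_apply,
      LinearMap.mulRight_apply, this]
    exact zsmul_mem hy.1 _
  exact h hx

/-- For `M` a module over an algebra `E ⊇ R`, elements of `R_n` map `M^a` to `M^{a + n}`. -/
lemma smul_mem_weight {E : Type u} [Ring E] [Algebra K E] (R : Subalgebra K E)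
    (T : TriangularDecomposition K R) (M : Type u) [AddCommGroup M] [Module E M] [Module K M]
    [IsScalarTower K E M] {n : ℤ} {x : R} (hx : x ∈ T.gr n) {a : K} {m : M}
    (hm : m ∈ (act K (T.del : E) M).maxGenEigenspace a) :
    (x : E) • m ∈ (act K (T.del : E) M).maxGenEigenspace (a + n) := by
  rw [Module.End.mem_maxGenEigenspace] at hm ⊢
  obtain ⟨k, hk⟩ := hm
  refine ⟨k, ?_⟩
  have hx' : (T.del : E) * x = x * T.del + n • (x : E) := by
    have := congrArg (Subtype.val : R → E) ((T.mem_gr n x).mp hx)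
    push_cast at this
    rw [← this]; abel
  have step : ∀ v : M, (act K (T.del : E) M - (a + n) • (1 : Module.End K M)) ((x : E) • v) =
      (x : E) • (act K (T.del : E) M - a • (1 : Module.End K M)) v := by
    intro v
    simp only [act, LinearMap.sub_apply, LinearMap.smul_apply, Module.End.one_apply,
      Algebra.lsmul_coe, smul_sub, ← mul_smul, hx', add_smul]
    have h1 : (n • (x : E)) • v = (n : K) • (x : E) • v := by
      rw [smul_assoc, Int.cast_smul_eq_zsmul]
    have h2 : (x : E) • a • v = a • (x : E) • v := by
      rw [← algebraMap_smul E a v, ← mul_smul, ← Algebra.commutes, mul_smul, algebraMap_smul]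
    rw [h1, h2, LinearMap.add_apply, LinearMap.smul_apply, LinearMap.smul_apply,
      Module.End.one_apply]
    abel
  have steps : ∀ (j : ℕ) (v : M),
      ((act K (T.del : E) M - (a + n) • (1 : Module.End K M)) ^ j) ((x : E) • v) =
      (x : E) • ((act K (T.del : E) M - a • (1 : Module.End K M)) ^ j) v := by
    intro j
    induction j with
    | zero => intro v; simp
    | succ j ih => intro v; rw [pow_succ, Module.End.mul_apply, step, ih, pow_succ,
        Module.End.mul_apply]
  rw [steps, hk, smul_zero]

lemma smul_mem_ws {E : Type u} [Ring E] [Algebra K E] (R : Subalgebra K E)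
    (T : TriangularDecomposition K R) (M : Type u) [AddCommGroup M] [Module E M] [Module K M]
    [IsScalarTower K E M] (x : R) {m : M} (hm : m ∈ ws (act K (T.del : E) M)) :
    (x : E) • m ∈ ws (act K (T.del : E) M) := by
  have hx : x ∈ ⨆ n, T.gr n := by rw [T.isInternal.submodule_iSup_eq_top]; trivial
  induction hx using Submodule.iSup_induction' with
  | mem n x hx =>
    unfold ws at hm
    induction hm using Submodule.iSup_induction' with
    | mem a m hm => exact Submodule.mem_iSup_of_mem _ (smul_mem_weight R T M hx hm)
    | zero => rw [smul_zero]; exact zero_mem _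
    | add m m' _ _ h h' => rw [smul_add]; exact add_mem h h'
  | zero => simp
  | add x y _ _ h h' => rw [Subalgebra.coe_add, add_smul]; exact add_mem h h'

end TriangularDecomposition

/-! ### Banach algebras with a triangular decomposition -/

section Banach

variable {K : Type w} [NormedField K] {𝓡 : Type u} [NormedRing 𝓡] [NormedAlgebra K 𝓡]

/-- The completion in `𝓡` of a subalgebra `S` of a subalgebra `R` of `𝓡`, i.e. its closure. -/
def closureIn (R : Subalgebra K 𝓡) (S : Subalgebra K R) : Subalgebra K 𝓡 :=
  (S.map R.val).topologicalClosure

lemma ad_mem_closureIn {R : Subalgebra K 𝓡} (d : R) {S : Subalgebra K R}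
    (hS : ∀ x ∈ S, d * x - x * d ∈ S) :
    ∀ x ∈ Subalgebra.toSubmodule (closureIn R S),
      ad K (d : 𝓡) x ∈ Subalgebra.toSubmodule (closureIn R S) := by
  intro x hx
  have hc : Continuous fun y : 𝓡 => (d : 𝓡) * y - y * d := by fun_prop
  refine map_mem_closure hc hx ?_
  rintro _ ⟨y, hy, rfl⟩
  exact ⟨d * y - y * d, hS y hy, by simp [ad]⟩

/-- `ad(∂)` as an endomorphism of the completion of a subalgebra `S ⊆ R` that is stable
under `ad(∂)`. -/
def adClosure {R : Subalgebra K 𝓡} (d : R) {S : Subalgebra K R}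
    (hS : ∀ x ∈ S, d * x - x * d ∈ S) : Module.End K (closureIn R S) :=
  (ad K (d : 𝓡)).restrict (p := Subalgebra.toSubmodule (closureIn R S))
    (q := Subalgebra.toSubmodule (closureIn R S)) (ad_mem_closureIn d hS)

variable (K 𝓡) in
/-- A triangular decomposition `(R, A, B, H, ∂)` of a Banach `K`-algebra `𝓡`. -/
structure BanachTriangularDecomposition where
  /-- The dense graded subalgebra `R ⊆ 𝓡`. -/
  R : Subalgebra K 𝓡
  dense : Dense (R : Set 𝓡)
  /-- The triangular decomposition `(A, B, H, ∂)` of `R`. -/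
  T : TriangularDecomposition K R
  /-- `𝓡 = 𝓐 ⊗̂ H ⊗̂ 𝓑` as Banach spaces, through the multiplication map. -/
  decomposition : ∃ e : CompletedTensor₃ K (closureIn R T.A) (T.H.map R.val) (closureIn R T.B)
      ≃L[K] 𝓡,
    ∀ (a : closureIn R T.A) (h : T.H.map R.val) (b : closureIn R T.B),
      e ((ProjTensor.tmul (K := K) (ProjTensor.tmul (K := K) a h) b :
        ProjTensor K (ProjTensor K (closureIn R T.A) (T.H.map R.val)) (closureIn R T.B))) =
      (a : 𝓡) * h * b
  /-- `𝓐` has a semi-simple weight space decomposition for `ad(∂)`, and `𝓐^ws = A`. -/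
  semisimple_A : HasSemisimpleWeightDecomposition
    (adClosure T.del fun _ hx => T.ad_mem T.A_graded hx)
  ws_A : (ws (adClosure T.del fun _ hx => T.ad_mem T.A_graded hx)).map
      (closureIn R T.A).val.toLinearMap = Subalgebra.toSubmodule (T.A.map R.val)
  /-- `𝓑` has a semi-simple weight space decomposition for `ad(∂)`, and `𝓑^ws = B`. -/
  semisimple_B : HasSemisimpleWeightDecomposition
    (adClosure T.del fun _ hx => T.ad_mem T.B_graded hx)
  ws_B : (ws (adClosure T.del fun _ hx => T.ad_mem T.B_graded hx)).map
      (closureIn R T.B).val.toLinearMap = Subalgebra.toSubmodule (T.B.map R.val)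

/-- The canonical topology of a finitely generated `𝓡`-module: it is the quotient topology for any
surjection `𝓡^r → M`. -/
abbrev canonicalTopology (E : Type u) [NormedRing E] (M : Type u) [AddCommGroup M] [Module E M] :
    TopologicalSpace M := moduleTopology E M

lemma canonicalTopology_eq (E : Type u) [NormedRing E] (M : Type u) [AddCommGroup M] [Module E M]
    (r : ℕ) (g : (Fin r → E) →ₗ[E] M) (hg : Function.Surjective g) :
    canonicalTopology E M = TopologicalSpace.coinduced g inferInstance :=
  ModuleTopology.eq_coinduced_of_surjective hg

namespace BanachTriangularDecomposition

open ModuleCat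

variable (D : BanachTriangularDecomposition K 𝓡)

/-- The element `∂`, viewed in `𝓡`. -/
def del : 𝓡 := (D.T.del : 𝓡)

/-- The completion `𝓐` of `A`. -/
abbrev A : Subalgebra K 𝓡 := closureIn D.R D.T.A

/-- The completion `𝓑` of `B`. -/
abbrev B : Subalgebra K 𝓡 := closureIn D.R D.T.B

/-- The category `Ô`: finitely generated `𝓡`-modules that are finite over `𝓐` and that admit a
weight space decomposition for the action of `∂`, with respect to the canonical topology. -/
def catOHat : ObjectProperty (ModuleCat.{u} 𝓡) := fun M =>
  Module.Finite 𝓡 M ∧ Module.Finite D.A M ∧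
    @HasWeightDecomposition K _ M _ _ (canonicalTopology 𝓡 M) (act K D.del M)

/-- `M^ws` as an `R`-submodule of the `𝓡`-module `M`. -/
def wsModule (M : ModuleCat.{u} 𝓡) : Submodule D.R M where
  carrier := ws (act K D.del M)
  add_mem' := add_mem
  zero_mem' := zero_mem _
  smul_mem' x _ hm := TriangularDecomposition.smul_mem_ws D.R D.T M x hm

lemma map_mem_wsModule {M N : ModuleCat.{u} 𝓡} (g : M ⟶ N) {m : M} (hm : m ∈ D.wsModule M) :
    g.hom m ∈ D.wsModule N := by
  change m ∈ ws (act K D.del M) at hm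
  change g.hom m ∈ ws (act K D.del N)
  unfold ws at hm
  induction hm using Submodule.iSup_induction' with
  | mem a m hm =>
    refine Submodule.mem_iSup_of_mem a ?_
    rw [Module.End.mem_maxGenEigenspace] at hm ⊢
    obtain ⟨k, hk⟩ := hm
    refine ⟨k, ?_⟩
    have steps : ∀ (j : ℕ) (v : M),
        ((act K D.del N - a • (1 : Module.End K N)) ^ j) (g.hom v) =
        g.hom (((act K D.del M - a • (1 : Module.End K M)) ^ j) v) := by
      intro j
      induction j with
      | zero => intro v; simp
      | succ j ih =>
        intro v
        rw [pow_succ, Module.End.mul_apply, pow_succ, Module.End.mul_apply, ← ih]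
        congr 1
        simp only [act, LinearMap.sub_apply, LinearMap.smul_apply, Module.End.one_apply,
          Algebra.lsmul_coe, map_sub, map_smul]
        rw [← algebraMap_smul 𝓡 a v, map_smul, algebraMap_smul]
    rw [steps, hk, map_zero]
  | zero => rw [map_zero]; exact zero_mem _
  | add m m' _ _ h h' => rw [map_add]; exact add_mem h h'

/-- The functor `(-)^ws : Mod(𝓡) ⥤ Mod(R)`. -/
def wsFunctor : ModuleCat.{u} 𝓡 ⥤ ModuleCat.{u} D.R where
  obj M := ModuleCat.of D.R (D.wsModule M)
  map g := ModuleCat.ofHom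
    { toFun := fun m => ⟨g.hom m, D.map_mem_wsModule g m.2⟩
      map_add' := fun x y => Subtype.ext (map_add g.hom x.1 y.1)
      map_smul' := fun r x => Subtype.ext (map_smul g.hom (r : 𝓡) x.1) }
  map_id _ := rfl
  map_comp _ _ := rfl

/-- The inclusion `R → 𝓡` as a ring homomorphism. -/
abbrev incl : D.R →+* 𝓡 := D.R.val

/-- The functor `𝓡 ⊗_R - : Mod(R) ⥤ Mod(𝓡)`. -/
abbrev extFunctor : ModuleCat.{u} D.R ⥤ ModuleCat.{u} 𝓡 := baseChange D.incl

/-- The functor `𝓡 ⊗_R - : O ⥤ Ô`, once it is known that it takes values in `Ô`. -/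
abbrev extO (hF : ∀ M, D.T.catO M → D.catOHat (D.extFunctor.obj M)) :
    D.T.catO.FullSubcategory ⥤ D.catOHat.FullSubcategory :=
  D.catOHat.lift (D.T.catO.ι ⋙ D.extFunctor) fun M => hF M.obj M.property

/-- The functor `(-)^ws : Ô ⥤ O`, once it is known that it takes values in `O`. -/
abbrev wsO (hG : ∀ M, D.catOHat M → D.T.catO (D.wsFunctor.obj M)) :
    D.catOHat.FullSubcategory ⥤ D.T.catO.FullSubcategory :=
  D.T.catO.lift (D.catOHat.ι ⋙ D.wsFunctor) fun M => hG M.obj M.property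

end BanachTriangularDecomposition

end Banach

/-! ### Abelian subcategories and highest weight categories -/

/-- A full subcategory of `Mod(S)` is a full abelian subcategory: with its induced additive
structure it is an abelian category, and the inclusion is exact. -/
def IsFullAbelianSubcategory {S : Type u} [Ring S] (P : ObjectProperty (ModuleCat.{u} S)) : Prop :=
  (∃ a : Abelian P.FullSubcategory,
      a.toPreadditive = (inferInstance : Preadditive P.FullSubcategory)) ∧
    PreservesFiniteLimits P.ι ∧ PreservesFiniteColimits P.ι

section HighestWeight

universe v' u' l

variable {C : Type u'} [Category.{v'} C] [Preadditive C]

/-- `S` is a subquotient of `X`. For `S` simple and `X` of finite length in an abelian category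
this says that `S` is a composition factor of `X`. -/
def IsSubquotient (S X : C) : Prop :=
  ∃ (Y : C) (i : Y ⟶ X) (q : Y ⟶ S), Mono i ∧ Epi q

/-- `X` has a finite filtration all of whose subquotients are isomorphic to some `Δ x` with
`p x`. -/
inductive HasFiltration {I : Type l} (Δ : I → C) (p : I → Prop) : C → Prop
  | zero (X : C) (h : IsZero X) : HasFiltration Δ p X
  | extend (E : ShortComplex C) (hE : E.ShortExact) (x : I) (hx : p x)
      (e : Nonempty (E.X₃ ≅ Δ x)) (h : HasFiltration Δ p E.X₁) : HasFiltration Δ p E.X₂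

/-- The `K`-linear category `C` is a highest weight category, with weights indexed by `I` ordered
by `lt`, and with standard objects `Δ x`. -/
structure IsHighestWeightCategory (K : Type w) [Field K] [Linear K C] {I : Type l}
    (lt : I → I → Prop) (Δ : I → C) : Prop where
  abelian : ∃ a : Abelian C, a.toPreadditive = (inferInstance : Preadditive C)
  /-- Every object has finite length. -/
  finite_length : ∀ X : C, IsArtinianObject X ∧ IsNoetherianObject X
  finite_hom : ∀ X Y : C, Module.Finite K (X ⟶ Y)
  /-- `lt` is a (strict) partial order on `I` with finite intervals. -/
  strict_order : IsStrictOrder I lt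
  interval_finite : ∀ x y : I, {z | lt x z ∧ lt z y}.Finite
  /-- There are simple objects `L x`, representing each isomorphism class of simple objects
  exactly once, and projective covers `P x` of `L x`, such that
  * `L x` is a quotient of `Δ x`, and the composition factors `L y` of the kernel have `y < x`;
  * `Δ x` is a quotient of `P x`, and the kernel is filtered by objects `Δ y` with `x < y`. -/
  structure_objects : ∃ L P : I → C,
    (∀ x, Simple (L x)) ∧
    (∀ x y, Nonempty (L x ≅ L y) → x = y) ∧
    (∀ S : C, Simple S → ∃ x, Nonempty (S ≅ L x)) ∧
    (∀ x, ∃ (N : C) (i : N ⟶ Δ x) (q : Δ x ⟶ L x) (w : i ≫ q = 0),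
      (ShortComplex.mk i q w).ShortExact ∧ ∀ y, IsSubquotient (L y) N → lt y x) ∧
    (∀ x, Projective (P x) ∧
      (∃ f : P x ⟶ L x, Epi f ∧ ∀ (Y : C) (g : Y ⟶ P x), Epi (g ≫ f) → Epi g) ∧
      ∃ (N : C) (i : N ⟶ P x) (q : P x ⟶ Δ x) (w : i ≫ q = 0),
        (ShortComplex.mk i q w).ShortExact ∧ HasFiltration Δ (fun y => lt x y) N)

end HighestWeight

end TriO

end

/-! The analytic core is that convergent weight expansions are unique. Integers accumulate
p-adically, so continuity of the projections to weight spaces is not evident;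
`eq_zero_of_hasSum_eigenvectors` replaces it. The operator ∏_{i ≤ j} (1 - (D - w)/i) fixes the
eigenvalue w and acts on the eigenvalue w + n + 1 by the integer (-1)^j C(n, j), which vanishes for
n < j. Applied to an expansion of zero, it places the first term in every open subgroup. Over a
noetherian Banach algebra, submodules of finite modules are closed
(`isClosed_submodule_of_isNoetherian`), and a filtration by submodules with cyclic quotients
generated by eigenvectors extends uniqueness to all modules spanned by generalized weight vectors
(`eq_zero_of_hasSum_weights`). Hence a ∂-stable submodule contains the components of its vectors,
and each weight space is spanned by algebraic products of homogeneous elements of A with weight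
generators. This makes Ô stable under subquotients and puts M^ws in O.

The equivalence rests on continuous coefficient maps 𝓡 → 𝓐 (`exists_slices`), built from the
completed tensor decomposition and from functionals on 𝓑 that vanish on the closed left ideal
generated by B_{≥ N} = ⨁_{n ≥ N} B_{-n}. They show that 𝓡 is a finite sum of 𝓐 g, with g in R,
modulo 𝓡 B_{≥ N}, and that R ∩ 𝓡 B_{≥ N} = R B_{≥ N}. The first fact makes 𝓡 ⊗_R M finite over 𝓐 for
M in O. The second embeds Q_N = R / R B_{≥ N} into 𝓡 / 𝓡 B_{≥ N}, and through presentations it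
embeds every object of O into an 𝓡-module (`exists_embedding`); so M → 𝓡 ⊗_R M is injective without
any flatness. Its image is the whole weight part by the product description, and 𝓡 ⊗_R M^ws → M is
injective because its kernel would be spanned by weight vectors.

The simple objects, projective covers and standard filtrations are constructed in O and transported.
On vectors killed by B_{<0} one has ∂ = -∂₀ with ∂₀ central in the split algebra H, so all weights
in O lie in finitely many sets -z + ℕ. This gives the artinian property and the theory of lowest
weight quotients Δ(W) → L(W). Maps out of Q_N are vectors killed by B_{≥ N}; for N large the summand
of Q_N cut out by a weight is therefore projective, and a minimal summand that maps nontrivially to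
L(W) is a projective cover by Fitting's lemma (`exists_projective_cover`). Finally Q_N is free over
A on weight vectors. The consequence `LowFree` of this survives passage to direct summands, and it
makes the layers of the filtration by the submodules `low` iterated extensions of Verma modules
(`exists_verma_subquotient`). -/

noncomputable section

namespace TriO

set_option linter.unusedSectionVars false

/-! ### Finitely generated modules over noetherian Banach algebras -/

section BanachModules

variable {K : Type*} [NontriviallyNormedField K]
  {E : Type*} [NormedRing E] [NormedAlgebra K E] [CompleteSpace E]

include K in
/-- Submodules of noetherian Banach modules are closed. -/
theorem isClosed_submodule_of_isNoetherian {F : Type*} [NormedAddCommGroup F] [NormedSpace K F]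
    [Module E F] [IsScalarTower K E F] [IsBoundedSMul E F] [CompleteSpace F] [IsNoetherian E F]
    (N : Submodule E F) : IsClosed (N : Set F) := by
  have hcs : ContinuousSMul E F := inferInstance
  let C : Submodule E F := N.topologicalClosure
  have hCc : IsClosed (C : Set F) := N.isClosed_topologicalClosure
  have : CompleteSpace C := hCc.completeSpace_coe
  obtain ⟨s, x, hx⟩ := Submodule.fg_iff_exists_fin_generating_family.mp (IsNoetherian.noetherian C)
  have hxC : ∀ i, x i ∈ C := fun i => hx ▸ Submodule.subset_span ⟨i, rfl⟩
  let C' : Submodule K F := C.restrictScalars K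
  have : CompleteSpace C' := hCc.completeSpace_coe
  let comb : (Fin s → C') → (Fin s → E) →L[K] C' := fun y =>
    { toFun := fun e => ∑ i, (⟨e i • (y i : F), C.smul_mem _ (y i).2⟩ : C')
      map_add' := fun e e' => by
        ext; simp [add_smul, Finset.sum_add_distrib]
      map_smul' := fun c e => by
        ext; simp [Finset.smul_sum, smul_assoc]
      cont := by
        refine continuous_finsetSum _ fun i _ => Continuous.subtype_mk ?_ _
        fun_prop }
  have comb_coe : ∀ y e, ((comb y e : C') : F) = ∑ i, e i • (y i : F) := fun y e => by
    simp [comb]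
  let f := comb fun i => ⟨x i, hxC i⟩
  have hf : f.range = ⊤ := by
    rw [LinearMap.range_eq_top]
    rintro ⟨z, hz⟩
    have hz' : z ∈ Submodule.span E (Set.range x) := hx ▸ hz
    obtain ⟨e, he⟩ := (Submodule.mem_span_range_iff_exists_fun E).mp hz'
    exact ⟨e, Subtype.ext ((comb_coe _ _).trans he)⟩
  -- The open mapping theorem bounds a right inverse of E^s → closure of N. Generators moved by a
  -- small enough amount still generate, and by density they can be moved into N.
  let fs := f.nonlinearRightInverseOfSurjective hf
  have hc : 0 < fs.nnnorm := f.nonlinearRightInverseOfSurjective_nnnorm_pos hf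
  -- This makes `s * δ` strictly smaller than the inverse of the bound of `fs`; `s + 1` keeps the
  -- denominator nonzero when there are no generators.
  let δ : NNReal := fs.nnnorm⁻¹ / 2 / (s + 1)
  have hδ : 0 < δ := by positivity
  have happ : ∀ i, ∃ y : C', (y : F) ∈ N ∧ ‖(y : F) - x i‖ ≤ δ := by
    intro i
    obtain ⟨y, hy, hd⟩ := Metric.mem_closure_iff.mp (show x i ∈ closure (N : Set F) from hxC i) δ
      (by exact_mod_cast hδ)
    exact ⟨⟨y, subset_closure hy⟩, hy, by rw [← dist_eq_norm, dist_comm]; exact hd.le⟩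
  choose y hyN hyx using happ
  let g := comb y
  have hdiff : ∀ e, ‖g e - f e‖ ≤ (s * δ : NNReal) * ‖e‖ := by
    intro e
    have : ((g e - f e : C') : F) = ∑ i, e i • ((y i : F) - x i) := by
      rw [AddSubgroupClass.coe_sub, comb_coe, comb_coe, ← Finset.sum_sub_distrib]
      simp [smul_sub]
    change ‖((g e - f e : C') : F)‖ ≤ _
    rw [this]
    calc _ ≤ ∑ i : Fin s, ‖e‖ * δ := norm_sum_le_of_le _ fun i _ =>
            (norm_smul_le _ _).trans (mul_le_mul (norm_le_pi_norm e i) (hyx i) (norm_nonneg _)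
              (norm_nonneg _))
      _ = _ := by simp; ring
  have hlt : (s * δ : NNReal) < fs.nnnorm⁻¹ := by
    have h1 : (0 : NNReal) < fs.nnnorm⁻¹ := by positivity
    have : (s * δ : NNReal) = fs.nnnorm⁻¹ / 2 * (s / (s + 1)) := by
      simp only [δ]; ring
    rw [this]
    calc _ ≤ fs.nnnorm⁻¹ / 2 * 1 := by
            gcongr
            exact div_le_one_of_le₀ (by simp) (by positivity)
      _ < _ := by rw [mul_one]; exact NNReal.half_lt_self h1.ne'
  have happrox : ApproximatesLinearOn g f Set.univ (s * δ) := by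
    intro a _ b _
    have := hdiff (a - b)
    rwa [map_sub] at this
  have hpos : (0 : ℝ) < (fs.nnnorm⁻¹ : NNReal) - (s * δ : NNReal) := sub_pos.mpr (by exact_mod_cast hlt)
  refine isClosed_of_closure_subset fun z hz => ?_
  let z' : C' := ⟨z, hz⟩
  obtain ⟨e, -, he⟩ := happrox.surjOn_closedBall_of_nonlinearRightInverse fs
    (ε := ‖z'‖ / ((fs.nnnorm⁻¹ : NNReal) - (s * δ : NNReal))) (b := 0) (by positivity)
    (Set.subset_univ _) (a := z') (by
      rw [map_zero, mem_closedBall_zero_iff, NNReal.coe_inv, mul_div_cancel₀]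
      rw [← NNReal.coe_inv]; exact hpos.ne')
  have : z = ∑ i, e i • (y i : F) := by
    rw [← comb_coe]; exact (congrArg Subtype.val he).symm
  rw [this]
  exact N.sum_mem fun i _ => N.smul_mem _ (hyN i)

variable [IsNoetherianRing E] {M : Type*} [AddCommGroup M] [Module E M] [Module.Finite E M]

-- M carries the quotient topology of some E^r, so closedness can be tested on the preimage, where
-- the noetherian Banach case applies.
include K in
theorem isClosed_submodule_of_finite [TopologicalSpace M] [IsModuleTopology E M]
    (N : Submodule E M) : IsClosed (N : Set M) := by
  obtain ⟨r, g, hg⟩ := Module.Finite.exists_fin' E M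
  have hq := IsModuleTopology.isQuotientMap_of_surjective (R := E) (φ := g) hg
  rw [← hq.isClosed_preimage]
  exact isClosed_submodule_of_isNoetherian (K := K) (N.comap g)

include K in
theorem t2Space_of_finite [TopologicalSpace M] [IsModuleTopology E M] : T2Space M := by
  have := IsModuleTopology.topologicalAddGroup E M
  have h := isClosed_submodule_of_finite (K := K) (⊥ : Submodule E M)
  have : T1Space M := IsTopologicalAddGroup.t1Space M (by simpa using h)
  infer_instance

omit [CompleteSpace E] [IsNoetherianRing E] [NormedAlgebra K E] in
theorem nonarchimedeanAddGroup_of_finite [IsUltrametricDist E] [TopologicalSpace M]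
    [IsModuleTopology E M] : NonarchimedeanAddGroup M := by
  have := IsModuleTopology.topologicalAddGroup E M
  obtain ⟨r, g, hg⟩ := Module.Finite.exists_fin' E M
  have hq := IsModuleTopology.isOpenQuotientMap_of_surjective (R := E) (φ := g) hg
  refine ⟨fun U hU => ?_⟩
  obtain ⟨V, hV⟩ := NonarchimedeanAddGroup.is_nonarchimedean (G := Fin r → E) (g ⁻¹' U)
    (hq.continuous.continuousAt.preimage_mem_nhds (by simpa using hU))
  refine ⟨⟨V.toAddSubgroup.map g.toAddMonoidHom, hq.isOpenMap _ V.isOpen⟩, ?_⟩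
  rintro _ ⟨v, hv, rfl⟩
  exact hV hv

/-- A module that is finite over a noetherian Banach algebra and over a closed noetherian
subalgebra has the same canonical topology for both. -/
theorem moduleTopology_eq_of_finite (S : Subalgebra K E) [CompleteSpace S] [IsNoetherianRing S]
    [Module.Finite S M] : moduleTopology S M = moduleTopology E M := by
  obtain ⟨r, g, hg⟩ := Module.Finite.exists_fin' E M
  obtain ⟨s, h, hh⟩ := Module.Finite.exists_fin' S M
  have hgc : IsClosed (g.ker : Set (Fin r → E)) := isClosed_submodule_of_isNoetherian (K := K) _
  have hhc : IsClosed (h.ker : Set (Fin s → S)) := isClosed_submodule_of_isNoetherian (K := K) _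
  let e₁ : ((Fin r → E) ⧸ g.ker) ≃ₗ[E] M := g.quotKerEquivOfSurjective hg
  let e₂ : ((Fin s → S) ⧸ h.ker) ≃ₗ[S] M := h.quotKerEquivOfSurjective hh
  let φ₀ : ((Fin s → S) ⧸ h.ker) ≃ₗ[S] ((Fin r → E) ⧸ g.ker) :=
    e₂.trans (e₁.restrictScalars S).symm
  have hφc : Continuous φ₀ := IsModuleTopology.continuous_of_linearMap φ₀.toLinearMap
  let φ : ((Fin s → S) ⧸ h.ker) →L[K] ((Fin r → E) ⧸ g.ker) :=
    ⟨φ₀.toLinearMap.restrictScalars K, hφc⟩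
  -- Both presentations are Banach spaces because the kernels are closed. The identity of M is
  -- continuous in one direction by S-linearity, and the open mapping theorem supplies the other.
  let ψ := ContinuousLinearEquiv.ofBijective φ
    (LinearMap.ker_eq_bot.mpr φ₀.injective) (LinearMap.range_eq_top.mpr φ₀.surjective)
  have hψ : ∀ x, ψ x = φ₀ x := fun x => rfl
  have h₁ : moduleTopology E M = TopologicalSpace.coinduced e₁ inferInstance :=
    ModuleTopology.eq_coinduced_of_surjective (φ := e₁.toLinearMap) e₁.surjective
  have h₂ : moduleTopology S M = TopologicalSpace.coinduced e₂ inferInstance :=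
    ModuleTopology.eq_coinduced_of_surjective (φ := e₂.toLinearMap) e₂.surjective
  have hcomp : (e₂ : _ → M) = e₁ ∘ ψ := by
    funext x
    simp [hψ, φ₀]
  rw [h₁, h₂, hcomp, ← coinduced_compose]
  congr 1
  exact ψ.toHomeomorph.coinduced_eq

end BanachModules

/-! ### Uniqueness of weight expansions -/

section Uniqueness

open Filter Topology

variable {K : Type*} [Field K] [CharZero K] {M : Type*} [AddCommGroup M] [Module K M]
  [TopologicalSpace M] [NonarchimedeanAddGroup M] [T2Space M] [ContinuousConstSMul K M]

/-- The operator `∏_{i=1}^j (1 - (D - w) / i)`. -/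
def lagrangeOp (D : Module.End K M) (w : K) : ℕ → Module.End K M
  | 0 => 1
  | j + 1 => (1 - ((j : K) + 1)⁻¹ • (D - w • (1 : Module.End K M))) * lagrangeOp D w j

omit [NonarchimedeanAddGroup M] [T2Space M] [CharZero K] in
theorem continuous_lagrangeOp [IsTopologicalAddGroup M] {D : Module.End K M} (hD : Continuous D)
    (w : K) (j : ℕ) : Continuous (lagrangeOp D w j) := by
  induction j with
  | zero => exact continuous_id
  | succ j ih =>
    have : ∀ x, lagrangeOp D w (j + 1) x = lagrangeOp D w j x -
        ((j : K) + 1)⁻¹ • (D (lagrangeOp D w j x) - w • lagrangeOp D w j x) := fun x => by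
      simp [lagrangeOp]
    rw [show ⇑(lagrangeOp D w (j + 1)) = fun x => _ from funext this]
    exact ih.sub (((hD.comp ih).sub (ih.const_smul w)).const_smul _)

omit [NonarchimedeanAddGroup M] [T2Space M] [ContinuousConstSMul K M] [CharZero K]
  [TopologicalSpace M] in
theorem lagrangeOp_apply_zero {D : Module.End K M} {w : K} {x : M} (hx : D x = w • x) (j : ℕ) :
    lagrangeOp D w j x = x := by
  induction j with
  | zero => rfl
  | succ j ih => simp [lagrangeOp, ih, hx]

-- The factor of index i acts by (i - n - 1)/i, and the product is a signed binomial coefficient.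
-- Two features matter: it is an integer, so it preserves open subgroups, and it vanishes for n < j.
omit [NonarchimedeanAddGroup M] [T2Space M] [ContinuousConstSMul K M] [TopologicalSpace M] in
theorem lagrangeOp_apply_succ {D : Module.End K M} {w : K} {n : ℕ} {x : M}
    (hx : D x = (w + (n + 1 : ℕ)) • x) (j : ℕ) :
    lagrangeOp D w j x = ((-1) ^ j * n.choose j : ℤ) • x := by
  induction j with
  | zero => simp [lagrangeOp]
  | succ j ih =>
    have hj : (j : K) + 1 ≠ 0 := by exact_mod_cast Nat.succ_ne_zero j
    have key : ((n.choose (j + 1) : ℕ) : K) * (j + 1) = (n.choose j : ℕ) * (n - j) := by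
      rcases le_or_gt j n with h | h
      · have := Nat.choose_succ_right_eq n j
        rw [← Nat.cast_sub h]
        exact_mod_cast this
      · simp [Nat.choose_eq_zero_of_lt h, Nat.choose_eq_zero_of_lt (h.trans (Nat.lt_succ_self j))]
    rw [lagrangeOp, Module.End.mul_apply, ih, map_zsmul]
    have h1 : (1 - ((j : K) + 1)⁻¹ • (D - w • (1 : Module.End K M))) x =
        (((j : K) - n) * ((j : K) + 1)⁻¹) • x := by
      simp only [LinearMap.sub_apply, Module.End.one_apply, LinearMap.smul_apply, hx, add_smul,
        add_sub_cancel_left, smul_smul]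
      nth_rw 1 [← one_smul K x]
      rw [← sub_smul]
      congr 1
      field_simp
      push_cast
      ring
    rw [h1, ← Int.cast_smul_eq_zsmul K, ← Int.cast_smul_eq_zsmul K, smul_smul]
    congr 1
    push_cast
    field_simp
    rw [pow_succ]
    linear_combination (-1) ^ j * key

/-- A convergent expansion in eigenvectors with eigenvalues in `w + ℕ` is unique. -/
theorem eq_zero_of_hasSum_eigenvectors {D : Module.End K M} (hD : Continuous D) {w : K}
    {x : ℕ → M} (hx : ∀ n, D (x n) = (w + n) • x n) (h : HasSum x 0) : x = 0 := by
  -- `lagrangeOp D w j` fixes the first term, kills the next j terms and multiplies the others by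
  -- integers. Once all terms from index j on lie in an open subgroup U, so does the first term.
  have head : ∀ (w : K) (x : ℕ → M), (∀ n, D (x n) = (w + n) • x n) → HasSum x 0 → x 0 = 0 := by
    clear hx h x w
    intro w x hx h
    have mem : ∀ U : OpenAddSubgroup M, x 0 ∈ U := by
      intro U
      have htend : ∀ᶠ n in atTop, x n ∈ U := by
        have := h.summable.tendsto_cofinite_zero
        rw [Nat.cofinite_eq_atTop] at this
        exact this (U.mem_nhds_zero)
      obtain ⟨j, hj⟩ := eventually_atTop.mp htend
      have h1 : HasSum (fun n => lagrangeOp D w j (x n)) 0 := by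
        have := h.map (lagrangeOp D w j) (continuous_lagrangeOp hD w j)
        rwa [map_zero] at this
      have h2 := (hasSum_nat_add_iff' 1).mpr h1
      rw [Finset.sum_range_one, lagrangeOp_apply_zero (by simpa using hx 0), zero_sub] at h2
      have h3 : -x 0 ∈ (U : Set M) := by
        refine U.isClosed.mem_of_tendsto h2 (Eventually.of_forall fun s => ?_)
        refine sum_mem fun n _ => ?_
        rw [lagrangeOp_apply_succ (hx (n + 1))]
        rcases le_or_gt j n with hn | hn
        · exact zsmul_mem (hj _ (hn.trans n.le_succ)) _
        · rw [Nat.choose_eq_zero_of_lt hn]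
          simp
      simpa using h3
    by_contra hne
    obtain ⟨U, hU⟩ := NonarchimedeanAddGroup.is_nonarchimedean (G := M) {x 0}ᶜ
      (isOpen_compl_singleton.mem_nhds (Ne.symm hne))
    exact hU (mem U) rfl
  -- The terms before n are already zero; dropping them leaves an expansion of zero that starts at
  -- the eigenvalue w + n.
  have all : ∀ n, x n = 0 := by
    intro n
    induction n using Nat.strong_induction_on with
    | _ n ih =>
      have h2 := (hasSum_nat_add_iff' n).mpr h
      rw [Finset.sum_eq_zero fun i hi => ih i (Finset.mem_range.mp hi), sub_zero] at h2
      have := head (w + n) (fun k => x (k + n)) (fun k => by rw [hx]; push_cast; congr 1; ring) h2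
      simpa using this
  exact funext all

end Uniqueness

/-! ### Weight vectors of modules over a Banach algebra with an expanding derivation -/

section WeightModules

variable {K : Type*} [NontriviallyNormedField K] {E : Type*} [NormedRing E] [NormedAlgebra K E]

/-- `E` is the completed sum of the eigenspaces `𝒜 n` of `δ` with eigenvalues `n ∈ ℕ`. -/
structure IsExpanding (δ : Module.End K E) (𝒜 : ℕ → Submodule K E) : Prop where
  apply : ∀ n, ∀ a ∈ 𝒜 n, δ a = (n : K) • a
  exists_hasSum : ∀ a, ∃ f : ℕ → E, (∀ n, f n ∈ 𝒜 n) ∧ HasSum f a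

variable {M : Type*} [AddCommGroup M] [Module E M] [Module K M] [IsScalarTower K E M]

/-- The endomorphism of `M ⧸ N` induced by `D`. -/
def quotEnd (N : Submodule E M) (D : Module.End K M) (h : ∀ x ∈ N, D x ∈ N) :
    Module.End K (M ⧸ N) where
  toFun := QuotientAddGroup.map N.toAddSubgroup N.toAddSubgroup D.toAddMonoidHom h
  map_add' := map_add _
  map_smul' c x := by
    induction x using Submodule.Quotient.induction_on with
    | _ x => exact congrArg Submodule.Quotient.mk (map_smul D c x)

theorem quotEnd_mk (N : Submodule E M) (D : Module.End K M) (h : ∀ x ∈ N, D x ∈ N) (x : M) :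
    quotEnd N D h (Submodule.Quotient.mk x) = Submodule.Quotient.mk (D x) := rfl

/-- The set of generalized weight vectors. -/
def weightVectors {K M : Type*} [CommRing K] [AddCommGroup M] [Module K M] (D : Module.End K M) :
    Set M := {m | ∃ μ, m ∈ D.maxGenEigenspace μ}

theorem map_mem_maxGenEigenspace {K M N : Type*} [CommRing K] [AddCommGroup M] [Module K M]
    [AddCommGroup N] [Module K N] {D : Module.End K M} {D' : Module.End K N} (f : M →ₗ[K] N)
    (h : ∀ x, f (D x) = D' (f x)) {μ : K} {m : M} (hm : m ∈ D.maxGenEigenspace μ) :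
    f m ∈ D'.maxGenEigenspace μ := by
  rw [Module.End.mem_maxGenEigenspace] at hm ⊢
  obtain ⟨k, hk⟩ := hm
  refine ⟨k, ?_⟩
  have : ∀ (k : ℕ) (m : M), ((D' - μ • (1 : Module.End K N)) ^ k) (f m) =
      f (((D - μ • (1 : Module.End K M)) ^ k) m) := by
    intro k
    induction k with
    | zero => intro m; rfl
    | succ k ih =>
      intro m
      rw [pow_succ, Module.End.mul_apply, pow_succ, Module.End.mul_apply, ← ih]
      simp [h]
  rw [this, hk, map_zero]

theorem quotEnd_mem (N : Submodule E M) (D : Module.End K M) (h : ∀ x ∈ N, D x ∈ N) {μ : K}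
    {m : M} (hm : m ∈ D.maxGenEigenspace μ) :
    (Submodule.Quotient.mk m : M ⧸ N) ∈ (quotEnd N D h).maxGenEigenspace μ :=
  map_mem_maxGenEigenspace (D' := quotEnd N D h) (N.mkQ.restrictScalars K) (fun _ => rfl) hm

/-- Submodules that can be built up by successively adding vectors that are eigenvectors of `D`
modulo the submodule constructed before. -/
inductive WeightFiltered (D : Module.End K M) : Submodule E M → Prop
  | bot : WeightFiltered D ⊥
  | sup (N : Submodule E M) (m : M) (w : K) (hN : WeightFiltered D N) (hm : D m - w • m ∈ N) :
      WeightFiltered D (N ⊔ Submodule.span E {m})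

variable {δ : Module.End K E} {𝒜 : ℕ → Submodule K E} {D : Module.End K M}

theorem WeightFiltered.apply_mem (hD : ∀ (a : E) (m : M), D (a • m) = δ a • m + a • D m)
    {N : Submodule E M} (hN : WeightFiltered D N) : ∀ x ∈ N, D x ∈ N := by
  induction hN with
  | bot => intro x hx; rw [(Submodule.mem_bot E).mp hx, map_zero]; exact zero_mem _
  | sup N m w hN hm ih =>
    intro x hx
    obtain ⟨y, hy, z, hz, rfl⟩ := Submodule.mem_sup.mp hx
    obtain ⟨a, rfl⟩ := Submodule.mem_span_singleton.mp hz
    have hm' : m ∈ N ⊔ Submodule.span E {m} :=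
      Submodule.mem_sup_right (Submodule.mem_span_singleton_self m)
    rw [map_add, hD]
    refine add_mem (Submodule.mem_sup_left (ih y hy)) (add_mem (Submodule.smul_mem _ _ hm')
      (Submodule.smul_mem _ _ ?_))
    have : D m = (D m - w • m) + w • m := by abel
    rw [this]
    refine add_mem (Submodule.mem_sup_left hm) ?_
    rw [← algebraMap_smul E w m]
    exact Submodule.smul_mem _ _ hm'

/-- A maximal filtered submodule N exists by noetherianity. A vector that is an eigenvector modulo N
could be added to N, so it lies in N; induction on the nilpotency order then absorbs every
generalized weight vector. -/
theorem weightFiltered_top [IsNoetherian E M]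
    (hspan : Submodule.span E (weightVectors D) = ⊤) :
    WeightFiltered D (⊤ : Submodule E M) := by
  obtain ⟨N, hN, hmax⟩ := set_has_maximal_iff_noetherian.mpr (inferInstanceAs (IsNoetherian E M))
    {N : Submodule E M | WeightFiltered D N} ⟨⊥, .bot⟩
  have key : ∀ (μ : K) (k : ℕ) (m : M),
      ((D - μ • (1 : Module.End K M)) ^ k) m ∈ N → m ∈ N := by
    intro μ k
    induction k with
    | zero => intro m hm; simpa using hm
    | succ k ih =>
      intro m hm
      have h1 : D m - μ • m ∈ N := by
        refine ih _ ?_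
        rw [pow_succ] at hm
        simpa using hm
      by_contra hne
      refine hmax _ (WeightFiltered.sup N m μ hN h1) (lt_of_le_of_ne le_sup_left fun h => hne ?_)
      rw [h]
      exact Submodule.mem_sup_right (Submodule.mem_span_singleton_self m)
  have : N = ⊤ := by
    rw [eq_top_iff, ← hspan, Submodule.span_le]
    rintro m ⟨μ, hm⟩
    rw [Module.End.mem_maxGenEigenspace] at hm
    obtain ⟨k, hk⟩ := hm
    exact key μ k m (hk ▸ zero_mem _)
  rwa [this] at hN

theorem smul_mem_maxGenEigenspace (hE : IsExpanding δ 𝒜)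
    (hD : ∀ (a : E) (m : M), D (a • m) = δ a • m + a • D m) {n : ℕ} {a : E} (ha : a ∈ 𝒜 n)
    {μ : K} {m : M} (hm : m ∈ D.maxGenEigenspace μ) :
    a • m ∈ D.maxGenEigenspace (μ + n) := by
  rw [Module.End.mem_maxGenEigenspace] at hm ⊢
  obtain ⟨k, hk⟩ := hm
  refine ⟨k, ?_⟩
  have smul_comm' : ∀ (c : K) (v : M), a • c • v = c • a • v := fun c v => by
    rw [← algebraMap_smul E c v, ← mul_smul, ← Algebra.commutes, mul_smul, algebraMap_smul]
  have : ∀ (k : ℕ) (m : M), ((D - (μ + n) • (1 : Module.End K M)) ^ k) (a • m) =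
      a • ((D - μ • (1 : Module.End K M)) ^ k) m := by
    intro k
    induction k with
    | zero => intro m; rfl
    | succ k ih =>
      intro m
      rw [pow_succ, Module.End.mul_apply, pow_succ, Module.End.mul_apply, ← ih]
      congr 1
      simp only [LinearMap.sub_apply, LinearMap.smul_apply, LinearMap.add_apply,
        Module.End.one_apply, hD, hE.apply n a ha, smul_assoc, add_smul, smul_sub, smul_comm']
      abel
  rw [this, hk, smul_zero]

/-- The span of the products `a • m` of weight `μ`, for `a` in some `𝒜 n` and `m ∈ S`. -/
def productWeightSpan (𝒜 : ℕ → Submodule K E) (D : Module.End K M) (S : Set M) (μ : K) :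
    Submodule K M :=
  Submodule.span K {y | ∃ (n : ℕ) (w : K) (a : E) (m : M), a ∈ 𝒜 n ∧ m ∈ S ∧
    m ∈ D.maxGenEigenspace w ∧ w + n = μ ∧ y = a • m}

theorem productWeightSpan_le (hE : IsExpanding δ 𝒜)
    (hD : ∀ (a : E) (m : M), D (a • m) = δ a • m + a • D m) (S : Set M) (μ : K) :
    productWeightSpan 𝒜 D S μ ≤ D.maxGenEigenspace μ := by
  refine Submodule.span_le.mpr ?_
  rintro _ ⟨n, w, a, m, ha, -, hm, rfl, rfl⟩
  exact smul_mem_maxGenEigenspace hE hD ha hm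

/-- It suffices to expand the coefficient a of a product a • m into its homogeneous parts. In
characteristic zero n ↦ w + n is injective, so the resulting family can be indexed by weights, with
zero elsewhere. -/
theorem exists_hasSum_productWeightSpan [CharZero K] [TopologicalSpace M] [ContinuousAdd M]
    [ContinuousSMul E M] (hE : IsExpanding δ 𝒜) {S : Set M} (hS : S ⊆ weightVectors D) {v : M}
    (hv : v ∈ Submodule.span E S) :
    ∃ g : K → M, (∀ μ, g μ ∈ productWeightSpan 𝒜 D S μ) ∧ HasSum g v := by
  induction hv using Submodule.closure_induction with
  | zero => exact ⟨0, fun _ => zero_mem _, hasSum_zero⟩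
  | add x y _ _ hx hy =>
    obtain ⟨g, hg, hgs⟩ := hx
    obtain ⟨g', hg', hgs'⟩ := hy
    exact ⟨g + g', fun μ => add_mem (hg μ) (hg' μ), hgs.add hgs'⟩
  | smul_mem a m hm =>
    obtain ⟨w, hw⟩ := hS hm
    obtain ⟨f, hf, hfs⟩ := hE.exists_hasSum a
    have hinj : Function.Injective fun n : ℕ => w + (n : K) := fun n n' h => by
      simpa using h
    refine ⟨Function.extend (fun n : ℕ => w + (n : K)) (fun n => f n • m) 0, fun μ => ?_, ?_⟩
    · by_cases hμ : ∃ n : ℕ, w + (n : K) = μ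
      · obtain ⟨n, rfl⟩ := hμ
        rw [hinj.extend_apply]
        exact Submodule.subset_span ⟨n, w, f n, m, hf n, hm, hw, rfl, rfl⟩
      · rw [Function.extend_apply' _ _ _ hμ]
        exact zero_mem _
    · rw [hasSum_extend_zero hinj]
      exact hfs.map ((LinearMap.toSpanSingleton E M m).toAddMonoidHom)
        (continuous_id.smul continuous_const)

variable [CharZero K] [TopologicalSpace M] [NonarchimedeanAddGroup M] [T2Space M]
  [ContinuousSMul E M]

/-- Expand v = Σ f n • m into eigenvectors for w + n. A power of D - μ killing v multiplies these
terms by powers of w + n - μ, so uniqueness removes every term with w + n ≠ μ. In particular v is an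
honest eigenvector. -/
theorem eigenspace_span_singleton [ContinuousConstSMul K M] (hDc : Continuous D)
    (hE : IsExpanding δ 𝒜) (hD : ∀ (a : E) (m : M), D (a • m) = δ a • m + a • D m)
    {m : M} {w : K} (hm : D m = w • m) {v : M} (hv : v ∈ Submodule.span E {m}) {μ : K}
    (hvμ : v ∈ D.maxGenEigenspace μ) :
    v = 0 ∨ D v = μ • v ∧ ∃ n : ℕ, μ = w + n := by
  obtain ⟨a, rfl⟩ := Submodule.mem_span_singleton.mp hv
  obtain ⟨f, hf, hfs⟩ := hE.exists_hasSum a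
  have hsum : HasSum (fun n => f n • m) (a • m) :=
    hfs.map ((LinearMap.toSpanSingleton E M m).toAddMonoidHom)
      (continuous_id.smul continuous_const)
  have hDf : ∀ n, D (f n • m) = (w + n) • f n • m := fun n => by
    rw [hD, hE.apply n _ (hf n), hm, ← algebraMap_smul E w m, ← mul_smul, ← Algebra.commutes,
      mul_smul, algebraMap_smul, smul_assoc, add_smul, add_comm]
  rw [Module.End.mem_maxGenEigenspace] at hvμ
  obtain ⟨k, hk⟩ := hvμ
  have hpow : ∀ (k n : ℕ), ((D - μ • (1 : Module.End K M)) ^ k) (f n • m) =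
      (w + n - μ) ^ k • f n • m := by
    intro k n
    induction k with
    | zero => simp
    | succ k ih =>
      rw [pow_succ', Module.End.mul_apply, ih, map_smul]
      simp only [LinearMap.sub_apply, LinearMap.smul_apply, Module.End.one_apply, hDf, ← sub_smul,
        smul_smul]
      rw [pow_succ]
  have hcont : ∀ k : ℕ, Continuous ((D - μ • (1 : Module.End K M)) ^ k) := by
    intro k
    induction k with
    | zero => exact continuous_id
    | succ k ih =>
      rw [pow_succ', Module.End.mul_eq_comp, LinearMap.coe_comp]
      exact (hDc.sub (continuous_id.const_smul μ)).comp ih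
  have hzero : HasSum (fun n : ℕ => (w + n - μ) ^ k • f n • m) 0 := by
    have := hsum.map ((D - μ • (1 : Module.End K M)) ^ k) (hcont k)
    rw [hk] at this
    simpa only [Function.comp_def, hpow] using this
  have hall := eq_zero_of_hasSum_eigenvectors (w := w) hDc
    (fun n => by rw [map_smul, hDf, smul_comm]) hzero
  by_cases hμ : ∃ n : ℕ, μ = w + n
  · right
    obtain ⟨n, rfl⟩ := hμ
    have hn : a • m = f n • m := by
      refine hsum.unique (hasSum_single n fun n' hn' => ?_)
      have := congrFun hall n'
      simp only [Pi.zero_apply] at this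
      refine (smul_eq_zero.mp this).resolve_left (pow_ne_zero _ ?_)
      rw [add_sub_add_left_eq_sub, sub_ne_zero]
      exact_mod_cast hn'
    exact ⟨by rw [hn, hDf], n, rfl⟩
  · left
    have hn : (fun n : ℕ => f n • m) = 0 := by
      funext n
      have := congrFun hall n
      simp only [Pi.zero_apply] at this
      refine (smul_eq_zero.mp this).resolve_left (pow_ne_zero _ ?_)
      rw [sub_ne_zero]
      exact fun h => hμ ⟨n, h.symm⟩
    rw [hn] at hsum
    exact hsum.unique hasSum_zero

theorem eq_zero_of_hasSum_span_singleton [ContinuousConstSMul K M] (hDc : Continuous D)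
    (hE : IsExpanding δ 𝒜) (hD : ∀ (a : E) (m : M), D (a • m) = δ a • m + a • D m)
    {m : M} {w : K} (hm : D m = w • m) {v : K → M} (hv : ∀ μ, v μ ∈ Submodule.span E {m})
    (hvμ : ∀ μ, v μ ∈ D.maxGenEigenspace μ) (h : HasSum v 0) : v = 0 := by
  have hinj : Function.Injective fun n : ℕ => w + (n : K) := fun n n' h => by
    simpa using h
  have key := fun μ => eigenspace_span_singleton hDc hE hD hm (hv μ) (hvμ μ)
  have hsupp : ∀ μ ∉ Set.range (fun n : ℕ => w + (n : K)), v μ = 0 := by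
    intro μ hμ
    refine (key μ).resolve_right ?_
    rintro ⟨-, n, rfl⟩
    exact hμ ⟨n, rfl⟩
  have h' := (hinj.hasSum_iff hsupp).mpr h
  have hz := eq_zero_of_hasSum_eigenvectors (w := w) hDc (fun n => by
    rcases key (w + n) with h0 | h0
    · simp [h0]
    · exact h0.1) h'
  funext μ
  by_cases hμ : μ ∈ Set.range (fun n : ℕ => w + (n : K))
  · obtain ⟨n, rfl⟩ := hμ
    exact congrFun hz n
  · exact hsupp μ hμ

end WeightModules

/-! ### Uniqueness of weight expansions in finite modules -/

section FiniteWeightModules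

variable {K : Type*} [NontriviallyNormedField K] [CharZero K] {E : Type*} [NormedRing E]
  [NormedAlgebra K E] [CompleteSpace E] [IsUltrametricDist E] [IsNoetherianRing E]
  {M : Type*} [AddCommGroup M] [Module E M] [Module K M] [IsScalarTower K E M]
  [Module.Finite E M] [TopologicalSpace M] [IsModuleTopology E M]
  {δ : Module.End K E} {𝒜 : ℕ → Submodule K E} {D : Module.End K M}

theorem continuousConstSMul_of_moduleTopology (K : Type*) [NontriviallyNormedField K] (E : Type*)
    [NormedRing E] [NormedAlgebra K E] (M : Type*) [AddCommGroup M] [Module E M] [Module K M]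
    [IsScalarTower K E M] [TopologicalSpace M] [IsModuleTopology E M] : ContinuousConstSMul K M := by
  have := IsModuleTopology.toContinuousSMul E M
  refine ⟨fun c => ?_⟩
  simp_rw [← algebraMap_smul E c]
  exact continuous_const_smul _

/-- Expansions in generalized weight vectors are unique. -/
theorem eq_zero_of_hasSum_weights (hDc : Continuous D) (hE : IsExpanding δ 𝒜)
    (hD : ∀ (a : E) (m : M), D (a • m) = δ a • m + a • D m)
    (hspan : Submodule.span E (weightVectors D) = ⊤) {v : K → M}
    (hv : ∀ μ, v μ ∈ D.maxGenEigenspace μ) (h : HasSum v 0) : v = 0 := by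
  have := IsModuleTopology.topologicalAddGroup E M
  -- Descend along the filtration: modulo the previous step, the expansion lives in a cyclic module
  -- generated by an eigenvector, where it must vanish. The components thus drop into the smaller
  -- submodule.
  have key : ∀ N : Submodule E M, WeightFiltered D N → (∀ μ, v μ ∈ N) → v = 0 := by
    intro N hN
    induction hN with
    | bot => intro hv0; funext μ; exact (Submodule.mem_bot E).mp (hv0 μ)
    | sup N m w hN hm ih =>
      intro hvN
      refine ih fun μ => ?_
      have hst := hN.apply_mem hD
      have := t2Space_of_finite (K := K) (E := E) (M := M ⧸ N)
      have := nonarchimedeanAddGroup_of_finite (E := E) (M := M ⧸ N)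
      have := continuousConstSMul_of_moduleTopology K E (M ⧸ N)
      have := IsModuleTopology.toContinuousSMul E (M ⧸ N)
      have hq : Topology.IsQuotientMap (Submodule.Quotient.mk : M → M ⧸ N) :=
        (Submodule.isOpenQuotientMap_mkQ N).isQuotientMap
      have hz := eq_zero_of_hasSum_span_singleton (D := quotEnd N D hst) (δ := δ) (𝒜 := 𝒜)
        (m := (Submodule.Quotient.mk m : M ⧸ N)) (w := w)
        (v := fun μ => (Submodule.Quotient.mk (v μ) : M ⧸ N))
        (hq.continuous_iff.mpr (hq.continuous.comp hDc)) hE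
        (fun a x => by
          induction x using Submodule.Quotient.induction_on with
          | _ x => exact congrArg Submodule.Quotient.mk (hD a x))
        (by
          rw [quotEnd_mk, ← sub_eq_zero]
          exact (Submodule.Quotient.mk_eq_zero N).mpr hm)
        (fun μ => by
          obtain ⟨y, hy, z, hz, hyz⟩ := Submodule.mem_sup.mp (hvN μ)
          obtain ⟨a, rfl⟩ := Submodule.mem_span_singleton.mp hz
          refine Submodule.mem_span_singleton.mpr ⟨a, ?_⟩
          change Submodule.Quotient.mk (a • m) = Submodule.Quotient.mk (v μ)
          rw [← hyz, eq_comm, Submodule.Quotient.eq]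
          simpa using hy)
        (fun μ => quotEnd_mem N D hst (hv μ))
        (h.map N.mkQ.toAddMonoidHom hq.continuous)
      exact (Submodule.Quotient.mk_eq_zero N).mp (congrFun hz μ)
  exact key ⊤ (weightFiltered_top hspan) fun _ => Submodule.mem_top

/-- A stable submodule contains the components of its vectors. -/
theorem mem_of_hasSum_weights (hDc : Continuous D) (hE : IsExpanding δ 𝒜)
    (hD : ∀ (a : E) (m : M), D (a • m) = δ a • m + a • D m)
    (hspan : Submodule.span E (weightVectors D) = ⊤) {N : Submodule E M}
    (hN : ∀ x ∈ N, D x ∈ N) {v : K → M} (hv : ∀ μ, v μ ∈ D.maxGenEigenspace μ) {x : M}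
    (hx : x ∈ N) (h : HasSum v x) (μ : K) : v μ ∈ N := by
  have := IsModuleTopology.topologicalAddGroup E M
  have hq : Topology.IsQuotientMap (Submodule.Quotient.mk : M → M ⧸ N) :=
    (Submodule.isOpenQuotientMap_mkQ N).isQuotientMap
  have hz := eq_zero_of_hasSum_weights (D := quotEnd N D hN) (δ := δ) (𝒜 := 𝒜)
    (v := fun μ => (Submodule.Quotient.mk (v μ) : M ⧸ N))
    (hq.continuous_iff.mpr (hq.continuous.comp hDc)) hE
    (fun a x => by
      induction x using Submodule.Quotient.induction_on with
      | _ x => exact congrArg Submodule.Quotient.mk (hD a x))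
    (by
      rw [eq_top_iff, ← N.range_mkQ, LinearMap.range_eq_map, ← hspan, Submodule.map_span]
      refine Submodule.span_mono ?_
      rintro _ ⟨m, ⟨μ, hm⟩, rfl⟩
      exact ⟨μ, quotEnd_mem N D hN hm⟩)
    (fun μ => quotEnd_mem N D hN (hv μ))
    (by
      have := h.map N.mkQ.toAddMonoidHom hq.continuous
      rwa [show N.mkQ.toAddMonoidHom x = 0 from (Submodule.Quotient.mk_eq_zero N).mpr hx] at this)
  exact (Submodule.Quotient.mk_eq_zero N).mp (congrFun hz μ)

/-- If `M` is generated by a set `S` of weight vectors, then its weight spaces are spanned by the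
products of weight `μ`. -/
theorem maxGenEigenspace_le_productWeightSpan (hDc : Continuous D) (hE : IsExpanding δ 𝒜)
    (hD : ∀ (a : E) (m : M), D (a • m) = δ a • m + a • D m) {S : Set M}
    (hS : S ⊆ weightVectors D) (hspan : Submodule.span E S = ⊤) (μ : K) :
    D.maxGenEigenspace μ ≤ productWeightSpan 𝒜 D S μ := by
  classical
  intro v hv
  have := IsModuleTopology.topologicalAddGroup E M
  have := IsModuleTopology.toContinuousSMul E M
  obtain ⟨g, hg, hgs⟩ := exists_hasSum_productWeightSpan hE hS (v := v) (hspan ▸ Submodule.mem_top)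
  -- Uniqueness is applied to the difference of the expansion by products and the expansion of v
  -- with a single term.
  have h1 : HasSum (Pi.single μ v : K → M) v := hasSum_pi_single μ v
  have h2 := hgs.sub h1
  rw [sub_self] at h2
  have hz := eq_zero_of_hasSum_weights (δ := δ) (𝒜 := 𝒜) hDc hE hD
    (top_le_iff.mp (hspan ▸ Submodule.span_mono hS)) (fun ν => by
      refine sub_mem (productWeightSpan_le hE hD S ν (hg ν)) ?_
      rcases eq_or_ne ν μ with rfl | hne
      · simpa using hv
      · rw [Pi.single_eq_of_ne hne]; exact zero_mem _) h2
  have : g μ = v := by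
    have := congrFun hz μ
    simpa [sub_eq_zero] using this
  exact this ▸ hg μ

end FiniteWeightModules

/-! ### Projections of an internal direct sum -/

section InternalProj

/-- The projection onto the `i`-th summand of an internal direct sum. -/
def internalProj {K M ι : Type*} [DecidableEq ι] [Semiring K] [AddCommMonoid M] [Module K M]
    {V : ι → Submodule K M} (h : DirectSum.IsInternal V) (i : ι) : M →ₗ[K] M :=
  (V i).subtype ∘ₗ DirectSum.component K ι (fun i => V i) i ∘ₗ
    (LinearEquiv.ofBijective (DirectSum.coeLinearMap V) h).symm.toLinearMap

variable {K M ι : Type*} [DecidableEq ι] [Semiring K] [AddCommMonoid M] [Module K M]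
  {V : ι → Submodule K M} (h : DirectSum.IsInternal V)

theorem internalProj_mem (i : ι) (x : M) : internalProj h i x ∈ V i := Subtype.coe_prop _

theorem internalProj_symm_apply {i : ι} {x : M} (hx : x ∈ V i) :
    (LinearEquiv.ofBijective (DirectSum.coeLinearMap V) h).symm x =
      DirectSum.lof K ι (fun i => V i) i ⟨x, hx⟩ := by
  rw [LinearEquiv.symm_apply_eq]
  exact (DirectSum.coeLinearMap_lof (A := V) i ⟨x, hx⟩).symm

theorem internalProj_of_mem {i : ι} {x : M} (hx : x ∈ V i) : internalProj h i x = x := by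
  simp only [internalProj, LinearMap.comp_apply, LinearEquiv.coe_coe,
    internalProj_symm_apply h hx]
  simp

theorem internalProj_of_mem_ne {i j : ι} (hij : j ≠ i) {x : M} (hx : x ∈ V j) :
    internalProj h i x = 0 := by
  simp only [internalProj, LinearMap.comp_apply, LinearEquiv.coe_coe,
    internalProj_symm_apply h hx]
  rw [DirectSum.component.of]
  simp [hij]

theorem internalProj_sum (x : M) : ∃ s : Finset ι, x = ∑ i ∈ s, internalProj h i x := by
  have hx : x ∈ iSup V := by
    rw [DirectSum.IsInternal.submodule_iSup_eq_top h]; trivial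
  obtain ⟨f, hf, rfl⟩ := (Submodule.mem_iSup_iff_exists_finsupp V x).mp hx
  refine ⟨f.support, ?_⟩
  rw [Finsupp.sum]
  refine Finset.sum_congr rfl fun i hi => ?_
  rw [map_sum, Finset.sum_eq_single i, internalProj_of_mem h (hf i)]
  · exact fun j _ hj => internalProj_of_mem_ne h hj (hf j)
  · exact fun h => absurd hi h

theorem internalProj_comm {N : Type*} [AddCommMonoid N] [Module K N] {W : ι → Submodule K N}
    (h' : DirectSum.IsInternal W) (f : M →ₗ[K] N) (hf : ∀ i, ∀ x ∈ V i, f x ∈ W i) (i : ι) (x : M) :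
    f (internalProj h i x) = internalProj h' i (f x) := by
  have hx : x ∈ iSup V := by
    rw [DirectSum.IsInternal.submodule_iSup_eq_top h]; trivial
  induction hx using Submodule.iSup_induction' with
  | mem j x hx =>
    rcases eq_or_ne j i with rfl | hne
    · rw [internalProj_of_mem h hx, internalProj_of_mem h' (hf _ _ hx)]
    · rw [internalProj_of_mem_ne h hne hx, internalProj_of_mem_ne h' hne (hf _ _ hx), map_zero]
  | zero => simp
  | add x y _ _ hx hy => simp [hx, hy]

end InternalProj

namespace TriangularDecomposition

variable {K : Type*} [Field K] {R : Type*} [Ring R] [Algebra K R]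
  (T : TriangularDecomposition K R)

/-! ### The graded pieces of `A`, `B` and their products -/

/-- `A_n`. -/
def degA (n : ℕ) : Submodule K R := Subalgebra.toSubmodule T.A ⊓ T.gr n

/-- `B_{-n}`. -/
def degB (n : ℕ) : Submodule K R := Subalgebra.toSubmodule T.B ⊓ T.gr (-n)

/-- `⨁_{n ≥ N} B_{-n}`. -/
def Bge (N : ℕ) : Submodule K R := ⨆ n : ℕ, ⨆ _ : N ≤ n, T.degB n

/-- The projection onto `R_n`. -/
def proj (n : ℤ) : R →ₗ[K] R := internalProj T.isInternal n

/-- The subspace `A`. -/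
abbrev SA : Submodule K R := Subalgebra.toSubmodule T.A
/-- The subspace `H`. -/
abbrev SH : Submodule K R := Subalgebra.toSubmodule T.H
/-- The subspace `B`. -/
abbrev SB : Submodule K R := Subalgebra.toSubmodule T.B

variable {T}

theorem degB_le_Bge {N n : ℕ} (h : N ≤ n) : T.degB n ≤ T.Bge N :=
  le_iSup₂_of_le n h le_rfl

theorem Bge_le_B (N : ℕ) : T.Bge N ≤ T.SB := iSup₂_le fun _ _ => inf_le_left

theorem Bge_anti {M N : ℕ} (h : M ≤ N) : T.Bge N ≤ T.Bge M :=
  iSup₂_le fun _ hn => degB_le_Bge (h.trans hn)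

theorem Bge_zero : T.Bge 0 = T.SB :=
  le_antisymm (Bge_le_B 0) (T.B_graded.trans (iSup_le fun _ => degB_le_Bge (Nat.zero_le _)))

theorem Bge_succ (N : ℕ) : T.Bge N = T.degB N ⊔ T.Bge (N + 1) := by
  refine le_antisymm (iSup₂_le fun n hn => ?_) (sup_le (degB_le_Bge le_rfl) (Bge_anti N.le_succ))
  rcases hn.eq_or_lt with rfl | h
  · exact le_sup_left
  · exact (degB_le_Bge h).trans le_sup_right

theorem Bneg_eq : T.Bneg = T.Bge 1 := by
  refine le_antisymm (iSup_le fun n => ?_) (iSup₂_le fun n hn => ?_)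
  · have : T.SB ⊓ T.gr (-((n : ℤ) + 1)) = T.degB (n + 1) := by simp [degB]
    rw [this]
    exact degB_le_Bge (by omega)
  · obtain ⟨m, rfl⟩ := Nat.exists_eq_add_of_le' hn
    refine le_iSup_of_le m ?_
    simp [degB]

theorem SA_le : T.SA ≤ ⨆ n, T.degA n := T.A_graded

theorem proj_of_mem {n : ℤ} {x : R} (hx : x ∈ T.gr n) : T.proj n x = x :=
  internalProj_of_mem T.isInternal hx

theorem proj_of_mem_ne {n m : ℤ} (h : m ≠ n) {x : R} (hx : x ∈ T.gr m) : T.proj n x = 0 :=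
  internalProj_of_mem_ne T.isInternal h hx

theorem degB_mul_mem {m n : ℕ} {b b' : R} (hb : b ∈ T.degB m) (hb' : b' ∈ T.degB n) :
    b * b' ∈ T.degB (m + n) := by
  refine ⟨T.B.mul_mem hb.1 hb'.1, ?_⟩
  have := T.graded_mul hb.2 hb'.2
  rwa [show (-(m : ℤ) + -(n : ℤ)) = -((m + n : ℕ) : ℤ) by push_cast; ring] at this

theorem Bge_mul_le (M N : ℕ) : T.Bge M * T.Bge N ≤ T.Bge (M + N) := by
  simp only [Bge, Submodule.iSup_mul, Submodule.mul_iSup]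
  refine iSup₂_le fun m hm => iSup₂_le fun n hn => Submodule.mul_le.mpr fun b hb b' hb' => ?_
  exact degB_le_Bge (by omega) (degB_mul_mem hb hb')

theorem mem_gr_zero {h : R} (hh : h ∈ T.H) : h ∈ T.gr 0 := T.H_le hh

theorem degA_zero_eq : T.degA 0 = 1 := by simpa [degA] using T.A_zero

theorem degB_zero_eq : T.degB 0 = 1 := by simpa [degB] using T.B_zero

/-- H sits in degree 0, so projecting the identity BH = HB to degree -n refines it to the graded
pieces. -/
theorem H_mul_degB_le (n : ℕ) : T.SH * T.degB n ≤ T.degB n * T.SH := by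
  have key : ∀ x ∈ T.SB * T.SH, T.proj (-n) x ∈ T.degB n * T.SH := by
    intro x hx
    induction hx using Submodule.mul_induction_on' with
    | mem_mul_mem b hb h hh =>
      have hb' := T.B_graded hb
      clear hb
      induction hb' using Submodule.iSup_induction' with
      | mem m b hb =>
        have : b * h ∈ T.gr (-m) := by simpa using T.graded_mul hb.2 (mem_gr_zero hh)
        rcases eq_or_ne m n with rfl | hne
        · rw [proj_of_mem this]
          exact Submodule.mul_mem_mul hb hh
        · rw [proj_of_mem_ne (by simpa using hne) this]
          exact zero_mem _
      | zero => simp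
      | add x y hx hy ihx ihy =>
        rw [add_mul, map_add]
        exact add_mem ihx ihy
    | add x _ y _ hx hy => rw [map_add]; exact add_mem hx hy
  refine Submodule.mul_le.mpr fun h hh b hb => ?_
  have h1 : h * b ∈ T.gr (-n) := by simpa using T.graded_mul (mem_gr_zero hh) hb.2
  rw [← proj_of_mem h1]
  refine key _ ?_
  rw [T.B_mul_H]
  exact Submodule.mul_mem_mul hh hb.1

theorem degB_mul_H_le (n : ℕ) : T.degB n * T.SH ≤ T.SH * T.degB n := by
  have key : ∀ x ∈ T.SH * T.SB, T.proj (-n) x ∈ T.SH * T.degB n := by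
    intro x hx
    induction hx using Submodule.mul_induction_on' with
    | mem_mul_mem h hh b hb =>
      have hb' := T.B_graded hb
      clear hb
      induction hb' using Submodule.iSup_induction' with
      | mem m b hb =>
        have : h * b ∈ T.gr (-m) := by simpa using T.graded_mul (mem_gr_zero hh) hb.2
        rcases eq_or_ne m n with rfl | hne
        · rw [proj_of_mem this]
          exact Submodule.mul_mem_mul hh hb
        · rw [proj_of_mem_ne (by simpa using hne) this]
          exact zero_mem _
      | zero => simp
      | add x y hx hy ihx ihy =>
        rw [mul_add, map_add]
        exact add_mem ihx ihy
    | add x _ y _ hx hy => rw [map_add]; exact add_mem hx hy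
  refine Submodule.mul_le.mpr fun b hb h hh => ?_
  have h1 : b * h ∈ T.gr (-n) := by simpa using T.graded_mul hb.2 (mem_gr_zero hh)
  rw [← proj_of_mem h1]
  refine key _ ?_
  rw [← T.B_mul_H]
  exact Submodule.mul_mem_mul hb.1 hh

theorem Bge_mul_H (N : ℕ) : T.Bge N * T.SH = T.SH * T.Bge N := by
  simp only [Bge, Submodule.iSup_mul, Submodule.mul_iSup]
  exact iSup_congr fun n => iSup_congr fun _ => le_antisymm (degB_mul_H_le n) (H_mul_degB_le n)

theorem H_mul_H : T.SH * T.SH = T.SH :=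
  T.H.isIdempotentElem_toSubmodule

theorem A_mul_H_mul_B : T.SA * T.SH * T.SB = ⊤ := by
  refine eq_top_iff.mpr fun r hr => ?_
  clear hr
  obtain ⟨t, rfl⟩ := T.bijective_mul.2 r
  induction t using TensorProduct.induction_on with
  | zero => simp
  | add x y hx hy => rw [map_add]; exact add_mem hx hy
  | tmul x b =>
    induction x using TensorProduct.induction_on with
    | zero => simp
    | add x y hx hy => rw [TensorProduct.add_tmul, map_add]; exact add_mem hx hy
    | tmul a h => exact Submodule.mul_mem_mul (Submodule.mul_mem_mul a.2 h.2) b.2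

/-- The left ideal `R (⨁_{n ≥ N} B_{-n})`. -/
def leftIdeal (T : TriangularDecomposition K R) (N : ℕ) : Submodule R R :=
  Submodule.span R (T.Bge N : Set R)

/-- This uses R = AHB together with B · B_{≥ N} ⊆ B_{≥ N}. -/
theorem leftIdeal_eq (N : ℕ) :
    (T.leftIdeal N).restrictScalars K = T.SA * T.SH * T.Bge N := by
  refine le_antisymm (fun x hx => ?_) ?_
  · have hx' : x ∈ Submodule.span R (T.Bge N : Set R) := hx
    have hB : T.SB * T.Bge N ≤ T.Bge N := by
      have := Bge_mul_le (T := T) 0 N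
      rwa [Bge_zero, zero_add] at this
    clear hx
    induction hx' using Submodule.closure_induction with
    | zero => exact zero_mem _
    | add x y hx hy ihx ihy => exact add_mem ihx ihy
    | smul_mem r b hb =>
      have hr : r ∈ T.SA * T.SH * T.SB := by rw [A_mul_H_mul_B]; trivial
      have h1 : r * b ∈ T.SA * T.SH * T.SB * T.Bge N := Submodule.mul_mem_mul hr hb
      rw [mul_assoc] at h1
      exact mul_le_mul' le_rfl hB h1
  · refine Submodule.mul_le.mpr fun x _ b hb => ?_
    exact (T.leftIdeal N).smul_mem x (Submodule.subset_span hb)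

/-- Homogeneous elements have homogeneous triangular expansions. -/
theorem mem_homogeneous {k : ℤ} {r : R} (hr : r ∈ T.gr k) :
    r ∈ ⨆ (i : ℕ) (j : ℕ) (_ : (i : ℤ) - j = k), T.degA i * T.SH * T.degB j := by
  have key : ∀ x ∈ T.SA * T.SH * T.SB,
      T.proj k x ∈ ⨆ (i : ℕ) (j : ℕ) (_ : (i : ℤ) - j = k), T.degA i * T.SH * T.degB j := by
    have hle : T.SA * T.SH * T.SB ≤ ⨆ (i : ℕ) (j : ℕ), T.degA i * T.SH * T.degB j := by
      calc _ ≤ (⨆ i, T.degA i) * T.SH * (⨆ j, T.degB j) :=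
            mul_le_mul' (mul_le_mul' T.A_graded le_rfl) T.B_graded
        _ ≤ _ := by
          simp only [Submodule.iSup_mul, Submodule.mul_iSup]
          rw [iSup_comm]
    refine fun x hx => Submodule.mem_comap.mp (hle.trans (iSup₂_le fun i j => ?_) hx)
    refine Submodule.mul_le.mpr fun x hx b hb => ?_
    have hx' : x ∈ T.gr i := by
      refine (Submodule.mul_le.mpr fun a ha h hh => ?_ : T.degA i * T.SH ≤ T.gr i) hx
      simpa using T.graded_mul ha.2 (mem_gr_zero hh)
    have hxb := T.graded_mul hx' hb.2
    rw [Submodule.mem_comap]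
    rcases eq_or_ne ((i : ℤ) + -j) k with h | h
    · rw [h] at hxb
      rw [proj_of_mem hxb]
      exact Submodule.mem_iSup_of_mem i (Submodule.mem_iSup_of_mem j
        (Submodule.mem_iSup_of_mem (by omega) (Submodule.mul_mem_mul hx hb)))
    · rw [proj_of_mem_ne h hxb]
      exact zero_mem _
  rw [← proj_of_mem hr]
  exact key r (by rw [A_mul_H_mul_B]; trivial)

/-- Every linear form on `R` yields a coefficient map `R → A`, by freeness of `R` over `A`. -/
theorem exists_slice (l : R →ₗ[K] K) :
    ∃ S : R →ₗ[K] R, ∀ a ∈ T.A, ∀ x ∈ T.SH * T.SB, S (a * x) = l x • a := by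
  let e := LinearEquiv.ofBijective _ T.bijective_mul
  let μ : T.H ⊗[K] T.B →ₗ[K] R :=
    TensorProduct.lift ((LinearMap.mul K R).compl₁₂ T.H.val.toLinearMap T.B.val.toLinearMap)
  let S : R →ₗ[K] R := T.A.val.toLinearMap ∘ₗ (TensorProduct.rid K T.A).toLinearMap ∘ₗ
    LinearMap.lTensor T.A (l ∘ₗ μ) ∘ₗ (TensorProduct.assoc K T.A T.H T.B).toLinearMap ∘ₗ
    e.symm.toLinearMap
  refine ⟨S, fun a ha x hx => ?_⟩
  induction hx using Submodule.mul_induction_on' with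
  | mem_mul_mem h hh b hb =>
    have : e.symm (a * (h * b)) =
        ((⟨a, ha⟩ : T.A) ⊗ₜ[K] (⟨h, hh⟩ : T.H)) ⊗ₜ[K] (⟨b, hb⟩ : T.B) := by
      rw [LinearEquiv.symm_apply_eq]
      simp [e, mul_assoc]
    simp [S, this, μ]
  | add x _ y _ hx hy => rw [mul_add, map_add, hx, hy, map_add, add_smul]

theorem proj_H_mul_Bge {n : ℕ} {x : R} (hx : x ∈ T.SH * T.Bge (n + 1)) : T.proj (-n) x = 0 := by
  have : T.SH * T.Bge (n + 1) ≤ LinearMap.ker (T.proj (-n)) := by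
    simp only [Bge, Submodule.mul_iSup]
    refine iSup₂_le fun m hm => Submodule.mul_le.mpr fun h hh b hb => ?_
    have h1 : h * b ∈ T.gr (-m) := by simpa using T.graded_mul (mem_gr_zero hh) hb.2
    exact proj_of_mem_ne (by omega) h1
  exact this hx

/-- Take the coefficient map of a linear form that is composed with the projection to degree 0. It
kills A H B_{≥ 1}, because H B_{≥ 1} has no part of degree 0, but it returns the value of the form
on h = 1 · h. -/
theorem H_inf_leftIdeal {h : R} (hh : h ∈ T.H) (h1 : h ∈ T.leftIdeal 1) : h = 0 := by
  by_contra hne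
  have : Nontrivial R := ⟨h, 0, hne⟩
  obtain ⟨l, hl⟩ : ∃ l : R →ₗ[K] K, l h ≠ 0 := by
    by_contra! hcon
    exact hne ((Module.forall_dual_apply_eq_zero_iff K h).mp hcon)
  obtain ⟨S, hS⟩ := T.exists_slice (l ∘ₗ T.proj 0)
  have hS0 : S h = 0 := by
    have h2 : h ∈ T.SA * T.SH * T.Bge 1 := leftIdeal_eq (T := T) 1 ▸ h1
    rw [mul_assoc] at h2
    refine (Submodule.mul_le.mpr fun a ha x hx => ?_ :
      T.SA * (T.SH * T.Bge 1) ≤ LinearMap.ker S) h2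
    have := proj_H_mul_Bge (n := 0) hx
    rw [LinearMap.mem_ker, hS a ha x (mul_le_mul' le_rfl (Bge_le_B 1) hx)]
    rw [LinearMap.comp_apply, show T.proj 0 x = 0 by simpa using this]
    simp
  have hS1 := hS 1 T.A.one_mem h
    (by simpa using Submodule.mul_mem_mul (show h ∈ T.SH from hh) (show (1 : R) ∈ T.SB from T.B.one_mem))
  rw [one_mul, hS0, LinearMap.comp_apply, proj_of_mem (mem_gr_zero hh), eq_comm, smul_eq_zero] at hS1
  exact hS1.elim hl one_ne_zero

/-! ### The element `∂₀` -/

/-- Since ∂ commutes with itself it has degree 0, so it lies in the sum of the A_i H B_{-i}. The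
term with i = 0 is in H, and the others are in the left ideal. -/
theorem exists_delZero (T : TriangularDecomposition K R) :
    ∃ d₀ ∈ T.H, T.del + d₀ ∈ T.leftIdeal 1 := by
  have h0 : T.del ∈ T.gr 0 := (T.mem_gr 0 _).mpr (by simp)
  have hle : ⨆ (i : ℕ) (j : ℕ) (_ : (i : ℤ) - j = 0), T.degA i * T.SH * T.degB j ≤
      T.SH ⊔ (T.leftIdeal 1).restrictScalars K := by
    refine iSup_le fun i => iSup_le fun j => iSup_le fun hij => ?_
    have : i = j := by omega
    subst this
    rcases Nat.eq_zero_or_pos i with rfl | hi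
    · rw [degA_zero_eq, degB_zero_eq, one_mul, mul_one]
      exact le_sup_left
    · refine le_trans ?_ le_sup_right
      rw [leftIdeal_eq]
      exact mul_le_mul' (mul_le_mul' inf_le_left le_rfl) (degB_le_Bge hi)
  obtain ⟨h, hh, x, hx, hsum⟩ := Submodule.mem_sup.mp (hle (mem_homogeneous h0))
  exact ⟨-h, T.H.neg_mem hh, by rw [← hsum]; simpa using hx⟩

/-- The element `∂₀ ∈ Z(H)`. -/
def delZero (T : TriangularDecomposition K R) : R := T.exists_delZero.choose

theorem delZero_mem : T.delZero ∈ T.H := T.exists_delZero.choose_spec.1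

theorem del_add_delZero_mem : T.del + T.delZero ∈ T.leftIdeal 1 := T.exists_delZero.choose_spec.2

/-- Right stability under H holds because B_{≥ N} H = H B_{≥ N}. -/
theorem H_mul_leftIdeal {N : ℕ} {h x : R} (hh : h ∈ T.H) (hx : x ∈ T.leftIdeal N) :
    x * h ∈ T.leftIdeal N := by
  have h1 : x ∈ T.SA * T.SH * T.Bge N := leftIdeal_eq (T := T) N ▸ hx
  have h2 : x * h ∈ T.SA * T.SH * T.Bge N * T.SH := Submodule.mul_mem_mul h1 hh
  rw [mul_assoc, Bge_mul_H, ← mul_assoc, mul_assoc T.SA, H_mul_H, ← leftIdeal_eq] at h2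
  exact h2

/-- As ∂ commutes with H, the commutator of ∂₀ with h equals that of ∂ + ∂₀; it therefore lies in H
∩ R B_{≥ 1} = 0. -/
theorem delZero_comm {h : R} (hh : h ∈ T.H) : T.delZero * h = h * T.delZero := by
  have h1 : T.del * h = h * T.del := by
    have := (T.mem_gr 0 h).mp (mem_gr_zero hh)
    rw [zero_smul, sub_eq_zero] at this
    exact this
  rw [← sub_eq_zero]
  refine H_inf_leftIdeal (T := T) (sub_mem (mul_mem delZero_mem hh) (mul_mem hh delZero_mem)) ?_
  have : T.delZero * h - h * T.delZero =
      (T.del + T.delZero) * h - h * (T.del + T.delZero) := by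
    rw [add_mul, mul_add, h1]; abel
  rw [this]
  exact sub_mem (H_mul_leftIdeal hh del_add_delZero_mem)
    ((T.leftIdeal 1).smul_mem h del_add_delZero_mem)

theorem delZero_unique {d : R} (hd : d ∈ T.H) (h : T.del + d ∈ T.leftIdeal 1) : d = T.delZero := by
  rw [← sub_eq_zero]
  refine H_inf_leftIdeal (sub_mem hd delZero_mem) ?_
  have := sub_mem h (del_add_delZero_mem (T := T))
  rwa [add_sub_add_left_eq_sub] at this

/-- A central element is scalar in every matrix block of the split algebra H, and the product over
the blocks of the differences with these scalars vanishes. Splitness is what puts all eigenvalues of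
∂₀ in K. -/
theorem exists_split_delZero (T : TriangularDecomposition K R) :
    ∃ l : List K, (l.map fun z => (⟨T.delZero, delZero_mem⟩ : T.H) - algebraMap K T.H z).prod = 0 := by
  obtain ⟨k, d, ⟨e⟩⟩ := T.H_split
  let x : T.H := ⟨T.delZero, delZero_mem⟩
  have hx : ∀ y : T.H, x * y = y * x := fun y => Subtype.ext (delZero_comm y.2)
  have hs : ∀ i, ∃ z : K, e x i = Matrix.scalar _ z := by
    intro i
    have : e x i ∈ Set.range (Matrix.scalar (Fin (d i))) := by
      refine Matrix.mem_range_scalar_of_commute_single fun a b _ => ?_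
      obtain ⟨y, hy⟩ := e.surjective (Pi.single i (Matrix.single a b 1))
      have := congrArg (fun t => e t i) (hx y)
      simp only [map_mul, hy, Pi.mul_apply, Pi.single_eq_same] at this
      exact this.symm
    obtain ⟨z, hz⟩ := this
    exact ⟨z, hz.symm⟩
  choose z hz using hs
  refine ⟨(List.finRange k).map z, e.injective (funext fun i => ?_)⟩
  rw [map_zero, map_list_prod, List.map_map, List.map_map]
  have : ∀ l : List (Fin k), i ∈ l →
      ((l.map (e ∘ (fun z => x - algebraMap K T.H z) ∘ z)).prod) i = 0 := by
    intro l hl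
    induction l with
    | nil => simp at hl
    | cons j l ih =>
      rw [List.map_cons, List.prod_cons, Pi.mul_apply]
      rcases List.mem_cons.mp hl with rfl | h
      · simp [hz, Matrix.algebraMap_eq_diagonal]
      · rw [ih h, mul_zero]
  exact this _ (List.mem_finRange i)

/-- A list of scalars `z` such that the product of the `∂₀ - z` vanishes. -/
def roots (T : TriangularDecomposition K R) : List K := T.exists_split_delZero.choose

theorem roots_prod : (T.roots.map fun z =>
    (⟨T.delZero, delZero_mem⟩ : T.H) - algebraMap K T.H z).prod = 0 :=
  T.exists_split_delZero.choose_spec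

end TriangularDecomposition

/-! ### Endomorphisms with a weight space decomposition -/

section WeightEndo

variable {K : Type*} [Field K] {V : Type*} [AddCommGroup V] [Module K V]

/-- On V^μ the operator D - c is the nonzero scalar μ - c plus a locally nilpotent operator; the
preimage is built by induction on the nilpotency order. -/
theorem exists_sub_smul_eq {D : Module.End K V} {c μ : K} (h : μ ≠ c) {u : V}
    (hu : u ∈ D.maxGenEigenspace μ) : ∃ y ∈ D.maxGenEigenspace μ, D y - c • y = u := by
  have key : ∀ (k : ℕ) (u : V), ((D - μ • (1 : Module.End K V)) ^ k) u = 0 →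
      ∃ y ∈ D.maxGenEigenspace μ, D y - c • y = u := by
    intro k
    induction k with
    | zero => intro u hu; exact ⟨0, zero_mem _, by simpa using hu.symm⟩
    | succ k ih =>
      intro u hu
      have hu' : u ∈ D.maxGenEigenspace μ := (Module.End.mem_maxGenEigenspace _ _ _).mpr ⟨_, hu⟩
      obtain ⟨y, hy, hyu⟩ := ih (D u - μ • u) (by
        rw [pow_succ, Module.End.mul_apply] at hu
        simpa using hu)
      refine ⟨(μ - c)⁻¹ • (u - y), Submodule.smul_mem _ _ (sub_mem hu' hy), ?_⟩
      have hne : μ - c ≠ 0 := sub_ne_zero.mpr h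
      rw [map_smul, smul_comm c, ← smul_sub, inv_smul_eq_iff₀ hne, map_sub, smul_sub,
        sub_sub_sub_comm, hyu, sub_smul]
      abel
  rw [Module.End.mem_maxGenEigenspace] at hu
  obtain ⟨k, hk⟩ := hu
  exact key k u hk

/-- D - c is onto every weight space V^μ with μ ≠ c. Hence some y in `ws D` makes (D - c)(m - y) lie
in V^c, and then m - y lies in V^c as well. -/
theorem mem_ws_of_sub_smul_mem {D : Module.End K V} {c : K} {m : V} (hm : D m - c • m ∈ ws D) :
    m ∈ ws D := by
  have key : ∀ x ∈ ws D, ∃ y ∈ ws D, x - (D y - c • y) ∈ D.maxGenEigenspace c := by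
    intro x hx
    unfold ws at hx
    induction hx using Submodule.iSup_induction' with
    | mem μ x hx =>
      rcases eq_or_ne μ c with rfl | hne
      · exact ⟨0, zero_mem _, by simpa using hx⟩
      · obtain ⟨y, hy, rfl⟩ := exists_sub_smul_eq hne hx
        exact ⟨y, Submodule.mem_iSup_of_mem μ hy, by simp⟩
    | zero => exact ⟨0, zero_mem _, by simp⟩
    | add x x' _ _ hx hx' =>
      obtain ⟨y, hy, h⟩ := hx
      obtain ⟨y', hy', h'⟩ := hx'
      refine ⟨y + y', add_mem hy hy', ?_⟩
      convert add_mem h h' using 1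
      simp only [map_add, smul_add]
      abel
  obtain ⟨y, hy, h⟩ := key _ hm
  have : m - y ∈ D.maxGenEigenspace c := by
    rw [Module.End.mem_maxGenEigenspace] at h ⊢
    obtain ⟨k, hk⟩ := h
    refine ⟨k + 1, ?_⟩
    rw [pow_succ, Module.End.mul_apply]
    convert hk using 2
    simp only [LinearMap.sub_apply, LinearMap.smul_apply, Module.End.one_apply, map_sub]
  rw [← sub_add_cancel m y]
  exact add_mem (Submodule.mem_iSup_of_mem c this) hy

theorem ws_isInternal [DecidableEq K] {D : Module.End K V} (h : ws D = ⊤) :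
    DirectSum.IsInternal fun μ => D.maxGenEigenspace μ :=
  (DirectSum.isInternal_submodule_iff_iSupIndep_and_iSup_eq_top _).mpr
    ⟨D.independent_maxGenEigenspace, h⟩

theorem eq_of_mem_maxGenEigenspace {D : Module.End K V} {μ ν : K} {v : V} (hv : v ≠ 0)
    (hμ : v ∈ D.maxGenEigenspace μ) (hν : v ∈ D.maxGenEigenspace ν) : μ = ν := by
  by_contra hne
  exact hv (Submodule.disjoint_def.mp
    (D.independent_maxGenEigenspace.pairwiseDisjoint hne) v hμ hν)

end WeightEndo

namespace TriangularDecomposition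

/-! ### Modules in the category `O` -/

section ModulesO

variable {K : Type w} [Field K] {R : Type u} [Ring R] [Algebra K R]
  (T : TriangularDecomposition K R)
  (M : Type u) [AddCommGroup M] [Module R M] [Module K M] [IsScalarTower K R M]

/-- The generalized weight space `M^μ`. -/
abbrev wt (μ : K) : Submodule K M := (act K T.del M).maxGenEigenspace μ

/-- The vectors killed by `⨁_{n ≥ N} B_{-n}`. -/
def killed (N : ℕ) : Submodule K M where
  carrier := {m | ∀ b ∈ T.Bge N, b • m = 0}
  add_mem' hx hy b hb := by rw [smul_add, hx b hb, hy b hb, add_zero]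
  zero_mem' b _ := smul_zero b
  smul_mem' c x hx b hb := by
    rw [← algebraMap_smul R c x, ← mul_smul, ← Algebra.commutes, mul_smul, hx b hb, smul_zero]

/-- Membership in the category `O`. -/
structure IsO (T : TriangularDecomposition K R) (M : Type u) [AddCommGroup M] [Module R M]
    [Module K M] [IsScalarTower K R M] : Prop where
  finite : Module.Finite R M
  exists_killed : ∀ m : M, ∃ N, m ∈ T.killed M N

variable {T M}

theorem act_apply (x : R) (m : M) : act K x M m = x • m := rfl

theorem smul_comm_scalar (x : R) (c : K) (m : M) : x • c • m = c • x • m := by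
  rw [← algebraMap_smul R c m, ← mul_smul, ← Algebra.commutes, mul_smul, algebraMap_smul]

theorem killed_anti {N N' : ℕ} (h : N ≤ N') : T.killed M N ≤ T.killed M N' :=
  fun _ hm b hb => hm b (Bge_anti h hb)

theorem mem_killed_iff {N : ℕ} {m : M} :
    m ∈ T.killed M N ↔ ∀ k, N ≤ k → ∀ b ∈ T.degB k, b • m = 0 := by
  refine ⟨fun h k hk b hb => h b (degB_le_Bge hk hb), fun h b hb => ?_⟩
  have : T.Bge N ≤ LinearMap.ker
      ((LinearMap.toSpanSingleton R M m).restrictScalars K) :=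
    iSup₂_le fun k hk b hb => h k hk b hb
  exact this hb

theorem leftIdeal_smul {N : ℕ} {m : M} (hm : m ∈ T.killed M N) {x : R} (hx : x ∈ T.leftIdeal N) :
    x • m = 0 := by
  have : T.leftIdeal N ≤ LinearMap.ker (LinearMap.toSpanSingleton R M m) :=
    Submodule.span_le.mpr fun b hb => hm b hb
  exact this hx

theorem H_smul_mem_killed {N : ℕ} {h : R} (hh : h ∈ T.H) {m : M} (hm : m ∈ T.killed M N) :
    h • m ∈ T.killed M N := by
  intro b hb
  rw [← mul_smul]
  exact leftIdeal_smul hm (H_mul_leftIdeal' hh hb)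
where
  H_mul_leftIdeal' {N : ℕ} {h b : R} (hh : h ∈ T.H) (hb : b ∈ T.Bge N) : b * h ∈ T.leftIdeal N :=
    H_mul_leftIdeal hh (Submodule.subset_span hb)

theorem Bge_smul_mem_killed {N k : ℕ} {b : R} (hb : b ∈ T.Bge k) {m : M}
    (hm : m ∈ T.killed M (N + k)) : b • m ∈ T.killed M N := by
  intro b' hb'
  rw [← mul_smul]
  exact hm _ (Bge_mul_le N k (Submodule.mul_mem_mul hb' hb))

theorem killed_zero : T.killed M 0 = ⊥ := by
  refine eq_bot_iff.mpr fun m hm => ?_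
  have := hm 1 (by rw [Bge_zero]; exact T.B.one_mem)
  simpa using this

theorem smul_mem_wt {n : ℤ} {x : R} (hx : x ∈ T.gr n) {μ : K} {m : M} (hm : m ∈ T.wt M μ) :
    x • m ∈ T.wt M (μ + n) := by
  rw [Module.End.mem_maxGenEigenspace] at hm ⊢
  obtain ⟨k, hk⟩ := hm
  refine ⟨k, ?_⟩
  have hx' : T.del * x = x * T.del + n • x := by
    rw [← (T.mem_gr n x).mp hx]; abel
  have : ∀ (k : ℕ) (m : M), ((act K T.del M - (μ + n) • (1 : Module.End K M)) ^ k) (x • m) =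
      x • ((act K T.del M - μ • (1 : Module.End K M)) ^ k) m := by
    intro k
    induction k with
    | zero => intro m; rfl
    | succ k ih =>
      intro m
      rw [pow_succ, Module.End.mul_apply, pow_succ, Module.End.mul_apply, ← ih]
      congr 1
      simp only [LinearMap.sub_apply, LinearMap.smul_apply, LinearMap.add_apply,
        Module.End.one_apply, act_apply, add_smul, smul_sub, ← mul_smul, hx',
        smul_comm_scalar]
      have h1 : (n : K) • x • m = (n • x) • m := by
        rw [smul_assoc, Int.cast_smul_eq_zsmul]
      rw [h1]
      abel
  rw [this, hk, smul_zero]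

theorem smul_mem_ws' (x : R) {m : M} (hm : m ∈ ws (act K T.del M)) :
    x • m ∈ ws (act K T.del M) := by
  have hx : x ∈ ⨆ n, T.gr n := by rw [T.isInternal.submodule_iSup_eq_top]; trivial
  induction hx using Submodule.iSup_induction' with
  | mem n x hx =>
    unfold ws at hm
    induction hm using Submodule.iSup_induction' with
    | mem a m hm => exact Submodule.mem_iSup_of_mem _ (smul_mem_wt hx hm)
    | zero => rw [smul_zero]; exact zero_mem _
    | add m m' _ _ h h' => rw [smul_add]; exact add_mem h h'
  | zero => rw [zero_smul]; exact zero_mem _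
  | add x y _ _ h h' => rw [add_smul]; exact add_mem h h'

/-- The operator `∂₀ - z`. -/
def delZeroSub (T : TriangularDecomposition K R) (z : K) : R := T.delZero - algebraMap K R z

theorem delZeroSub_mem (z : K) : T.delZeroSub z ∈ T.H := sub_mem delZero_mem (T.H.algebraMap_mem z)

theorem prod_delZeroSub_mem (l : List K) : (l.map T.delZeroSub).prod ∈ T.H :=
  T.H.list_prod_mem fun x hx => by
    obtain ⟨z, -, rfl⟩ := List.mem_map.mp hx
    exact delZeroSub_mem z

theorem prod_delZeroSub_roots : (T.roots.map T.delZeroSub).prod = 0 := by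
  have := congrArg T.H.val (roots_prod (T := T))
  rw [map_list_prod, List.map_map, map_zero] at this
  exact this

/-- Induction on N. On vectors killed by B_{≥ N+1}, the element ∂ + ∂₀ of R B_{≥ 1} takes values in
R times vectors killed by B_{≥ N}, hence in `ws`. Modulo `ws`, ∂ is therefore -∂₀, and the factors
of the vanishing product in ∂₀ are peeled off one by one. -/
theorem killed_le_ws (N : ℕ) : T.killed M N ≤ ws (act K T.del M) := by
  induction N with
  | zero => rw [killed_zero]; exact bot_le
  | succ N ih =>
    have h1 : ∀ m ∈ T.killed M (N + 1), ∀ x ∈ T.leftIdeal 1, x • m ∈ ws (act K T.del M) := by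
      intro m hm x hx
      have hx' : x ∈ Submodule.span R (T.Bge 1 : Set R) := hx
      clear hx
      induction hx' using Submodule.closure_induction with
      | zero => rw [zero_smul]; exact zero_mem _
      | add x y _ _ h h' => rw [add_smul]; exact add_mem h h'
      | smul_mem r b hb =>
        rw [smul_eq_mul, mul_smul]
        exact smul_mem_ws' r (ih (Bge_smul_mem_killed hb hm))
    have key : ∀ (l : List K), ∀ m ∈ T.killed M (N + 1),
        (l.map T.delZeroSub).prod • m ∈ ws (act K T.del M) → m ∈ ws (act K T.del M) := by
      intro l
      induction l with
      | nil => intro m _ h; simpa using h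
      | cons z l ihl =>
        intro m hm h
        rw [List.map_cons, List.prod_cons, mul_smul] at h
        have hm' := H_smul_mem_killed (prod_delZeroSub_mem l) hm
        refine ihl m hm (mem_ws_of_sub_smul_mem (c := -z) ?_)
        have h2 := sub_mem (h1 _ hm' _ del_add_delZero_mem) h
        convert h2 using 1
        rw [act_apply, add_smul, delZeroSub, sub_smul, algebraMap_smul, neg_smul]
        abel
    intro m hm
    refine key T.roots m hm ?_
    rw [prod_delZeroSub_roots, zero_smul]
    exact zero_mem _

theorem IsO.ws_eq_top (hM : T.IsO M) : ws (act K T.del M) = ⊤ :=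
  eq_top_iff.mpr fun m _ => by
    obtain ⟨N, hN⟩ := hM.exists_killed m
    exact killed_le_ws N hN

/-- Choose b of the most negative degree with b v ≠ 0. Then B_{≥ 1} b v lies in the span of products
of still more negative degree with v, which are zero. -/
theorem exists_smul_mem_killed_one {N : ℕ} {v : M} (hv : v ∈ T.killed M N) (hne : v ≠ 0) :
    ∃ k, ∃ b ∈ T.degB k, b • v ≠ 0 ∧ b • v ∈ T.killed M 1 := by
  induction N with
  | zero => rw [killed_zero] at hv; exact absurd hv hne
  | succ N ih =>
    by_cases h : v ∈ T.killed M N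
    · exact ih h
    · have : ∃ b ∈ T.Bge N, b • v ≠ 0 := by
        by_contra! hcon
        exact h hcon
      obtain ⟨b, hb, hbv⟩ := this
      rw [Bge_succ] at hb
      obtain ⟨b₁, hb₁, b₂, hb₂, rfl⟩ := Submodule.mem_sup.mp hb
      rw [add_smul, hv b₂ hb₂, add_zero] at hbv
      refine ⟨N, b₁, hb₁, hbv, Bge_smul_mem_killed (k := N) (degB_le_Bge le_rfl hb₁) ?_⟩
      rwa [add_comm]

theorem del_smul_of_killed {v : M} (hv : v ∈ T.killed M 1) : T.del • v = -(T.delZero • v) := by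
  rw [eq_neg_iff_add_eq_zero, ← add_smul]
  exact leftIdeal_smul hv del_add_delZero_mem

/-- Along the vanishing product of the ∂₀ - z, the last nonzero partial product applied to v is an
eigenvector of ∂₀. It still has weight μ, because H has degree 0, and there ∂ = -∂₀. -/
theorem exists_root_of_killed {v : M} (hv : v ∈ T.killed M 1) (hne : v ≠ 0) {μ : K}
    (hμ : v ∈ T.wt M μ) : ∃ z ∈ T.roots, μ = -z := by
  have key : ∀ (l : List K), (l.map T.delZeroSub).prod • v = 0 → ∃ z ∈ l, μ = -z := by
    intro l
    induction l with
    | nil => intro h; exact absurd (by simpa using h) hne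
    | cons z l ih =>
      intro h
      by_cases h0 : (l.map T.delZeroSub).prod • v = 0
      · obtain ⟨z', hz', h'⟩ := ih h0
        exact ⟨z', List.mem_cons_of_mem _ hz', h'⟩
      · refine ⟨z, List.mem_cons_self, ?_⟩
        have hk := H_smul_mem_killed (prod_delZeroSub_mem l) hv
        have hw : (l.map T.delZeroSub).prod • v ∈ T.wt M μ := by
          simpa using smul_mem_wt (mem_gr_zero (prod_delZeroSub_mem l)) hμ
        refine eq_of_mem_maxGenEigenspace h0 hw ?_
        rw [List.map_cons, List.prod_cons, mul_smul, delZeroSub, sub_smul, algebraMap_smul,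
          sub_eq_zero] at h
        refine (Module.End.mem_maxGenEigenspace _ _ _).mpr ⟨1, ?_⟩
        rw [pow_one, LinearMap.sub_apply, act_apply, del_smul_of_killed hk, h]
        simp
  exact key T.roots (by rw [prod_delZeroSub_roots, zero_smul])

variable (T) in
theorem exists_roots_bound [CharZero K] (μ : K) :
    ∃ N : ℕ, ∀ k : ℕ, N ≤ k → ∀ z ∈ T.roots, ∀ n : ℕ, μ - k ≠ -z + n := by
  classical
  have hN : ∃ N : ℕ, ∀ k : ℕ, N ≤ k → ∀ z ∈ T.roots.toFinset, ∀ n : ℕ, μ - k ≠ -z + n := by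
    rw [← Filter.eventually_atTop, Filter.eventually_all_finset]
    intro z _
    rw [Filter.eventually_atTop]
    by_cases h : ∃ k n : ℕ, μ - k = -z + n
    · obtain ⟨k, n, h⟩ := h
      refine ⟨k + n + 1, fun k' hk' n' h' => ?_⟩
      have : ((k + n : ℕ) : K) = ((k' + n' : ℕ) : K) := by
        push_cast
        linear_combination h' - h
      have := Nat.cast_injective this
      omega
    · push Not at h
      exact ⟨0, fun k _ n => h k n⟩
  obtain ⟨N, hN⟩ := hN
  exact ⟨N, fun k hk z hz => hN k hk z (List.mem_toFinset.mpr hz)⟩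

/-- An element of B of degree -j pushes v down to a nonzero vector killed by B_{≥ 1}, whose weight ν
- j is minus a root. -/
theorem IsO.exists_root_of_mem_wt (hM : T.IsO M) {ν : K} {v : M} (hv : v ∈ T.wt M ν)
    (hne : v ≠ 0) : ∃ z ∈ T.roots, ∃ n : ℕ, ν = -z + n := by
  obtain ⟨N, hN⟩ := hM.exists_killed v
  obtain ⟨j, b, hb, hne', hk⟩ := exists_smul_mem_killed_one hN hne
  obtain ⟨z, hz, hzμ⟩ := exists_root_of_killed hk hne' (smul_mem_wt hb.2 hv)
  refine ⟨z, hz, j, ?_⟩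
  push_cast at hzμ
  linear_combination hzμ

variable (T) in
/-- Weight spaces of modules in `O` are killed by `B_{-k}` for all large `k`, uniformly in the
module. -/
theorem exists_wt_le_killed [CharZero K] (μ : K) :
    ∃ N : ℕ, ∀ (M : Type u) [AddCommGroup M] [Module R M] [Module K M] [IsScalarTower K R M],
      T.IsO M → T.wt M μ ≤ T.killed M N := by
  obtain ⟨N, hN⟩ := T.exists_roots_bound μ
  refine ⟨N, fun M _ _ _ _ hM v hv => mem_killed_iff.mpr fun k hk b hb => ?_⟩
  by_contra hne
  obtain ⟨z, hz, n, hn⟩ := hM.exists_root_of_mem_wt (smul_mem_wt hb.2 hv) hne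
  refine hN k hk z hz n ?_
  push_cast at hn
  linear_combination hn

theorem exists_proj_ne_zero [DecidableEq K] (h : ws (act K T.del M) = ⊤) {v : M} (hv : v ≠ 0) :
    ∃ μ, internalProj (ws_isInternal h) μ v ≠ 0 := by
  by_contra! hcon
  obtain ⟨s, hs⟩ := internalProj_sum (ws_isInternal h) v
  exact hv (by rw [hs]; exact Finset.sum_eq_zero fun μ _ => hcon μ)

theorem IsO.exists_root_vector (hM : T.IsO M) {v : M} (hv : v ≠ 0) :
    ∃ x : R, x • v ≠ 0 ∧ x • v ∈ T.killed M 1 := by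
  obtain ⟨N, hN⟩ := hM.exists_killed v
  obtain ⟨k, b, -, h⟩ := exists_smul_mem_killed_one hN hv
  exact ⟨b, h⟩

theorem proj_map {M' : Type u} [AddCommGroup M'] [Module R M'] [Module K M'] [IsScalarTower K R M']
    [DecidableEq K] (h : ws (act K T.del M) = ⊤) (h' : ws (act K T.del M') = ⊤)
    (f : M →ₗ[R] M') (μ : K) (m : M) :
    f (internalProj (ws_isInternal h) μ m) = internalProj (ws_isInternal h') μ (f m) :=
  internalProj_comm (ws_isInternal h) (ws_isInternal h') (f.restrictScalars K)
    (fun _ _ hx => map_mem_maxGenEigenspace (f.restrictScalars K) (fun x => map_smul f T.del x) hx)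
    μ m

theorem map_mem_wt {M' : Type u} [AddCommGroup M'] [Module R M'] [Module K M']
    [IsScalarTower K R M'] (f : M →ₗ[R] M') {μ : K} {m : M} (hm : m ∈ T.wt M μ) :
    f m ∈ T.wt M' μ :=
  map_mem_maxGenEigenspace (f.restrictScalars K) (fun x => map_smul f T.del x) hm

theorem mem_wt_of_injective {M' : Type u} [AddCommGroup M'] [Module R M'] [Module K M']
    [IsScalarTower K R M'] (f : M →ₗ[R] M') (hf : Function.Injective f) {μ : K} {m : M}
    (hm : f m ∈ T.wt M' μ) : m ∈ T.wt M μ := by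
  rw [Module.End.mem_maxGenEigenspace] at hm ⊢
  obtain ⟨k, hk⟩ := hm
  refine ⟨k, hf ?_⟩
  have : ∀ (k : ℕ) (m : M), f (((act K T.del M - μ • (1 : Module.End K M)) ^ k) m) =
      ((act K T.del M' - μ • (1 : Module.End K M')) ^ k) (f m) := by
    intro k
    induction k with
    | zero => intro m; rfl
    | succ k ih =>
      intro m
      rw [pow_succ, Module.End.mul_apply, pow_succ, Module.End.mul_apply, ih]
      congr 1
      simp only [LinearMap.sub_apply, LinearMap.smul_apply, Module.End.one_apply, act_apply,
        map_sub, map_smul]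
      rw [← algebraMap_smul R μ m, map_smul, algebraMap_smul]
  rw [this, hk, map_zero]

theorem ws_quotient (h : ws (act K T.del M) = ⊤) (N : Submodule R M) :
    ws (act K T.del (M ⧸ N)) = ⊤ := by
  refine eq_top_iff.mpr fun x hx => ?_
  clear hx
  induction x using Submodule.Quotient.induction_on with
  | _ x =>
    have hx : x ∈ ws (act K T.del M) := h ▸ Submodule.mem_top
    unfold ws at hx
    induction hx using Submodule.iSup_induction' with
    | mem μ x hx => exact Submodule.mem_iSup_of_mem μ (map_mem_wt N.mkQ hx)
    | zero => exact zero_mem _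
    | add x y _ _ hx hy => exact add_mem hx hy

theorem smul_proj [DecidableEq K] (h : ws (act K T.del M) = ⊤) {n : ℤ} {x : R} (hx : x ∈ T.gr n)
    (μ : K) (m : M) : x • internalProj (ws_isInternal h) μ m =
      internalProj (ws_isInternal h) (μ + n) (x • m) := by
  have hm : m ∈ ws (act K T.del M) := h ▸ Submodule.mem_top
  unfold ws at hm
  induction hm using Submodule.iSup_induction' with
  | mem ν m hm =>
    rcases eq_or_ne ν μ with rfl | hne
    · rw [internalProj_of_mem _ hm, internalProj_of_mem _ (smul_mem_wt hx hm)]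
    · rw [internalProj_of_mem_ne _ hne hm,
        internalProj_of_mem_ne _ (by simpa using hne) (smul_mem_wt hx hm), smul_zero]
  | zero => rw [map_zero, smul_zero, map_zero]
  | add y z _ _ hy hz => rw [map_add, smul_add, hy, hz, smul_add, map_add]

theorem proj_mem_killed [DecidableEq K] (h : ws (act K T.del M) = ⊤) {N : ℕ} {m : M}
    (hm : m ∈ T.killed M N) (μ : K) : internalProj (ws_isInternal h) μ m ∈ T.killed M N :=
  mem_killed_iff.mpr fun k hk b hb => by
    rw [smul_proj h hb.2, mem_killed_iff.mp hm k hk b hb, map_zero]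

theorem proj_mem_submodule [DecidableEq K] (h : ws (act K T.del M) = ⊤) (N : Submodule R M) {m : M}
    (hm : m ∈ N) (μ : K) : internalProj (ws_isInternal h) μ m ∈ N := by
  have := proj_map h (ws_quotient h N) N.mkQ μ m
  rw [(Submodule.Quotient.mk_eq_zero N).mpr hm |> (show N.mkQ m = 0 from ·), map_zero] at this
  exact (Submodule.Quotient.mk_eq_zero N).mp this

theorem IsO.submodule [IsNoetherianRing R] (hM : T.IsO M) (N : Submodule R M) : T.IsO N where
  finite := by
    have := hM.finite
    have : IsNoetherian R M := isNoetherian_of_isNoetherianRing_of_finite R M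
    infer_instance
  exists_killed m := by
    obtain ⟨k, hk⟩ := hM.exists_killed m
    exact ⟨k, fun b hb => Subtype.ext (hk b hb)⟩

theorem IsO.of_surjective {M' : Type u} [AddCommGroup M'] [Module R M'] [Module K M']
    [IsScalarTower K R M'] (hM : T.IsO M) (f : M →ₗ[R] M') (hf : Function.Surjective f) :
    T.IsO M' where
  finite := by
    have := hM.finite
    exact Module.Finite.of_surjective f hf
  exists_killed m := by
    obtain ⟨m, rfl⟩ := hf m
    obtain ⟨k, hk⟩ := hM.exists_killed m
    exact ⟨k, fun b hb => by rw [← map_smul, hk b hb, map_zero]⟩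

theorem IsO.of_injective [IsNoetherianRing R] {M' : Type u} [AddCommGroup M'] [Module R M']
    [Module K M'] [IsScalarTower K R M'] (hM : T.IsO M) (f : M' →ₗ[R] M)
    (hf : Function.Injective f) : T.IsO M' :=
  (hM.submodule f.range).of_surjective (LinearEquiv.ofInjective f hf).symm.toLinearMap
    (LinearEquiv.ofInjective f hf).symm.surjective

theorem IsO.quotient (hM : T.IsO M) (N : Submodule R M) : T.IsO (M ⧸ N) :=
  hM.of_surjective N.mkQ N.mkQ_surjective

theorem IsO.pi {n : ℕ} {M : Fin n → Type u} [∀ i, AddCommGroup (M i)] [∀ i, Module R (M i)]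
    [∀ i, Module K (M i)] [∀ i, IsScalarTower K R (M i)] (hM : ∀ i, T.IsO (M i)) :
    T.IsO (∀ i, M i) where
  finite := by
    have := fun i => (hM i).finite
    infer_instance
  exists_killed m := by
    choose N hN using fun i => (hM i).exists_killed (m i)
    exact ⟨Finset.univ.sup N, fun b hb => funext fun i =>
      killed_anti (Finset.le_sup (Finset.mem_univ i)) (hN i) b hb⟩

/-! ### Finiteness over `A` -/

/-- `⨁_{n < N} B_{-n}`. -/
def lowB (T : TriangularDecomposition K R) (N : ℕ) : Submodule K R := ⨆ n : Fin N, T.degB n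

theorem lowB_fg (N : ℕ) : (T.lowB N).FG :=
  Submodule.fg_iSup _ fun _ => Module.Finite.iff_fg.mp (T.B_finite _)

theorem lowB_le (N : ℕ) : T.lowB N ≤ T.SB := iSup_le fun _ => inf_le_left

theorem lowB_sup_Bge (N : ℕ) : T.lowB N ⊔ T.Bge N = T.SB := by
  refine le_antisymm (sup_le (lowB_le N) (Bge_le_B N)) (T.B_graded.trans (iSup_le fun n => ?_))
  rcases lt_or_ge n N with h | h
  · exact le_sup_of_le_left (le_iSup_of_le (⟨n, h⟩ : Fin N) le_rfl)
  · exact le_sup_of_le_right (degB_le_Bge h)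

theorem finite_H : Module.Finite K T.H := by
  obtain ⟨k, d, ⟨e⟩⟩ := T.H_split
  exact Module.Finite.equiv e.symm.toLinearEquiv

theorem SH_fg : T.SH.FG := Module.Finite.iff_fg.mp finite_H

theorem top_eq_sup_leftIdeal (N : ℕ) :
    T.SA * (T.SH * T.lowB N) ⊔ (T.leftIdeal N).restrictScalars K = ⊤ := by
  rw [leftIdeal_eq, ← mul_assoc, ← Submodule.mul_sup, lowB_sup_Bge, A_mul_H_mul_B]

/-- The set `G v` for a finite set of vectors `v` killed by `⨁_{n ≥ N} B_{-n}`, where `G` spans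
`H ⨁_{n < N} B_{-n}`, generates the same module over `A` as `v` over `R`. -/
theorem span_A_eq_top {N : ℕ} {S : Set M} (hS : S ⊆ T.killed M N)
    (hspan : Submodule.span R S = ⊤) {G : Set R} (hG : Submodule.span K G = T.SH * T.lowB N) :
    Submodule.span T.A (Set.image2 (· • ·) G S) = ⊤ := by
  refine eq_top_iff.mpr fun m hm => ?_
  replace hm : m ∈ Submodule.span R S := hspan ▸ Submodule.mem_top
  induction hm using Submodule.closure_induction with
  | zero => exact zero_mem _
  | add x y _ _ hx hy => exact add_mem hx hy
  | smul_mem r m hm =>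
    have hr : r ∈ T.SA * (T.SH * T.lowB N) ⊔ (T.leftIdeal N).restrictScalars K := by
      rw [top_eq_sup_leftIdeal]; trivial
    obtain ⟨x, hx, y, hy, rfl⟩ := Submodule.mem_sup.mp hr
    rw [add_smul, leftIdeal_smul (hS hm) hy, add_zero]
    clear hr
    induction hx using Submodule.mul_induction_on' with
    | mem_mul_mem a ha g hg =>
      rw [← hG] at hg
      rw [mul_smul]
      refine Submodule.smul_mem _ (⟨a, ha⟩ : T.A) ?_
      induction hg using Submodule.span_induction with
      | mem g hg => exact Submodule.subset_span ⟨g, hg, m, hm, rfl⟩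
      | zero => rw [zero_smul]; exact zero_mem _
      | add g g' _ _ h h' => rw [add_smul]; exact add_mem h h'
      | smul c g _ h =>
        rw [smul_assoc, ← algebraMap_smul T.A c]
        exact Submodule.smul_mem _ _ h
    | add x _ y _ hx hy => rw [add_smul]; exact add_mem hx hy

theorem IsO.exists_generators (hM : T.IsO M) :
    ∃ (N : ℕ) (S : Finset M), (S : Set M) ⊆ T.killed M N ∧ Submodule.span R (S : Set M) = ⊤ := by
  obtain ⟨S, hS⟩ := hM.finite.fg_top
  choose N hN using hM.exists_killed
  exact ⟨S.sup N, S, fun m hm => killed_anti (Finset.le_sup hm) (hN m), hS⟩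

theorem exists_span_H_mul_lowB (N : ℕ) :
    ∃ G : Finset R, Submodule.span K (G : Set R) = T.SH * T.lowB N :=
  SH_fg.mul (lowB_fg N)

theorem IsO.finite_A (hM : T.IsO M) : Module.Finite T.A M := by
  classical
  obtain ⟨N, S, hS, hspan⟩ := hM.exists_generators
  obtain ⟨G, hG⟩ := exists_span_H_mul_lowB (T := T) N
  refine ⟨⟨Finset.image₂ (· • ·) G S, ?_⟩⟩
  rw [Finset.coe_image₂]
  exact span_A_eq_top hS hspan hG

theorem IsO.exists_weight_generators (hM : T.IsO M) :
    ∃ S : Finset M, (S : Set M) ⊆ weightVectors (act K T.del M) ∧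
      Submodule.span T.A (S : Set M) = ⊤ := by
  have h : Submodule.span T.A (weightVectors (act K T.del M)) = ⊤ := by
    refine eq_top_iff.mpr fun m hm => ?_
    replace hm : m ∈ ws (act K T.del M) := hM.ws_eq_top ▸ Submodule.mem_top
    unfold ws at hm
    induction hm using Submodule.iSup_induction' with
    | mem μ m hm => exact Submodule.subset_span ⟨μ, hm⟩
    | zero => exact zero_mem _
    | add x y _ _ hx hy => exact add_mem hx hy
  have hfg : (Submodule.span T.A (weightVectors (act K T.del M))).FG :=
    h ▸ hM.finite_A.fg_top
  obtain ⟨S, hS, hS'⟩ := (Submodule.fg_span_iff_fg_span_finset_subset _).mp hfg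
  exact ⟨S, hS, hS'.symm.trans h⟩

/-- If `M` is generated over `A` by a set `S` of weight vectors, then the weight space `M^μ` is
spanned by the products of weight `μ`. -/
theorem wt_le_span [CharZero K] (hws : ws (act K T.del M) = ⊤) {S : Set M}
    (hS : S ⊆ weightVectors (act K T.del M)) (hspan : Submodule.span T.A S = ⊤) (μ : K) :
    T.wt M μ ≤ Submodule.span K {y | ∃ (n : ℕ) (w : K) (a : R) (m : M), a ∈ T.degA n ∧ m ∈ S ∧
      m ∈ T.wt M w ∧ w + n = μ ∧ y = a • m} := by
  classical
  set Y : K → Submodule K M := fun μ => Submodule.span K {y | ∃ (n : ℕ) (w : K) (a : R) (m : M),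
    a ∈ T.degA n ∧ m ∈ S ∧ m ∈ T.wt M w ∧ w + n = μ ∧ y = a • m} with hY
  have hle : ∀ μ, Y μ ≤ T.wt M μ := by
    intro μ
    refine Submodule.span_le.mpr ?_
    rintro _ ⟨n, w, a, m, ha, -, hm, rfl, rfl⟩
    simpa using smul_mem_wt ha.2 hm
  have htop : ∀ v : M, v ∈ ⨆ μ, Y μ := by
    intro v
    have hv : v ∈ Submodule.span T.A S := hspan ▸ Submodule.mem_top
    induction hv using Submodule.closure_induction with
    | zero => exact zero_mem _
    | add x y _ _ hx hy => exact add_mem hx hy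
    | smul_mem a m hm =>
      obtain ⟨w, hw⟩ := hS hm
      obtain ⟨a, ha⟩ := a
      change a • m ∈ _
      have ha' := SA_le ha
      clear ha
      induction ha' using Submodule.iSup_induction' with
      | mem n a ha =>
        exact Submodule.mem_iSup_of_mem (w + n)
          (Submodule.subset_span ⟨n, w, a, m, ha, hm, hw, rfl, rfl⟩)
      | zero => rw [zero_smul]; exact zero_mem _
      | add x y _ _ hx hy => rw [add_smul]; exact add_mem hx hy
  intro v hv
  obtain ⟨f, hf, hfv⟩ := (Submodule.mem_iSup_iff_exists_finsupp Y v).mp (htop v)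
  have h1 := internalProj_of_mem (ws_isInternal hws) hv
  rw [← hfv, Finsupp.sum, map_sum, Finset.sum_eq_single μ] at h1
  · rw [← hfv, Finsupp.sum, ← h1, internalProj_of_mem _ (hle _ (hf μ))]
    exact hf μ
  · exact fun ν _ hν => internalProj_of_mem_ne _ hν (hle _ (hf ν))
  · intro hμ
    rw [Finsupp.notMem_support_iff.mp hμ, map_zero]

/-- Each of the finitely many weight generators m over A contributes to M^μ through at most one
piece A_n m, and A_n is finite dimensional. -/
theorem IsO.finite_wt [CharZero K] (hM : T.IsO M) (μ : K) : Module.Finite K (T.wt M μ) := by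
  classical
  obtain ⟨S, hS, hspan⟩ := hM.exists_weight_generators
  have h1 := wt_le_span hM.ws_eq_top hS hspan μ
  have hS' : ∀ m ∈ S, ∃ μ, m ∈ T.wt M μ := fun m hm => hS hm
  choose! w hw using hS'
  have h2 : ∀ m : M, ∃ n : ℕ, ∀ n' : ℕ, w m + n' = μ → n' = n := by
    intro m
    by_cases h : ∃ n : ℕ, w m + n = μ
    · obtain ⟨n, rfl⟩ := h
      exact ⟨n, fun n' hn' => by simpa using hn'⟩
    · exact ⟨0, fun n' hn' => absurd ⟨n', hn'⟩ h⟩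
  choose n hn using h2
  let Z : Submodule K M := ⨆ m : S, (T.degA (n m)).map
    ((LinearMap.toSpanSingleton R M (m : M)).restrictScalars K)
  have hZ : Z.FG := Submodule.fg_iSup _ fun m =>
    (Module.Finite.iff_fg.mp (T.A_finite _)).map _
  have : Module.Finite K Z := Module.Finite.iff_fg.mpr hZ
  have hle : T.wt M μ ≤ Z := by
    refine h1.trans (Submodule.span_le.mpr ?_)
    rintro _ ⟨k, w', a, m, ha, hm, hmw, hk, rfl⟩
    by_cases h0 : m = 0
    · rw [h0, smul_zero]; exact zero_mem _
    · have : w' = w m := eq_of_mem_maxGenEigenspace h0 hmw (hw m hm)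
      subst this
      rw [hn m k hk] at ha
      exact Submodule.mem_iSup_of_mem (⟨m, hm⟩ : S) ⟨a, ha, rfl⟩
  exact Submodule.finiteDimensional_of_le hle

/-- Intersecting with the finite dimensional sum V of the weight spaces at minus the roots is
strictly monotone on submodules. Indeed, for N < N', a nonzero vector of N'/N has a nonzero multiple
killed by B_{≥ 1}; a nonzero weight component of it has weight -z and lifts to N' ∩ V. -/
theorem IsO.isArtinian [CharZero K] (hM : T.IsO M) : IsArtinian R M := by
  classical
  let V : Submodule K M := ⨆ z : {z // z ∈ T.roots.toFinset}, T.wt M (-(z : K))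
  have hV : Module.Finite K V := by
    have := fun z : {z // z ∈ T.roots.toFinset} => hM.finite_wt (-(z : K))
    exact Module.Finite.iff_fg.mpr (Submodule.fg_iSup _ fun z => Module.Finite.iff_fg.mp (this z))
  let φ : Submodule R M → Submodule K V := fun N => (N.restrictScalars K).comap V.subtype
  have hφ : StrictMono φ := by
    intro N N' hlt
    refine lt_of_le_of_ne (fun x hx => hlt.le hx) fun heq => hlt.not_ge ?_
    by_contra hnot
    obtain ⟨v, hv, hvN⟩ := Set.not_subset.mp hnot
    have hQ := hM.quotient N
    have hv0 : N.mkQ v ≠ 0 := fun h => hvN ((Submodule.Quotient.mk_eq_zero N).mp h)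
    obtain ⟨x, hx, hxk⟩ := hQ.exists_root_vector hv0
    obtain ⟨μ, hμ⟩ := exists_proj_ne_zero hQ.ws_eq_top hx
    have hk := proj_mem_killed hQ.ws_eq_top hxk μ
    obtain ⟨z, hz, hzμ⟩ := exists_root_of_killed hk hμ (internalProj_mem _ _ _)
    let y := internalProj (ws_isInternal hM.ws_eq_top) μ (x • v)
    have hyN' : y ∈ N' := proj_mem_submodule hM.ws_eq_top N' (N'.smul_mem x hv) μ
    have hyV : y ∈ V := by
      refine Submodule.mem_iSup_of_mem (⟨z, List.mem_toFinset.mpr hz⟩ : {z // z ∈ T.roots.toFinset}) ?_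
      rw [← hzμ]
      exact internalProj_mem _ _ _
    have hyN : y ∈ N := by
      have : (⟨y, hyV⟩ : V) ∈ φ N := heq ▸ hyN'
      exact this
    apply hμ
    rw [← map_smul, ← proj_map hM.ws_eq_top hQ.ws_eq_top]
    exact (Submodule.Quotient.mk_eq_zero N).mpr hyN
  exact hφ.wellFoundedLT

end ModulesO

end TriangularDecomposition

/-! ### The universal property of the extension of scalars -/

section BaseChange

variable {R S : Type u} [Ring R] [Ring S] (f : R →+* S)
  {M : Type u} [AddCommGroup M] [Module R M]

theorem btmul_add (s : S) (m m' : M) : btmul f s (m + m') = btmul f s m + btmul f s m' := by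
  simp [btmul, TensorProduct.tmul_add]

theorem smul_btmul (s s' : S) (m : M) : s • btmul f s' m = btmul f (s * s') m := rfl

theorem btmul_smul (s : S) (r : R) (m : M) : btmul f s (r • m) = btmul f (s * f r) m := by
  refine ((Submodule.Quotient.eq _).mpr ?_).symm
  exact Submodule.subset_span ⟨s, r, m, rfl⟩

theorem btmul_one_smul (r : R) (m : M) : btmul f 1 (r • m) = f r • btmul f 1 m := by
  rw [btmul_smul, smul_btmul, one_mul, mul_one]

theorem btmul_eq_smul (s : S) (m : M) : btmul f s m = s • btmul f 1 m := by
  rw [smul_btmul, mul_one]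

/-- The map `m ↦ 1 ⊗ m`. -/
def btmulOne : M →+ BaseChange f M where
  toFun := btmul f 1
  map_zero' := by simp [btmul]
  map_add' := btmul_add f 1

theorem btmulOne_apply (m : M) : btmulOne f m = btmul f 1 m := rfl

theorem span_btmulOne {X : Set M} (hX : Submodule.span R X = ⊤) :
    Submodule.span S (btmulOne f '' X) = ⊤ := by
  have h1 : ∀ m : M, btmulOne f m ∈ Submodule.span S (btmulOne f '' X) := by
    intro m
    have hm : m ∈ Submodule.span R X := hX ▸ Submodule.mem_top
    induction hm using Submodule.span_induction with
    | mem x hx => exact Submodule.subset_span ⟨x, hx, rfl⟩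
    | zero => rw [map_zero]; exact zero_mem _
    | add x y _ _ hx hy => rw [map_add]; exact add_mem hx hy
    | smul r x _ hx =>
      rw [btmulOne_apply, btmul_one_smul]
      exact Submodule.smul_mem _ _ hx
  refine (Submodule.eq_top_iff').mpr fun t => ?_
  obtain ⟨t, rfl⟩ := Submodule.Quotient.mk_surjective _ t
  induction t using TensorProduct.induction_on with
  | zero => exact zero_mem _
  | add x y hx hy => rw [Submodule.Quotient.mk_add]; exact add_mem hx hy
  | tmul s m =>
    have : (Submodule.Quotient.mk (s ⊗ₜ[ℤ] m) : BaseChange f M) = s • btmulOne f m :=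
      btmul_eq_smul f s m
    rw [this]
    exact Submodule.smul_mem _ _ (h1 m)

variable {f} {N : Type*} [AddCommGroup N] [Module S N]

/-- The linear map `S ⊗_R M → N` induced by an `f`-semilinear map `M → N`. -/
def baseChangeLift (φ : M →+ N) (hφ : ∀ (r : R) (m : M), φ (r • m) = f r • φ m) :
    BaseChange f M →ₗ[S] N :=
  Submodule.liftQ _ (TensorProduct.AlgebraTensorModule.lift
    (LinearMap.toSpanSingleton S (M →ₗ[ℤ] N) φ.toIntLinearMap)) <| by
    rw [balanced, Submodule.span_le]
    rintro _ ⟨s, r, m, rfl⟩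
    simp [hφ, mul_smul]

@[simp]
theorem baseChangeLift_btmul (φ : M →+ N) (hφ : ∀ (r : R) (m : M), φ (r • m) = f r • φ m)
    (s : S) (m : M) : baseChangeLift φ hφ (btmul f s m) = s • φ m := rfl

theorem baseChange_hom_ext {g g' : BaseChange f M →ₗ[S] N}
    (h : ∀ m, g (btmulOne f m) = g' (btmulOne f m)) : g = g' := by
  refine LinearMap.ext_on (span_btmulOne f (Submodule.span_univ (R := R) (M := M))) ?_
  rintro _ ⟨m, -, rfl⟩
  exact h m

end BaseChange

/-! ### Modules generated by killed vectors, and lifting of weight vectors -/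

namespace TriangularDecomposition

section Killed

variable {K : Type w} [Field K] {R : Type u} [Ring R] [Algebra K R]
  {T : TriangularDecomposition K R}
  {M : Type u} [AddCommGroup M] [Module R M] [Module K M] [IsScalarTower K R M]

/-- For b in B_{-k} and r in R_n, the product b r has degree n - k, so its terms in A_i H B_{-j}
satisfy j = i + k - n. This is at least N as soon as k ≥ N + n, and then all terms kill m. -/
theorem exists_smul_mem_killed {N : ℕ} {m : M} (hm : m ∈ T.killed M N) (r : R) :
    ∃ N', r • m ∈ T.killed M N' := by
  have hr : r ∈ ⨆ n, T.gr n := by rw [T.isInternal.submodule_iSup_eq_top]; trivial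
  induction hr using Submodule.iSup_induction' with
  | zero => exact ⟨0, by rw [zero_smul]; exact zero_mem _⟩
  | add x y _ _ hx hy =>
    obtain ⟨N₁, h₁⟩ := hx
    obtain ⟨N₂, h₂⟩ := hy
    refine ⟨max N₁ N₂, ?_⟩
    rw [add_smul]
    exact add_mem (killed_anti (le_max_left _ _) h₁) (killed_anti (le_max_right _ _) h₂)
  | mem n r hr =>
    refine ⟨N + n.toNat, mem_killed_iff.mpr fun k hk b hb => ?_⟩
    rw [← mul_smul]
    refine leftIdeal_smul hm ?_
    have h := mem_homogeneous (T.graded_mul hb.2 hr)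
    have hle : (⨆ (i : ℕ) (j : ℕ) (_ : (i : ℤ) - j = -k + n), T.degA i * T.SH * T.degB j) ≤
        (T.leftIdeal N).restrictScalars K := by
      rw [leftIdeal_eq]
      refine iSup_le fun i => iSup_le fun j => iSup_le fun hij => ?_
      exact mul_le_mul' (mul_le_mul' inf_le_left le_rfl) (degB_le_Bge (by omega))
    exact hle h

theorem isO_of_span {S : Set M} (hfin : S.Finite) (hS : ∀ m ∈ S, ∃ N, m ∈ T.killed M N)
    (hspan : Submodule.span R S = ⊤) : T.IsO M where
  finite := ⟨hfin.toFinset, by simpa using hspan⟩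
  exists_killed m := by
    have hm : m ∈ Submodule.span R S := hspan ▸ Submodule.mem_top
    induction hm using Submodule.span_induction with
    | mem x hx => exact hS x hx
    | zero => exact ⟨0, zero_mem _⟩
    | add x y _ _ hx hy =>
      obtain ⟨N₁, h₁⟩ := hx
      obtain ⟨N₂, h₂⟩ := hy
      exact ⟨max N₁ N₂, add_mem (killed_anti (le_max_left _ _) h₁)
        (killed_anti (le_max_right _ _) h₂)⟩
    | smul r x _ hx =>
      obtain ⟨N, h⟩ := hx
      exact exists_smul_mem_killed h r

/-- Linear maps commute with the projections to weight spaces, so the μ-component of any preimage is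
again a preimage. -/
theorem exists_wt_lift {M' : Type u} [AddCommGroup M'] [Module R M'] [Module K M']
    [IsScalarTower K R M'] (h : ws (act K T.del M) = ⊤) (f : M →ₗ[R] M')
    (hf : Function.Surjective f) {μ : K} {y : M'} (hy : y ∈ T.wt M' μ) :
    ∃ x ∈ T.wt M μ, f x = y := by
  classical
  have h' : ws (act K T.del M') = ⊤ := by
    refine (Submodule.eq_top_iff').mpr fun y => ?_
    obtain ⟨x, rfl⟩ := hf y
    have hx : x ∈ ws (act K T.del M) := h ▸ Submodule.mem_top
    unfold ws at hx
    induction hx using Submodule.iSup_induction' with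
    | mem μ x hx => exact Submodule.mem_iSup_of_mem μ (map_mem_wt f hx)
    | zero => rw [map_zero]; exact zero_mem _
    | add x y _ _ hx hy => rw [map_add]; exact add_mem hx hy
  obtain ⟨x, rfl⟩ := hf y
  refine ⟨internalProj (ws_isInternal h) μ x, internalProj_mem _ _ _, ?_⟩
  rw [proj_map h h', internalProj_of_mem _ hy]

variable (T M) in
/-- The vectors killed by `⨁_{n ≥ N} B_{-n}`, as an `H`-module. -/
def killedH (N : ℕ) : Submodule T.H M where
  __ := (T.killed M N).toAddSubmonoid
  smul_mem' h _ hm := H_smul_mem_killed h.2 hm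

variable (T M) in
/-- A generalized weight space, as an `H`-module. -/
def wtH (μ : K) : Submodule T.H M where
  __ := (T.wt M μ).toAddSubmonoid
  smul_mem' h m hm := by
    have := smul_mem_wt (mem_gr_zero h.2) (show m ∈ T.wt M μ from hm)
    rwa [Int.cast_zero, add_zero] at this

theorem mem_wtH {μ : K} {m : M} : m ∈ T.wtH M μ ↔ m ∈ T.wt M μ := Iff.rfl

end Killed

/-! ### Verma modules -/

section Verma

open ModuleCat

variable {K : Type w} [Field K] {R : Type u} [Ring R] [Algebra K R]
  {T : TriangularDecomposition K R} (W : ModuleCat.{u} T.H)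

/-- The canonical map `W → Δ(W)`. -/
def vermaIncl : W →ₗ[T.H] T.verma W where
  toFun m := Submodule.Quotient.mk (btmulOne (T.H.val : T.H →+* R) m)
  map_add' x y := by rw [map_add]; rfl
  map_smul' h m := by
    rw [btmulOne_apply, btmul_one_smul]
    rfl

theorem vermaIncl_mem_killed (v : W) : vermaIncl W v ∈ T.killed (T.verma W) 1 := by
  intro b hb
  refine (Submodule.Quotient.mk_eq_zero _).mpr (Submodule.subset_span ⟨b, Bneg_eq (T := T) ▸ hb, v, ?_⟩)
  exact (btmul_eq_smul _ b v).symm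

theorem span_vermaIncl : Submodule.span R (Set.range (vermaIncl W)) = ⊤ := by
  have h := span_btmulOne (T.H.val : T.H →+* R) (Submodule.span_univ (R := T.H) (M := W))
  rw [Set.image_univ] at h
  have h2 := congrArg (Submodule.map (Submodule.span R {x | ∃ b ∈ T.Bneg, ∃ w : W,
    x = btmul (T.H.val : T.H →+* R) b w}).mkQ) h
  rw [Submodule.map_span, Submodule.map_top, Submodule.range_mkQ, ← Set.range_comp] at h2
  exact h2

variable {W} {M : Type u} [AddCommGroup M] [Module R M] [Module K M] [IsScalarTower K R M]

/-- The universal property of `Δ(W)`. -/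
def vermaLift (φ : W →ₗ[T.H] M) (hφ : ∀ v, φ v ∈ T.killed M 1) : T.verma W →ₗ[R] M :=
  Submodule.liftQ _ (baseChangeLift (f := (T.H.val : T.H →+* R)) φ.toAddMonoidHom
    fun r m => map_smul φ r m) <| by
    refine Submodule.span_le.mpr ?_
    rintro _ ⟨b, hb, v, rfl⟩
    exact hφ v b (Bneg_eq (T := T) ▸ hb)

theorem vermaLift_vermaIncl (φ : W →ₗ[T.H] M) (hφ : ∀ v, φ v ∈ T.killed M 1) (v : W) :
    vermaLift φ hφ (vermaIncl W v) = φ v := by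
  change (1 : R) • φ v = φ v
  rw [one_smul]

variable (T) in
theorem isSemisimpleRing_H : IsSemisimpleRing T.H := by
  obtain ⟨k, d, ⟨e⟩⟩ := T.H_split
  exact e.symm.toRingEquiv.isSemisimpleRing

/-- W is a left ideal of the semisimple algebra H, and H embeds into R / R B_{≥ 1}, where it is
killed by B_{≥ 1}. The induced map from Δ(W) detects W. -/
theorem vermaIncl_injective (hW : IsSimpleModule T.H W) : Function.Injective (vermaIncl W) := by
  have := isSemisimpleRing_H T
  obtain ⟨I, ⟨e⟩⟩ := IsSemisimpleRing.exists_linearEquiv_ideal_of_isSimpleModule T.H W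
  let j : T.H →ₗ[T.H] (R ⧸ T.leftIdeal 1) :=
    { toFun := fun h => Submodule.Quotient.mk (h : R)
      map_add' := fun _ _ => rfl
      map_smul' := fun _ _ => rfl }
  have hj : Function.Injective j := by
    rw [← LinearMap.ker_eq_bot, LinearMap.ker_eq_bot']
    intro h hh
    exact Subtype.ext (H_inf_leftIdeal h.2 ((Submodule.Quotient.mk_eq_zero _).mp hh))
  let φ : W →ₗ[T.H] (R ⧸ T.leftIdeal 1) := j ∘ₗ I.subtype ∘ₗ e.toLinearMap
  have hφ : ∀ v, φ v ∈ T.killed (R ⧸ T.leftIdeal 1) 1 := fun v b hb =>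
    (Submodule.Quotient.mk_eq_zero _).mpr
      (H_mul_leftIdeal (e v : T.H).2 (Submodule.subset_span hb))
  have hinj : Function.Injective φ := hj.comp (I.injective_subtype.comp e.injective)
  intro v v' h
  apply hinj
  rw [← vermaLift_vermaIncl φ hφ, h, vermaLift_vermaIncl]

theorem isO_verma (hW : Module.Finite T.H W) : T.IsO (T.verma W) := by
  obtain ⟨S, hS⟩ := hW.fg_top
  refine isO_of_span (S := vermaIncl W '' S) (S.finite_toSet.image _) ?_ ?_
  · rintro _ ⟨v, -, rfl⟩
    exact ⟨1, vermaIncl_mem_killed W v⟩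
  · refine eq_top_iff.mpr ?_
    rw [← span_vermaIncl W, Submodule.span_le]
    rintro _ ⟨v, rfl⟩
    have hv : v ∈ Submodule.span T.H (S : Set W) := hS ▸ Submodule.mem_top
    induction hv using Submodule.span_induction with
    | mem x hx => exact Submodule.subset_span ⟨x, hx, rfl⟩
    | zero => rw [map_zero]; exact zero_mem _
    | add x y _ _ hx hy => rw [map_add]; exact add_mem hx hy
    | smul r x _ hx => rw [map_smul]; exact Submodule.smul_mem _ (r : R) hx

/-- The central element `∂₀` of `H`. -/
def delZeroH (T : TriangularDecomposition K R) : T.H := ⟨T.delZero, delZero_mem⟩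

theorem delZeroH_comm (h : T.H) : T.delZeroH * h = h * T.delZeroH :=
  Subtype.ext (delZero_comm h.2)

/-- The eigenspaces of the central element ∂₀ are H-submodules, hence zero or everything. They
cannot all vanish, since the product of the ∂₀ - z over the roots is zero. -/
theorem exists_delZero_scalar (hW : IsSimpleModule T.H W) :
    ∃ z : K, ∀ v : W, T.delZeroH • v = algebraMap K T.H z • v := by
  have := IsSimpleModule.nontrivial T.H W
  let N (z : K) : Submodule T.H W :=
    { carrier := {v | T.delZeroH • v = algebraMap K T.H z • v}
      add_mem' := fun {x y} hx hy => by
        simp only [Set.mem_ofPred_eq] at hx hy ⊢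
        rw [smul_add, hx, hy, smul_add]
      zero_mem' := by simp
      smul_mem' := fun h v hv => by
        simp only [Set.mem_ofPred_eq] at hv ⊢
        rw [← mul_smul, delZeroH_comm, mul_smul, hv, ← mul_smul, ← mul_smul, Algebra.commutes] }
  suffices h : ∃ z, N z ≠ ⊥ by
    obtain ⟨z, hz⟩ := h
    have := (eq_bot_or_eq_top (N z)).resolve_left hz
    exact ⟨z, fun v => (this ▸ Submodule.mem_top : v ∈ N z)⟩
  by_contra! hcon
  have key : ∀ (l : List K) (v : W),
      (l.map fun z => T.delZeroH - algebraMap K T.H z).prod • v = 0 → v = 0 := by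
    intro l
    induction l with
    | nil => intro v h; simpa using h
    | cons z l ih =>
      intro v h
      rw [List.map_cons, List.prod_cons, mul_smul] at h
      refine ih v ?_
      have : (l.map fun z => T.delZeroH - algebraMap K T.H z).prod • v ∈ N z := by
        change T.delZeroH • _ = _
        rwa [sub_smul, sub_eq_zero] at h
      rw [hcon z] at this
      exact this
  obtain ⟨v, hv⟩ := exists_ne (0 : W)
  exact hv (key T.roots v (by
    have := roots_prod (T := T)
    change (T.roots.map fun z => T.delZeroH - algebraMap K T.H z).prod = 0 at this
    rw [this, zero_smul]))

theorem leftIdeal_one_eq : (T.leftIdeal 1).restrictScalars K =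
    T.SA * T.SH * T.Bneg := by rw [leftIdeal_eq, Bneg_eq]

/-- The element chosen in the definition of `c` is ∂₀ by uniqueness, and the existence condition
there holds, so the default value never occurs. -/
theorem c_spec (W : T.Irr) (v : W.rep) : T.delZeroH • v = algebraMap K T.H (T.c W) • v := by
  have h : ∃ a : K, ∃ d₀ : T.H,
      T.del + (d₀ : R) ∈ Subalgebra.toSubmodule T.A * Subalgebra.toSubmodule T.H * T.Bneg ∧
      ∀ v : W.rep, d₀ • v = algebraMap K T.H a • v := by
    obtain ⟨z, hz⟩ := exists_delZero_scalar (T := T) (W := W.rep) W.2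
    exact ⟨z, T.delZeroH, leftIdeal_one_eq (T := T) ▸ del_add_delZero_mem, hz⟩
  obtain ⟨d, hd, hd'⟩ := h.choose_spec
  have hc : T.c W = h.choose := dif_pos h
  rw [← leftIdeal_one_eq] at hd
  have : d = T.delZeroH := Subtype.ext (delZero_unique d.2 hd)
  rw [hc, ← this]
  exact hd' v

end Verma

end TriangularDecomposition

namespace TriangularDecomposition

/-! ### Simple quotients of Verma modules -/

section Simple

open ModuleCat

variable {K : Type w} [Field K] {R : Type u} [Ring R] [Algebra K R]
  {T : TriangularDecomposition K R} (W : T.Irr)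

instance isSimpleModule_rep : IsSimpleModule T.H W.rep := W.2

theorem isO_verma_rep : T.IsO (T.verma W.rep) := isO_verma inferInstance

theorem rep_injective {W E : T.Irr} (e : W.rep ≃ₗ[T.H] E.rep) : W = E := by
  refine Subtype.ext ?_
  exact skeleton_skeletal _ ⟨(fromSkeleton (ModuleCat.{u} T.H)).preimageIso e.toModuleIso⟩

theorem exists_rep (V : Type u) [AddCommGroup V] [Module T.H V] [IsSimpleModule T.H V] :
    ∃ W : T.Irr, Nonempty (W.rep ≃ₗ[T.H] V) := by
  let e : (fromSkeleton (ModuleCat.{u} T.H)).obj (toSkeleton (ModuleCat.of T.H V)) ≃ₗ[T.H] V :=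
    (fromSkeletonToSkeletonIso (ModuleCat.of T.H V)).toLinearEquiv
  exact ⟨⟨toSkeleton (ModuleCat.of T.H V), IsSimpleModule.congr e⟩, ⟨e⟩⟩

/-- Every simple module occurs in H, and its class is determined by its isotypic component; a
semisimple ring has only finitely many of these. -/
theorem finite_irr : Finite T.Irr := by
  have := isSemisimpleRing_H T
  choose I hI using fun W : T.Irr =>
    IsSemisimpleRing.exists_linearEquiv_ideal_of_isSimpleModule T.H W.rep
  have hs : ∀ W, IsSimpleModule T.H (I W) := fun W => IsSimpleModule.congr (hI W).some.symm
  let φ : T.Irr → isotypicComponents T.H T.H := fun W =>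
    ⟨isotypicComponent T.H T.H (I W), I W, hs W, rfl⟩
  refine Finite.of_injective φ fun W E h => ?_
  have h1 : I W ≤ isotypicComponent T.H T.H (I E) :=
    (Submodule.le_isotypicComponent (I W)).trans (congrArg Subtype.val h).le
  have h2 := IsIsotypicOfType.isotypicComponent T.H T.H (I E)
  have h3 := (isIsotypicOfType_submodule_iff.mp h2) (I W) h1
  exact rep_injective ((hI W).some.trans (h3.some.trans (hI E).some.symm))

theorem vermaIncl_mem_wt (v : W.rep) : vermaIncl W.rep v ∈ T.wt (T.verma W.rep) (-T.c W) := by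
  refine (Module.End.mem_maxGenEigenspace _ _ _).mpr ⟨1, ?_⟩
  rw [pow_one, LinearMap.sub_apply, act_apply, del_smul_of_killed (vermaIncl_mem_killed _ v)]
  have : T.delZero • (vermaIncl W.rep v : T.verma W.rep) = T.c W • vermaIncl W.rep v := by
    have h := congrArg (vermaIncl W.rep) (c_spec W v)
    rw [map_smul, map_smul] at h
    change T.delZero • (vermaIncl W.rep v : T.verma W.rep) =
      (algebraMap K T.H (T.c W) : R) • (vermaIncl W.rep v : T.verma W.rep) at h
    rw [h]
    exact algebraMap_smul R (T.c W) (vermaIncl W.rep v : T.verma W.rep)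
  rw [this]
  simp

theorem span_A_vermaIncl : Submodule.span T.A (Set.range (vermaIncl W.rep)) = ⊤ := by
  obtain ⟨G, hG⟩ := exists_span_H_mul_lowB (T := T) 1
  have hlow : T.lowB 1 ≤ 1 := by
    rw [← degB_zero_eq (T := T)]
    exact iSup_le fun i => by rw [Fin.eq_zero i]; exact le_rfl
  have hGH : ∀ g ∈ G, g ∈ T.H := fun g hg => by
    have h1 : g ∈ T.SH * T.lowB 1 := hG ▸ Submodule.subset_span hg
    have h2 := mul_le_mul' (le_refl T.SH) hlow h1
    rwa [mul_one] at h2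
  have h := span_A_eq_top (T := T) (N := 1) (S := Set.range (vermaIncl W.rep))
    (by rintro _ ⟨v, rfl⟩; exact vermaIncl_mem_killed _ v) (span_vermaIncl _) hG
  refine eq_top_iff.mpr (h ▸ Submodule.span_mono ?_)
  rintro _ ⟨g, hg, _, ⟨v, rfl⟩, rfl⟩
  exact ⟨(⟨g, hGH g hg⟩ : T.H) • v, map_smul _ _ _⟩

variable [CharZero K]

/-- Δ(W) is generated over A by the image of W, all of whose vectors have weight -c(W). -/
theorem wt_verma_le (ν : K) : T.wt (T.verma W.rep) ν ≤
    Submodule.span K {y | ∃ (n : ℕ) (a : R) (v : W.rep), a ∈ T.degA n ∧ -T.c W + n = ν ∧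
      y = a • vermaIncl W.rep v} := by
  intro x hx
  have := wt_le_span (isO_verma_rep W).ws_eq_top
    (S := Set.range (vermaIncl W.rep)) (by rintro _ ⟨v, rfl⟩; exact ⟨_, vermaIncl_mem_wt W v⟩)
    (span_A_vermaIncl W) ν hx
  refine Submodule.span_le.mpr ?_ this
  rintro _ ⟨n, w, a, _, ha, ⟨v, rfl⟩, hw, hwn, rfl⟩
  by_cases h0 : vermaIncl W.rep v = 0
  · rw [h0, smul_zero]; exact zero_mem _
  · have := eq_of_mem_maxGenEigenspace h0 hw (vermaIncl_mem_wt W v)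
    subst this
    exact Submodule.subset_span ⟨n, a, v, ha, hwn, rfl⟩

theorem exists_weight_verma {ν : K} {x : T.verma W.rep} (hx : x ∈ T.wt (T.verma W.rep) ν)
    (h0 : x ≠ 0) : ∃ n : ℕ, ν = -T.c W + n := by
  by_contra! hcon
  have := wt_verma_le W ν hx
  have hem : {y | ∃ (n : ℕ) (a : R) (v : W.rep), a ∈ T.degA n ∧ -T.c W + n = ν ∧
      y = a • vermaIncl W.rep v} = ∅ := by
    ext y
    simp only [Set.mem_ofPred_eq, Set.mem_empty_iff_false, iff_false]
    rintro ⟨n, -, -, -, h, -⟩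
    exact hcon n h.symm
  rw [hem, Submodule.span_empty] at this
  exact h0 this

theorem wt_verma_eq {x : T.verma W.rep} (hx : x ∈ T.wt (T.verma W.rep) (-T.c W)) :
    ∃ v, vermaIncl W.rep v = x := by
  have := wt_verma_le W _ hx
  clear hx
  induction this using Submodule.span_induction with
  | mem x hx =>
    obtain ⟨n, a, v, ha, hn, rfl⟩ := hx
    have : n = 0 := by simpa using hn
    subst this
    rw [degA_zero_eq] at ha
    obtain ⟨c, rfl⟩ := Submodule.mem_one.mp ha
    exact ⟨algebraMap K T.H c • v, map_smul _ _ _⟩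
  | zero => exact ⟨0, map_zero _⟩
  | add x y _ _ hx hy =>
    obtain ⟨v, rfl⟩ := hx
    obtain ⟨v', rfl⟩ := hy
    exact ⟨v + v', map_add _ _ _⟩
  | smul c x _ hx =>
    obtain ⟨v, rfl⟩ := hx
    refine ⟨algebraMap K T.H c • v, ?_⟩
    rw [map_smul]
    exact algebraMap_smul R c (vermaIncl W.rep v : T.verma W.rep)

open Classical in
/-- The largest submodule of `Δ(W)` without component of weight `-c(W)`. -/
def vermaRad : Submodule R (T.verma W.rep) where
  carrier := {m | ∀ r : R,
    internalProj (ws_isInternal (isO_verma_rep W).ws_eq_top) (-T.c W) (r • m) = 0}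
  add_mem' hx hy r := by rw [smul_add, map_add, hx r, hy r, add_zero]
  zero_mem' r := by rw [smul_zero, map_zero]
  smul_mem' s m hm r := by rw [← mul_smul]; exact hm _

theorem eq_top_of_vermaIncl_mem {N : Submodule R (T.verma W.rep)} {v : W.rep} (hv : v ≠ 0)
    (h : vermaIncl W.rep v ∈ N) : N = ⊤ := by
  let N' : Submodule T.H W.rep :=
    { carrier := {v | vermaIncl W.rep v ∈ N}
      add_mem' := fun hx hy => by
        rw [Set.mem_ofPred_eq, map_add]; exact add_mem hx hy
      zero_mem' := by rw [Set.mem_ofPred_eq, map_zero]; exact zero_mem _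
      smul_mem' := fun h x hx => by
        rw [Set.mem_ofPred_eq, map_smul]; exact N.smul_mem (h : R) hx }
  have hN' : N' = ⊤ := (eq_bot_or_eq_top N').resolve_left fun hbot => hv (by
    have : v ∈ N' := h
    rwa [hbot] at this)
  rw [eq_top_iff, ← span_vermaIncl, Submodule.span_le]
  rintro _ ⟨x, rfl⟩
  exact (hN' ▸ Submodule.mem_top : x ∈ N')

/-- N contains the weight components of its vectors. A nonzero component of weight -c(W) comes from
W and, W being simple, generates Δ(W). -/
theorem le_vermaRad {N : Submodule R (T.verma W.rep)} (hN : N ≠ ⊤) : N ≤ vermaRad W := by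
  classical
  intro m hm r
  have h1 := proj_mem_submodule (isO_verma_rep W).ws_eq_top N (N.smul_mem r hm) (-T.c W)
  obtain ⟨v, hv⟩ := wt_verma_eq W
    (internalProj_mem (ws_isInternal (isO_verma_rep W).ws_eq_top) (-T.c W) (r • m))
  by_contra hne
  refine hN (eq_top_of_vermaIncl_mem W (v := v) ?_ (by convert h1))
  rintro rfl
  rw [map_zero] at hv
  exact hne (by convert hv.symm)

theorem vermaIncl_notMem_vermaRad {v : W.rep} (hv : v ≠ 0) :
    vermaIncl W.rep v ∉ vermaRad W := by
  classical
  intro h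
  have := h 1
  rw [one_smul, internalProj_of_mem _ (vermaIncl_mem_wt W v)] at this
  exact hv (vermaIncl_injective W.2 (this.trans (map_zero _).symm))

theorem vermaRad_ne_top : vermaRad W ≠ ⊤ := by
  have := IsSimpleModule.nontrivial T.H W.rep
  obtain ⟨v, hv⟩ := exists_ne (0 : W.rep)
  exact fun h => vermaIncl_notMem_vermaRad W hv (h ▸ Submodule.mem_top)

theorem isCoatom_vermaRad : IsCoatom (vermaRad W) :=
  ⟨vermaRad_ne_top W, fun N hN => by
    by_contra h
    exact hN.not_ge (le_vermaRad W h)⟩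

/-- The simple quotient `L(W)` of `Δ(W)`. -/
abbrev simpleQuot : Type u := T.verma W.rep ⧸ vermaRad W

instance isSimpleModule_simpleQuot : IsSimpleModule R (simpleQuot W) :=
  isSimpleModule_iff_isCoatom.mpr (isCoatom_vermaRad W)

theorem isO_simpleQuot : T.IsO (simpleQuot W) := (isO_verma_rep W).quotient _

/-- The canonical map `W → L(W)`. -/
def simpleIncl : W.rep →ₗ[T.H] simpleQuot W where
  toFun v := (vermaRad W).mkQ (vermaIncl W.rep v)
  map_add' x y := by rw [map_add, map_add]
  map_smul' h x := by
    rw [map_smul]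
    rfl

theorem simpleIncl_ne_zero {v : W.rep} (hv : v ≠ 0) : simpleIncl W v ≠ 0 := fun h =>
  vermaIncl_notMem_vermaRad W hv ((Submodule.Quotient.mk_eq_zero _).mp h)

theorem simpleIncl_injective : Function.Injective (simpleIncl W) := by
  refine (injective_iff_map_eq_zero _).mpr fun v hv => ?_
  by_contra h
  exact simpleIncl_ne_zero W h hv

theorem simpleIncl_mem_wt (v : W.rep) : simpleIncl W v ∈ T.wt (simpleQuot W) (-T.c W) :=
  map_mem_wt (vermaRad W).mkQ (vermaIncl_mem_wt W v)

theorem simpleIncl_mem_killed (v : W.rep) : simpleIncl W v ∈ T.killed (simpleQuot W) 1 := by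
  intro b hb
  have := congrArg (vermaRad W).mkQ (vermaIncl_mem_killed W.rep v b hb)
  rwa [map_smul, map_zero] at this

theorem wt_simpleQuot_eq {x : simpleQuot W} (hx : x ∈ T.wt (simpleQuot W) (-T.c W)) :
    ∃ v, simpleIncl W v = x := by
  obtain ⟨y, hy, rfl⟩ := exists_wt_lift (isO_verma_rep W).ws_eq_top (vermaRad W).mkQ
    (vermaRad W).mkQ_surjective hx
  obtain ⟨v, rfl⟩ := wt_verma_eq W hy
  exact ⟨v, rfl⟩

theorem exists_weight_simpleQuot {ν : K} {x : simpleQuot W} (hx : x ∈ T.wt (simpleQuot W) ν)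
    (h0 : x ≠ 0) : ∃ n : ℕ, ν = -T.c W + n := by
  obtain ⟨y, hy, rfl⟩ := exists_wt_lift (isO_verma_rep W).ws_eq_top (vermaRad W).mkQ
    (vermaRad W).mkQ_surjective hx
  exact exists_weight_verma W hy fun h => h0 (by rw [h, map_zero])

-- All weights of L(E) lie in -c(E) + ℕ. Using this in both directions forces c(W) = c(E), and the
-- isomorphism then carries the lowest weight space W into E.
variable {W} in
theorem eq_of_simpleQuot_equiv {E : T.Irr} (f : simpleQuot W ≃ₗ[R] simpleQuot E) : W = E := by
  have key : ∀ {W E : T.Irr} (f : simpleQuot W ≃ₗ[R] simpleQuot E),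
      ∃ n : ℕ, -T.c W = -T.c E + n := by
    intro W E f
    have := IsSimpleModule.nontrivial T.H W.rep
    obtain ⟨v, hv⟩ := exists_ne (0 : W.rep)
    exact exists_weight_simpleQuot E (map_mem_wt f.toLinearMap (simpleIncl_mem_wt W v))
      fun h => simpleIncl_ne_zero W hv (f.map_eq_zero_iff.mp h)
  obtain ⟨n, hn⟩ := key f
  obtain ⟨m, hm⟩ := key f.symm
  have h0 : ((n + m : ℕ) : K) = 0 := by
    push_cast
    linear_combination -hn - hm
  have hn0 : n = 0 := by
    have := Nat.cast_eq_zero.mp h0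
    omega
  subst hn0
  have hc : T.c W = T.c E := by simpa using hn
  have hmem : ∀ v, ∃ e, simpleIncl E e = f (simpleIncl W v) := fun v =>
    wt_simpleQuot_eq E (hc ▸ map_mem_wt f.toLinearMap (simpleIncl_mem_wt W v))
  let φ : W.rep →ₗ[T.H] simpleQuot E :=
    { toFun := fun v => f (simpleIncl W v)
      map_add' := fun x y => by rw [map_add, map_add]
      map_smul' := fun h x => by
        rw [map_smul]
        exact map_smul f (h : R) (simpleIncl W x) }
  let ψ := (LinearEquiv.ofInjective (simpleIncl E) (simpleIncl_injective E)).symm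
  let g : W.rep →ₗ[T.H] E.rep := ψ.toLinearMap ∘ₗ
    φ.codRestrict (LinearMap.range (simpleIncl E)) fun v => hmem v
  have hg : Function.Injective g := ψ.injective.comp fun v v' h =>
    simpleIncl_injective W (f.injective (congrArg Subtype.val h))
  have := IsSimpleModule.nontrivial T.H W.rep
  exact rep_injective (LinearEquiv.ofBijective g (LinearMap.bijective_of_ne_zero fun h => by
    obtain ⟨v, hv⟩ := exists_ne (0 : W.rep)
    exact hv (hg (by rw [h]; rfl))))

/-- The vectors of S killed by B_{≥ 1} form a nonzero H-module. A simple submodule W of it induces a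
map Δ(W) → S, onto by simplicity, whose kernel is a maximal submodule and so must be the radical. -/
theorem exists_equiv_simpleQuot {S : Type u} [AddCommGroup S] [Module R S] [Module K S]
    [IsScalarTower K R S] (hS : T.IsO S) [IsSimpleModule R S] :
    ∃ W : T.Irr, Nonempty (S ≃ₗ[R] simpleQuot W) := by
  have := isSemisimpleRing_H T
  have hnt := IsSimpleModule.nontrivial R S
  obtain ⟨v, hv⟩ := exists_ne (0 : S)
  obtain ⟨x, hx, hxk⟩ := hS.exists_root_vector hv
  have hnt' : Nontrivial (T.killedH S 1) :=
    ⟨⟨x • v, hxk⟩, 0, fun h => hx (congrArg Subtype.val h)⟩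
  obtain ⟨V, hV⟩ := IsSemisimpleModule.exists_simple_submodule T.H (T.killedH S 1)
  obtain ⟨W, ⟨e⟩⟩ := exists_rep (T := T) V
  let φ : W.rep →ₗ[T.H] S := (T.killedH S 1).subtype ∘ₗ V.subtype ∘ₗ e.toLinearMap
  let g := vermaLift φ fun v => (V.subtype (e v)).2
  have hg0 : g ≠ 0 := by
    intro h
    have hnW := IsSimpleModule.nontrivial T.H W.rep
    obtain ⟨v, hv⟩ := exists_ne (0 : W.rep)
    have h1 := vermaLift_vermaIncl φ (fun v => (V.subtype (e v)).2) v
    change g _ = _ at h1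
    rw [h, LinearMap.zero_apply] at h1
    exact hv (e.map_eq_zero_iff.mp (Subtype.ext (Subtype.ext h1.symm)))
  have hsurj : Function.Surjective g := LinearMap.surjective_of_ne_zero hg0
  have e1 := g.quotKerEquivOfSurjective hsurj
  have hker : IsCoatom (LinearMap.ker g) :=
    isSimpleModule_iff_isCoatom.mp (IsSimpleModule.congr e1)
  have heq : LinearMap.ker g = vermaRad W := by
    rcases (le_vermaRad W hker.1).eq_or_lt with h | h
    · exact h
    · exact absurd (hker.2 _ h) (vermaRad_ne_top W)
  exact ⟨W, ⟨e1.symm.trans (Submodule.quotEquivOfEq _ _ heq)⟩⟩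

/-- The composition factors `L(E)` of the radical of `Δ(W)` satisfy `E < W`. -/
theorem lt_of_subquotient {E : T.Irr} {Y : Type u} [AddCommGroup Y] [Module R Y]
    (i : Y →ₗ[R] vermaRad W) (hi : Function.Injective i)
    (q : Y →ₗ[R] simpleQuot E) (hq : Function.Surjective q) [IsNoetherianRing R] : T.lt E W := by
  let _ : Module K Y := Module.compHom Y (algebraMap K R)
  have : IsScalarTower K R Y := ⟨fun a b c => by
    rw [Algebra.smul_def, mul_smul]; rfl⟩
  have hY : T.IsO Y := ((isO_verma_rep W).submodule (vermaRad W)).of_injective i hi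
  have := IsSimpleModule.nontrivial T.H E.rep
  obtain ⟨v, hv⟩ := exists_ne (0 : E.rep)
  obtain ⟨y, hy, hyv⟩ := exists_wt_lift hY.ws_eq_top q hq (simpleIncl_mem_wt E v)
  let x : T.verma W.rep := i y
  have hy0 : y ≠ 0 := by
    rintro rfl
    rw [map_zero] at hyv
    exact simpleIncl_ne_zero E hv hyv.symm
  have hx0 : x ≠ 0 := fun h => hy0 (hi (by rw [map_zero]; exact Subtype.ext h))
  have hx : x ∈ T.wt (T.verma W.rep) (-T.c E) :=
    map_mem_wt ((vermaRad W).subtype ∘ₗ i) hy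
  obtain ⟨n, hn⟩ := exists_weight_verma W hx hx0
  -- If n = 0, the lifted vector has the lowest weight -c(W), so it comes from W, while the radical
  -- meets the image of W only in 0.
  refine ⟨n, Nat.pos_of_ne_zero ?_, by linear_combination hn⟩
  rintro rfl
  rw [Nat.cast_zero, add_zero] at hn
  rw [hn] at hx
  obtain ⟨v', hv'⟩ := wt_verma_eq W hx
  refine vermaIncl_notMem_vermaRad W (v := v') ?_ (hv' ▸ (i y).2)
  rintro rfl
  exact hx0 (by rw [← hv', map_zero])

theorem isStrictOrder_lt : IsStrictOrder T.Irr T.lt where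
  irrefl W := by
    rintro ⟨n, hn, h⟩
    rw [sub_self, eq_comm, Nat.cast_eq_zero] at h
    omega
  trans W E F := by
    rintro ⟨n, hn, h⟩ ⟨m, hm, h'⟩
    exact ⟨n + m, by omega, by push_cast; linear_combination h + h'⟩

end Simple

end TriangularDecomposition

theorem exists_weight_basis {K : Type*} [Field K] {V : Type*} [AddCommGroup V] [Module K V]
    [Module.Finite K V] {D : Module.End K V} (h : ws D = ⊤) :
    ∃ (m : ℕ) (v : Module.Basis (Fin m) K V), ∀ i, ∃ μ, v i ∈ D.maxGenEigenspace μ := by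
  classical
  let b := (ws_isInternal h).collectedBasis fun μ =>
    Module.Basis.ofVectorSpace K (D.maxGenEigenspace μ)
  have hfin := Module.Finite.finite_basis b
  obtain ⟨m, ⟨e⟩⟩ := hfin.exists_equiv_fin
  refine ⟨m, b.reindex e, fun i => ⟨(e.symm i).1, ?_⟩⟩
  rw [Module.Basis.reindex_apply]
  exact (ws_isInternal h).collectedBasis_mem _ _

namespace TriangularDecomposition

variable {K : Type w} [Field K] {R : Type u} [Ring R] [Algebra K R]
  {T : TriangularDecomposition K R}

/-! ### The modules `R / R B_{≥ N}` -/

section QuotQ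

variable (T) in
/-- The module `R / ∑_{n ≥ N} R B_{-n}`. -/
def quotQ (N : ℕ) : Type u := R ⧸ T.leftIdeal N

instance (N : ℕ) : AddCommGroup (T.quotQ N) := inferInstanceAs (AddCommGroup (R ⧸ T.leftIdeal N))
instance (N : ℕ) : Module R (T.quotQ N) := inferInstanceAs (Module R (R ⧸ T.leftIdeal N))
instance (N : ℕ) : Module K (T.quotQ N) := inferInstanceAs (Module K (R ⧸ T.leftIdeal N))
instance (N : ℕ) : IsScalarTower K R (T.quotQ N) :=
  inferInstanceAs (IsScalarTower K R (R ⧸ T.leftIdeal N))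

variable (T) in
/-- The projection `R → R / ∑_{n ≥ N} R B_{-n}`. -/
def toQ (N : ℕ) : R →ₗ[R] T.quotQ N := (T.leftIdeal N).mkQ

theorem toQ_surjective (N : ℕ) : Function.Surjective (T.toQ N) :=
  (T.leftIdeal N).mkQ_surjective

theorem toQ_eq_zero {N : ℕ} {r : R} : T.toQ N r = 0 ↔ r ∈ T.leftIdeal N :=
  Submodule.Quotient.mk_eq_zero (T.leftIdeal N)

theorem toQ_eq_smul (N : ℕ) (r : R) : T.toQ N r = r • T.toQ N 1 := by
  rw [← map_smul, smul_eq_mul, mul_one]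

theorem toQ_one_mem_killed (N : ℕ) : T.toQ N 1 ∈ T.killed (T.quotQ N) N := fun b hb => by
  rw [← toQ_eq_smul, toQ_eq_zero]
  exact Submodule.subset_span hb

theorem span_toQ_one (N : ℕ) : Submodule.span R {T.toQ N 1} = ⊤ := by
  refine (Submodule.eq_top_iff').mpr fun x => ?_
  obtain ⟨r, rfl⟩ := toQ_surjective N x
  rw [toQ_eq_smul N r]
  exact Submodule.smul_mem (Submodule.span R {T.toQ N 1}) r (Submodule.subset_span rfl)

theorem isO_quotQ (N : ℕ) : T.IsO (T.quotQ N) :=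
  isO_of_span (Set.finite_singleton (T.toQ N 1))
    (by rintro _ rfl; exact ⟨N, toQ_one_mem_killed N⟩) (span_toQ_one N)

variable {M : Type u} [AddCommGroup M] [Module R M] [Module K M] [IsScalarTower K R M]

/-- The map `R / ∑_{n ≥ N} R B_{-n} → M` given by a vector killed by `∑_{n ≥ N} B_{-n}`. -/
def quotLift {N : ℕ} {m : M} (hm : m ∈ T.killed M N) : T.quotQ N →ₗ[R] M :=
  (T.leftIdeal N).liftQ (LinearMap.toSpanSingleton R M m) fun _ hx => leftIdeal_smul hm hx

theorem quotLift_toQ {N : ℕ} {m : M} (hm : m ∈ T.killed M N) (r : R) :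
    quotLift hm (T.toQ N r) = r • m := rfl

theorem quotQ_hom_ext {M : Type*} [AddCommGroup M] [Module R M] {N : ℕ} {f g : T.quotQ N →ₗ[R] M}
    (h : f (T.toQ N 1) = g (T.toQ N 1)) : f = g := by
  refine LinearMap.ext fun x => ?_
  obtain ⟨r, rfl⟩ := toQ_surjective N x
  rw [toQ_eq_smul, map_smul, map_smul, h]

theorem H_mul_degB_fg (N : ℕ) : (T.SH * T.degB N).FG :=
  SH_fg.mul (Module.Finite.iff_fg.mp (T.B_finite _))

theorem toQ_succ_mem_killed_one {N : ℕ} {x : R} (hx : x ∈ T.SH * T.degB N) :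
    T.toQ (N + 1) x ∈ T.killed (T.quotQ (N + 1)) 1 := by
  intro b hb
  rw [← map_smul, toQ_eq_zero]
  have h1 : b * x ∈ T.Bge 1 * (T.SH * T.degB N) := Submodule.mul_mem_mul hb hx
  rw [← mul_assoc, Bge_mul_H, mul_assoc] at h1
  have h2 : T.SH * (T.Bge 1 * T.degB N) ≤ (T.leftIdeal (N + 1)).restrictScalars K := by
    refine Submodule.mul_le.mpr fun h _ y hy => ?_
    refine (T.leftIdeal (N + 1)).smul_mem h (Submodule.subset_span ?_)
    have h3 := mul_le_mul' (le_refl (T.Bge 1)) (degB_le_Bge (T := T) (le_refl N)) hy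
    have h4 := Bge_mul_le (T := T) 1 N h3
    rwa [add_comm] at h4
  exact h2 h1

theorem delZero_mul_mem {N : ℕ} {x : R} (hx : x ∈ T.SH * T.degB N) :
    T.delZero * x ∈ T.SH * T.degB N := by
  have : T.delZero * x ∈ T.SH * (T.SH * T.degB N) := Submodule.mul_mem_mul delZero_mem hx
  rwa [← mul_assoc, H_mul_H] at this

/-- Through j the operator D becomes multiplication by -∂₀, so the vanishing product in ∂₀ can be
peeled off factor by factor. -/
theorem ws_eq_top_of_delZero {V : Type*} [AddCommGroup V] [Module K V] (D : Module.End K V)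
    (j : V →ₗ[K] R) (hj : Function.Injective j) (hD : ∀ v, j (D v) = -(T.delZero * j v)) :
    ws D = ⊤ := by
  refine (Submodule.eq_top_iff').mpr fun v => ?_
  have key : ∀ (l : List K) (v : V),
      (∃ v' ∈ ws D, j v' = (l.map T.delZeroSub).prod * j v) → v ∈ ws D := by
    intro l
    induction l with
    | nil =>
      rintro v ⟨v', hv', h⟩
      rw [List.map_nil, List.prod_nil, one_mul] at h
      exact hj h ▸ hv'
    | cons z l ih =>
      rintro v ⟨v', hv', h⟩
      -- The partial products stay in the image of j because ∂₀ - z is modelled on V by -D - z.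
      have hex : ∀ (l : List K) (v : V), ∃ u, j u = (l.map T.delZeroSub).prod * j v := by
        intro l
        induction l with
        | nil => exact fun v => ⟨v, by simp⟩
        | cons z l ihl =>
          intro v
          obtain ⟨u, hu⟩ := ihl v
          refine ⟨-D u - z • u, ?_⟩
          rw [List.map_cons, List.prod_cons, mul_assoc, ← hu, map_sub, map_neg, hD, map_smul,
            delZeroSub, sub_mul, neg_neg, Algebra.smul_def]
      obtain ⟨u, hu⟩ := hex l v
      refine ih v ⟨u, mem_ws_of_sub_smul_mem (c := -z) ?_, hu⟩
      have : D u - (-z) • u = -v' := by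
        apply hj
        rw [map_sub, hD, map_smul, map_neg, h, List.map_cons, List.prod_cons, mul_assoc, ← hu,
          delZeroSub, sub_mul, neg_smul, Algebra.smul_def]
        abel
      rw [this]
      exact neg_mem hv'
  refine key T.roots v ⟨0, zero_mem _, ?_⟩
  rw [prod_delZeroSub_roots, zero_mul, map_zero]

/-- `H B_{-N}` is, through its image in `R / R B_{≥ N + 1}`, spanned by weight vectors. -/
theorem exists_weight_basis_H_mul_degB (N : ℕ) :
    ∃ (m : ℕ) (v : Module.Basis (Fin m) K ↥(T.SH * T.degB N)),
      ∀ i, ∃ μ, T.toQ (N + 1) (v i : R) ∈ T.wt (T.quotQ (N + 1)) μ := by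
  have : Module.Finite K ↥(T.SH * T.degB N) := Module.Finite.iff_fg.mpr (H_mul_degB_fg N)
  let D : Module.End K ↥(T.SH * T.degB N) :=
    -((LinearMap.mulLeft K T.delZero).restrict fun x hx => delZero_mul_mem hx)
  have hD : ws D = ⊤ := ws_eq_top_of_delZero D (T.SH * T.degB N).subtype Subtype.val_injective
    fun v => rfl
  obtain ⟨m, v, hv⟩ := exists_weight_basis hD
  refine ⟨m, v, fun i => ?_⟩
  obtain ⟨μ, hμ⟩ := hv i
  refine ⟨μ, map_mem_maxGenEigenspace
    (((T.toQ (N + 1)).restrictScalars K) ∘ₗ (T.SH * T.degB N).subtype) (fun x => ?_) hμ⟩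
  have h1 := del_smul_of_killed (toQ_succ_mem_killed_one x.2)
  change T.toQ (N + 1) (-(T.delZero * x)) = T.del • T.toQ (N + 1) x
  rw [h1, map_neg, ← map_smul, smul_eq_mul]

/-- The coefficient map of the i-th dual form, composed with the projection to degree -N, kills R
B_{≥ N+1} and extracts the coefficient of the i-th basis vector. -/
theorem linearIndependent_toQ {N m : ℕ} (v : Module.Basis (Fin m) K ↥(T.SH * T.degB N)) :
    LinearIndependent T.A fun i => T.toQ (N + 1) (v i : R) := by
  rw [Fintype.linearIndependent_iff]
  intro g hg i
  have h1 : ∑ j, (g j : R) * (v j : R) ∈ T.leftIdeal (N + 1) := by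
    rw [← toQ_eq_zero, map_sum, ← hg]
    refine Finset.sum_congr rfl fun j _ => ?_
    rw [← smul_eq_mul, map_smul]
    rfl
  obtain ⟨l, hl⟩ := LinearMap.exists_extend (v.coord i)
  obtain ⟨S, hS⟩ := T.exists_slice (l ∘ₗ T.proj (-N))
  have hS0 : T.SA * T.SH * T.Bge (N + 1) ≤ LinearMap.ker S := by
    rw [mul_assoc]
    refine Submodule.mul_le.mpr fun a ha x hx => ?_
    rw [LinearMap.mem_ker, hS a ha x (mul_le_mul' le_rfl (Bge_le_B _) hx), LinearMap.comp_apply,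
      proj_H_mul_Bge hx, map_zero, zero_smul]
  rw [← leftIdeal_eq] at hS0
  have h2 := hS0 h1
  have hgr : T.SH * T.degB N ≤ T.gr (-N) := Submodule.mul_le.mpr fun h hh b hb => by
    simpa using T.graded_mul (mem_gr_zero hh) hb.2
  have h3 : ∀ j, S ((g j : R) * (v j : R)) = if j = i then (g j : R) else 0 := by
    intro j
    have hle : T.SH * T.degB N ≤ T.SH * T.SB := mul_le_mul' le_rfl inf_le_left
    rw [hS _ (g j).2 _ (hle (v j).2), LinearMap.comp_apply,
      proj_of_mem (hgr (v j).2)]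
    have : l (v j) = v.coord i (v j) := LinearMap.congr_fun hl (v j)
    rw [this, Module.Basis.coord_apply, Module.Basis.repr_self, Finsupp.single_apply]
    split_ifs <;> simp
  rw [LinearMap.mem_ker, map_sum, Finset.sum_congr rfl fun j _ => h3 j, Finset.sum_ite_eq'] at h2
  simpa using h2

theorem mem_span_toQ {N m : ℕ} (v : Module.Basis (Fin m) K ↥(T.SH * T.degB N)) {r : R}
    (hr : r ∈ T.leftIdeal N) :
    T.toQ (N + 1) r ∈ Submodule.span T.A (Set.range fun i => T.toQ (N + 1) (v i : R)) := by
  have h1 : r ∈ T.SA * T.SH * T.Bge N := leftIdeal_eq (T := T) N ▸ hr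
  rw [Bge_succ, Submodule.mul_sup, ← leftIdeal_eq, mul_assoc] at h1
  obtain ⟨x, hx, y, hy, rfl⟩ := Submodule.mem_sup.mp h1
  rw [map_add, toQ_eq_zero.mpr hy, add_zero]
  clear h1 hr
  induction hx using Submodule.mul_induction_on' with
  | mem_mul_mem a ha g hg =>
    have h0 : T.toQ (N + 1) (a * g) = a • T.toQ (N + 1) g := map_smul (T.toQ (N + 1)) a g
    rw [h0]
    refine Submodule.smul_mem _ (⟨a, ha⟩ : T.A) ?_
    have h2 := v.sum_repr ⟨g, hg⟩
    have h3 : g = ∑ i, v.repr ⟨g, hg⟩ i • (v i : R) := by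
      have := congrArg (T.SH * T.degB N).subtype h2
      rw [map_sum] at this
      exact this.symm
    have h4 : T.toQ (N + 1) g = ∑ i, T.toQ (N + 1) (v.repr ⟨g, hg⟩ i • (v i : R)) := by
      conv_lhs => rw [h3]
      rw [map_sum]
    rw [h4]
    refine Submodule.sum_mem _ fun i _ => ?_
    have : T.toQ (N + 1) (v.repr ⟨g, hg⟩ i • (v i : R)) =
        algebraMap K T.A (v.repr ⟨g, hg⟩ i) • T.toQ (N + 1) (v i : R) := by
      rw [Algebra.smul_def, ← smul_eq_mul, map_smul]
      rfl
    rw [this]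
    exact Submodule.smul_mem _ _ (Submodule.subset_span ⟨i, rfl⟩)
  | add x _ y _ hx hy => rw [map_add]; exact add_mem hx hy

/-- `R / R B_{≥ N}` is free over `A` on finitely many weight vectors. -/
theorem exists_weight_basis_quotQ (N : ℕ) :
    ∃ (n : ℕ) (q : Module.Basis (Fin n) T.A (T.quotQ N)),
      ∀ i, ∃ μ, q i ∈ T.wt (T.quotQ N) μ := by
  induction N with
  | zero =>
    have : Subsingleton (T.quotQ 0) := by
      refine subsingleton_of_forall_eq 0 fun x => ?_
      obtain ⟨r, rfl⟩ := toQ_surjective 0 x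
      have := toQ_one_mem_killed (T := T) 0
      rw [killed_zero] at this
      rw [toQ_eq_smul, (Submodule.mem_bot K).mp this, smul_zero]
    exact ⟨0, Module.Basis.empty _, fun i => i.elim0⟩
  | succ N ih =>
    obtain ⟨n, q, hq⟩ := ih
    obtain ⟨m, v, hv⟩ := exists_weight_basis_H_mul_degB (T := T) N
    let g : T.quotQ (N + 1) →ₗ[R] T.quotQ N :=
      quotLift (killed_anti N.le_succ (toQ_one_mem_killed N))
    have hg : ∀ r, g (T.toQ (N + 1) r) = T.toQ N r := fun r => by
      rw [quotLift_toQ, ← toQ_eq_smul]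
    have hgs : Function.Surjective g := fun x => by
      obtain ⟨r, rfl⟩ := toQ_surjective N x
      exact ⟨_, hg r⟩
    have hq' : ∀ i, ∃ y, (∃ μ, y ∈ T.wt (T.quotQ (N + 1)) μ) ∧ g y = q i := fun i => by
      obtain ⟨μ, hμ⟩ := hq i
      obtain ⟨y, hy, h⟩ := exists_wt_lift (isO_quotQ (N + 1)).ws_eq_top g hgs hμ
      exact ⟨y, ⟨μ, hy⟩, h⟩
    choose q' hq'w hq'g using hq'
    have hgA : ∀ (a : T.A) x, g (a • x) = a • g x := fun a x => map_smul g (a : R) x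
    have hgv : ∀ i, g (T.toQ (N + 1) (v i : R)) = 0 := fun i => by
      rw [hg, toQ_eq_zero]
      have : T.SH * T.degB N ≤ (T.leftIdeal N).restrictScalars K :=
        Submodule.mul_le.mpr fun h _ b hb => (T.leftIdeal N).smul_mem h
          (Submodule.subset_span (degB_le_Bge le_rfl hb))
      exact this (v i).2
    -- The kernel of Q_{N+1} → Q_N has the A-basis given by H B_{-N}; weight lifts of the basis of
    -- Q_N complete it.
    let F : Fin m ⊕ Fin n → T.quotQ (N + 1) := Sum.elim (fun i => T.toQ (N + 1) (v i : R)) q'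
    have hli : LinearIndependent T.A F := by
      rw [Fintype.linearIndependent_iff]
      intro a ha
      rw [Fintype.sum_sum_type] at ha
      simp only [F, Sum.elim_inl, Sum.elim_inr] at ha
      have h1 := congrArg g ha
      rw [map_add, map_sum, map_sum, map_zero] at h1
      simp only [hgA, hgv, smul_zero, Finset.sum_const_zero, zero_add, hq'g] at h1
      have h2 := Fintype.linearIndependent_iff.mp q.linearIndependent _ h1
      simp only [h2, zero_smul, Finset.sum_const_zero, add_zero] at ha
      have h3 := Fintype.linearIndependent_iff.mp (linearIndependent_toQ v) _ ha
      rintro (i | i)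
      · exact h3 i
      · exact h2 i
    have hsp : ⊤ ≤ Submodule.span T.A (Set.range F) := by
      intro x _
      have h1 := q.sum_repr (g x)
      let y := ∑ i, q.repr (g x) i • q' i
      have hy : y ∈ Submodule.span T.A (Set.range F) := Submodule.sum_mem _ fun i _ =>
        Submodule.smul_mem _ _ (Submodule.subset_span ⟨Sum.inr i, rfl⟩)
      have hgy : g (x - y) = 0 := by
        rw [map_sub, map_sum]
        simp only [hgA, hq'g]
        rw [h1, sub_self]
      obtain ⟨r, hr⟩ := toQ_surjective (N + 1) (x - y)
      rw [← hr, hg, toQ_eq_zero] at hgy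
      have h2 := mem_span_toQ v hgy
      rw [hr] at h2
      rw [← sub_add_cancel x y]
      refine add_mem (Submodule.span_mono ?_ h2) hy
      rintro _ ⟨i, rfl⟩
      exact ⟨Sum.inl i, rfl⟩
    refine ⟨m + n, (Module.Basis.mk hli hsp).reindex finSumFinEquiv, fun i => ?_⟩
    rw [Module.Basis.reindex_apply, Module.Basis.mk_apply]
    rcases finSumFinEquiv.symm i with j | j
    · exact hv j
    · exact hq'w j

end QuotQ

/-! ### The submodules generated by vectors of low weight -/

section Low

variable (T) (M : Type u) [AddCommGroup M] [Module R M] [Module K M] [IsScalarTower K R M]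

/-- The submodule generated by the weight spaces `M^(μ - n)`, `n > 0`. -/
def low (μ : K) : Submodule R M := Submodule.span R {m | ∃ n : ℕ, m ∈ T.wt M (μ - (n + 1))}

/-- A `K`-basis of `A`. -/
def basisA : Module.Basis (Module.Basis.ofVectorSpaceIndex K T.A) K T.A :=
  Module.Basis.ofVectorSpace K T.A

/-- A weak form of freeness over `A` of the associated graded module for the filtration by the
submodules `low`. -/
def LowFree : Prop := ∀ (μ : K) (y : Module.Basis.ofVectorSpaceIndex K T.A →₀ M),
  (∀ k, y k ∈ T.wt M μ) → (y.sum fun k m => (T.basisA k : R) • m) ∈ T.low M μ →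
    ∀ k, y k ∈ T.low M μ

variable {T M}

theorem span_le_span_A {X : Set M} (hH : ∀ h ∈ T.H, ∀ x ∈ X, h • x ∈ X)
    (hB : ∀ n, ∀ b ∈ T.degB n, ∀ x ∈ X, b • x ∈ X) {m : M} (hm : m ∈ Submodule.span R X) :
    m ∈ Submodule.span T.A X := by
  induction hm using Submodule.closure_induction with
  | zero => exact zero_mem _
  | add x y _ _ hx hy => exact add_mem hx hy
  | smul_mem r m hm =>
    have hr : r ∈ T.SA * T.SH * T.SB := by rw [A_mul_H_mul_B]; trivial
    induction hr using Submodule.mul_induction_on' with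
    | mem_mul_mem x hx b hb =>
      have hb' := T.B_graded hb
      clear hb
      induction hb' using Submodule.iSup_induction' with
      | mem n b hb =>
        induction hx using Submodule.mul_induction_on' with
        | mem_mul_mem a ha h hh =>
          rw [mul_smul, mul_smul]
          exact Submodule.smul_mem _ (⟨a, ha⟩ : T.A)
            (Submodule.subset_span (hH h hh _ (hB n b hb m hm)))
        | add x _ y _ hx hy => rw [add_mul, add_smul]; exact add_mem hx hy
      | zero => rw [mul_zero, zero_smul]; exact zero_mem _
      | add y z _ _ hy hz => rw [mul_add, add_smul]; exact add_mem hy hz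
    | add x _ y _ hx hy => rw [add_smul]; exact add_mem hx hy

theorem exists_finsupp_of_mem_span_A (V : Submodule K M) {m : M}
    (hm : m ∈ Submodule.span T.A (V : Set M)) :
    ∃ y : Module.Basis.ofVectorSpaceIndex K T.A →₀ M, (∀ k, y k ∈ V) ∧
      (y.sum fun k m => (T.basisA k : R) • m) = m := by
  have hadd : ∀ y z : Module.Basis.ofVectorSpaceIndex K T.A →₀ M,
      ((y + z).sum fun k m => (T.basisA k : R) • m) =
      (y.sum fun k m => (T.basisA k : R) • m) + z.sum fun k m => (T.basisA k : R) • m :=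
    fun y z => Finsupp.sum_add_index' (fun _ => smul_zero _) fun _ => smul_add _
  induction hm using Submodule.closure_induction with
  | zero => exact ⟨0, fun _ => zero_mem _, Finsupp.sum_zero_index⟩
  | add x y _ _ hx hy =>
    obtain ⟨f, hf, rfl⟩ := hx
    obtain ⟨g, hg, rfl⟩ := hy
    exact ⟨f + g, fun k => add_mem (hf k) (hg k), hadd f g⟩
  | smul_mem a m hm =>
    refine ⟨(T.basisA.repr a).mapRange (fun c => c • m) (zero_smul _ _), fun k => ?_, ?_⟩
    · rw [Finsupp.mapRange_apply]
      exact V.smul_mem _ hm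
    · rw [Finsupp.sum_mapRange_index fun _ => smul_zero _]
      have h1 : a = (T.basisA.repr a).sum fun k c => c • T.basisA k :=
        (T.basisA.linearCombination_repr a).symm
      have h2 : (a : R) = (T.basisA.repr a).sum fun k c => c • (T.basisA k : R) := by
        conv_lhs => rw [h1]
        rw [Finsupp.sum, Finsupp.sum]
        push_cast
        rfl
      change _ = (a : R) • m
      rw [h2, Finsupp.sum, Finsupp.sum, Finset.sum_smul]
      refine Finset.sum_congr rfl fun k _ => ?_
      rw [smul_comm_scalar, smul_assoc]

theorem low_weight_closed {μ : K} {k : ℤ} (hk : k ≤ 0) {r : R} (hr : r ∈ T.gr k) {m : M}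
    (hm : ∃ n : ℕ, m ∈ T.wt M (μ - (n + 1))) : ∃ n : ℕ, r • m ∈ T.wt M (μ - (n + 1)) := by
  obtain ⟨n, hn⟩ := hm
  obtain ⟨j, rfl⟩ := Int.eq_ofNat_of_zero_le (neg_nonneg.mpr hk) |>.imp fun j h =>
    (neg_eq_iff_eq_neg.mp h)
  refine ⟨n + j, ?_⟩
  have := smul_mem_wt hr hn
  push_cast at this ⊢
  convert this using 2
  ring

theorem low_le_span_A {μ : K} {m : M} (hm : m ∈ T.low M μ) :
    m ∈ Submodule.span T.A {m : M | ∃ n : ℕ, m ∈ T.wt M (μ - (n + 1))} :=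
  span_le_span_A (X := {m : M | ∃ n : ℕ, m ∈ T.wt M (μ - (n + 1))})
    (fun _ hh _ hx => low_weight_closed le_rfl (mem_gr_zero hh) hx)
    (fun n _ hb _ hx => low_weight_closed (by omega) hb.2 hx) hm

/-- In coordinates for an A-basis of weight vectors, `low μ` has zero entries at the basis vectors
of weight μ. A vector of weight μ has scalar entries there and is determined modulo `low μ` by them.
A relation among the elements of a K-basis of A thus forces these scalars to vanish. -/
theorem lowFree_quotQ [CharZero K] (N : ℕ) : T.LowFree (T.quotQ N) := by
  classical
  obtain ⟨n, q, hq⟩ := exists_weight_basis_quotQ (T := T) N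
  choose ω hω using hq
  have hws := (isO_quotQ (T := T) N).ws_eq_top
  have hgen : ∀ ν, ∀ x ∈ T.wt (T.quotQ N) ν, x ∈ Submodule.span K
      {y | ∃ (m : ℕ) (a : T.A) (j : Fin n), (a : R) ∈ T.degA m ∧ ω j + m = ν ∧ y = a • q j} := by
    intro ν x hx
    have h1 := wt_le_span hws (S := Set.range q) (by rintro _ ⟨i, rfl⟩; exact ⟨_, hω i⟩)
      q.span_eq ν hx
    refine Submodule.span_le.mpr ?_ h1
    rintro _ ⟨m, w, a, _, ha, ⟨j, rfl⟩, hw, hm, rfl⟩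
    by_cases h0 : q j = 0
    · rw [h0, smul_zero]; exact zero_mem _
    · have := eq_of_mem_maxGenEigenspace h0 hw (hω j)
      subst this
      exact Submodule.subset_span ⟨m, ⟨a, ha.1⟩, j, ha, hm, rfl⟩
  have hrepr : ∀ (a : T.A) (j i : Fin n), q.repr (a • q j) i = if j = i then a else 0 := by
    intro a j i
    rw [map_smul, Module.Basis.repr_self, Finsupp.smul_single, smul_eq_mul, mul_one,
      Finsupp.single_apply]
  intro μ y hy hsum
  -- coordinates of vectors in `low`
  have hlow : ∀ x ∈ T.low (T.quotQ N) μ, ∀ i, ω i = μ → q.repr x i = 0 := by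
    intro x hx i hi
    have hx' := low_le_span_A hx
    clear hx
    induction hx' using Submodule.span_induction with
    | mem x hx =>
      obtain ⟨k, hk⟩ := hx
      have := hgen _ x hk
      clear hk
      induction this using Submodule.span_induction with
      | mem x hx =>
        obtain ⟨m, a, j, -, hm, rfl⟩ := hx
        rw [hrepr, if_neg]
        rintro rfl
        rw [hi] at hm
        have : ((m + (k + 1) : ℕ) : K) = 0 := by push_cast; linear_combination hm
        exact absurd (Nat.cast_eq_zero.mp this) (by omega)
      | zero => rw [map_zero]; rfl
      | add x y _ _ hx hy => rw [map_add, Finsupp.add_apply, hx, hy, add_zero]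
      | smul c x _ hx =>
        have : c • x = algebraMap K T.A c • x := (algebraMap_smul R c x).symm
        rw [this, map_smul, Finsupp.smul_apply, hx, smul_zero]
    | zero => rw [map_zero]; rfl
    | add x y _ _ hx hy => rw [map_add, Finsupp.add_apply, hx, hy, add_zero]
    | smul a x _ hx => rw [map_smul, Finsupp.smul_apply, hx, smul_zero]
  -- coordinates of vectors of weight `μ`
  have hwt : ∀ x ∈ T.wt (T.quotQ N) μ,
      (∀ i, ω i = μ → ∃ c : K, q.repr x i = algebraMap K T.A c) ∧
      x - ∑ i with ω i = μ, q.repr x i • q i ∈ T.low (T.quotQ N) μ := by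
    intro x hx
    have := hgen _ x hx
    clear hx
    induction this using Submodule.span_induction with
    | mem x hx =>
      obtain ⟨m, a, j, ha, hm, rfl⟩ := hx
      rcases Nat.eq_zero_or_pos m with rfl | hpos
      · rw [degA_zero_eq] at ha
        obtain ⟨c, hc⟩ := Submodule.mem_one.mp ha
        have hac : a = algebraMap K T.A c := Subtype.ext hc.symm
        refine ⟨fun i _ => ?_, ?_⟩
        · rw [hrepr]
          split_ifs
          · exact ⟨c, hac⟩
          · exact ⟨0, (map_zero _).symm⟩
        · rw [Finset.sum_congr rfl fun i _ => by rw [hrepr], Finset.sum_eq_single j]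
          · rw [if_pos rfl, sub_self]; exact zero_mem _
          · intro i _ hne
            rw [if_neg hne.symm, zero_smul]
          · intro h
            simp only [Finset.mem_filter, Finset.mem_univ, true_and] at h
            exact absurd (by simpa using hm) h
      · have hne : ∀ i, ω i = μ → j ≠ i := by
          rintro i hi rfl
          rw [hi] at hm
          have : (m : K) = 0 := by linear_combination hm
          exact absurd (Nat.cast_eq_zero.mp this) (by omega)
        refine ⟨fun i hi => ⟨0, by rw [hrepr, if_neg (hne i hi), map_zero]⟩, ?_⟩
        rw [Finset.sum_eq_zero, sub_zero]
        · obtain ⟨k, rfl⟩ := Nat.exists_eq_add_of_le' hpos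
          refine (T.low _ μ).smul_mem (a : R) (Submodule.subset_span ⟨k, ?_⟩)
          convert hω j using 2
          rw [← hm]
          push_cast
          ring
        · intro i hi
          simp only [Finset.mem_filter, Finset.mem_univ, true_and] at hi
          rw [hrepr, if_neg (hne i hi), zero_smul]
    | zero =>
      refine ⟨fun i _ => ⟨0, by rw [map_zero, map_zero]; rfl⟩, ?_⟩
      simp
    | add x y _ _ hx hy =>
      refine ⟨fun i hi => ?_, ?_⟩
      · obtain ⟨c, hc⟩ := hx.1 i hi
        obtain ⟨d, hd⟩ := hy.1 i hi
        exact ⟨c + d, by rw [map_add, map_add, Finsupp.add_apply, hc, hd]⟩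
      · have := add_mem hx.2 hy.2
        convert this using 1
        simp only [map_add, Finsupp.add_apply, add_smul, Finset.sum_add_distrib]
        abel
    | smul c x _ hx =>
      have hc : c • x = algebraMap K T.A c • x := (algebraMap_smul R c x).symm
      refine ⟨fun i hi => ?_, ?_⟩
      · obtain ⟨d, hd⟩ := hx.1 i hi
        exact ⟨c * d, by rw [hc, map_smul, Finsupp.smul_apply, hd, smul_eq_mul, map_mul]⟩
      · have := (T.low (T.quotQ N) μ).smul_mem (algebraMap K R c) hx.2
        convert this using 1
        rw [hc, smul_sub, Finset.smul_sum]
        congr 1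
        refine Finset.sum_congr rfl fun i _ => ?_
        rw [map_smul, Finsupp.smul_apply, smul_eq_mul, mul_smul]
        rfl
  intro k
  have hc : ∀ i, ω i = μ → ∀ k, ∃ c : K, q.repr (y k) i = algebraMap K T.A c :=
    fun i hi k => (hwt _ (hy k)).1 i hi
  have hzero : ∀ i, ω i = μ → q.repr (y k) i = 0 := by
    intro i hi
    choose c hc using hc i hi
    have h1 := hlow _ hsum i hi
    have h2 : q.repr (y.sum fun k m => (T.basisA k : R) • m) i =
        ∑ k ∈ y.support, c k • T.basisA k := by
      rw [Finsupp.sum, map_sum, Finsupp.finsetSum_apply]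
      refine Finset.sum_congr rfl fun k _ => ?_
      have : (T.basisA k : R) • y k = T.basisA k • y k := rfl
      rw [this, map_smul, Finsupp.smul_apply, hc, smul_eq_mul, ← Algebra.commutes,
        Algebra.smul_def]
    rw [h2] at h1
    by_cases hk : k ∈ y.support
    · have := linearIndependent_iff'.mp T.basisA.linearIndependent y.support c h1 k hk
      rw [hc, this, map_zero]
    · rw [Finsupp.notMem_support_iff.mp hk, map_zero]; rfl
  have h3 := (hwt _ (hy k)).2
  rw [Finset.sum_eq_zero, sub_zero] at h3
  · exact h3
  · intro i hi
    simp only [Finset.mem_filter, Finset.mem_univ, true_and] at hi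
    rw [hzero i hi, zero_smul]

/-- Linear maps preserve weights and hence the submodules `low`, so the property passes to direct
summands, for which an A-basis of weight vectors is not at hand. -/
theorem LowFree.of_retract {M' : Type u} [AddCommGroup M'] [Module R M'] [Module K M']
    [IsScalarTower K R M'] (h : T.LowFree M) (i : M' →ₗ[R] M) (p : M →ₗ[R] M')
    (hpi : ∀ x, p (i x) = x) : T.LowFree M' := by
  intro μ y hy hsum k
  have hmap : ∀ {N N' : Type u} [AddCommGroup N] [Module R N] [Module K N] [IsScalarTower K R N]
      [AddCommGroup N'] [Module R N'] [Module K N'] [IsScalarTower K R N'] (f : N →ₗ[R] N'),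
      ∀ x ∈ T.low N μ, f x ∈ T.low N' μ := by
    intro N N' _ _ _ _ _ _ _ _ f x hx
    have : T.low N μ ≤ (T.low N' μ).comap f := Submodule.span_le.mpr fun m ⟨n, hn⟩ =>
      Submodule.subset_span ⟨n, map_mem_wt f hn⟩
    exact this hx
  have h1 := h μ (y.mapRange i (map_zero i)) (fun k => by
    rw [Finsupp.mapRange_apply]; exact map_mem_wt i (hy k)) (by
    rw [Finsupp.sum_mapRange_index fun _ => smul_zero _]
    have := hmap i _ hsum
    rw [Finsupp.sum, map_sum] at this
    convert this using 1
    exact Finset.sum_congr rfl fun k _ => (map_smul i _ _).symm) k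
  rw [Finsupp.mapRange_apply] at h1
  have := hmap p _ h1
  rwa [hpi] at this

end Low

end TriangularDecomposition

theorem exists_factor_of_surjective {S : Type*} [Ring S] {U V N : Type*} [AddCommGroup U]
    [AddCommGroup V] [AddCommGroup N] [Module S U] [Module S V] [Module S N] {θ : U →ₗ[S] V}
    (hθ : Function.Surjective θ) {j : U →ₗ[S] N} (hj : LinearMap.ker θ ≤ LinearMap.ker j) :
    ∃ φ : V →ₗ[S] N, ∀ u, φ (θ u) = j u := by
  refine ⟨(LinearMap.ker θ).liftQ j hj ∘ₗ (θ.quotKerEquivOfSurjective hθ).symm.toLinearMap,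
    fun u => ?_⟩
  have h1 : (θ.quotKerEquivOfSurjective hθ).symm (θ u) = Submodule.Quotient.mk u := by
    rw [LinearEquiv.symm_apply_eq]
    rfl
  rw [LinearMap.comp_apply, LinearEquiv.coe_coe, h1]
  rfl

namespace TriangularDecomposition

variable {K : Type w} [Field K] {R : Type u} [Ring R] [Algebra K R]
  {T : TriangularDecomposition K R}

/-! ### Projective covers -/

section Projective

open ModuleCat

variable (T) in
/-- The lifting property of projective objects of `O`. -/
def LiftsInO (P : Type u) [AddCommGroup P] [Module R P] : Prop :=
  ∀ (M M' : Type u) [AddCommGroup M] [Module R M] [Module K M] [IsScalarTower K R M]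
    [AddCommGroup M'] [Module R M'] [Module K M'] [IsScalarTower K R M'], T.IsO M →
    ∀ ψ : M →ₗ[R] M', Function.Surjective ψ → ∀ φ : P →ₗ[R] M', ∃ g : P →ₗ[R] M, ψ ∘ₗ g = φ

/-- A map out of the summand is determined by the image of its generator, which has weight μ. That
image lifts to a vector of weight μ; by the choice of N the lift is killed by B_{≥ N}, so it defines
a map on Q_N. -/
theorem liftsInO_range {μ : K} {N : ℕ}
    (hN : ∀ (M : Type u) [AddCommGroup M] [Module R M] [Module K M] [IsScalarTower K R M],
      T.IsO M → T.wt M μ ≤ T.killed M N)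
    (p : Module.End R (T.quotQ N)) (hp : ∀ x, p (p x) = p x)
    (hpμ : p (T.toQ N 1) ∈ T.wt (T.quotQ N) μ) : T.LiftsInO (LinearMap.range p) := by
  intro M M' _ _ _ _ _ _ _ _ hM ψ hψ φ
  let x : LinearMap.range p := ⟨p (T.toQ N 1), T.toQ N 1, rfl⟩
  have hx : x ∈ T.wt (LinearMap.range p) μ :=
    mem_wt_of_injective (LinearMap.range p).subtype Subtype.val_injective hpμ
  obtain ⟨m, hm, hmx⟩ := exists_wt_lift hM.ws_eq_top ψ hψ (map_mem_wt φ hx)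
  let g := quotLift (hN M hM hm)
  have h1 : ψ ∘ₗ g = φ ∘ₗ p.rangeRestrict := by
    refine quotQ_hom_ext ?_
    rw [LinearMap.comp_apply, LinearMap.comp_apply, quotLift_toQ, one_smul, hmx]
    rfl
  refine ⟨g ∘ₗ (LinearMap.range p).subtype, LinearMap.ext ?_⟩
  rintro ⟨_, y, rfl⟩
  have h2 := LinearMap.congr_fun h1 (p y)
  rw [LinearMap.comp_apply, LinearMap.comp_apply] at h2
  rw [LinearMap.comp_apply, LinearMap.comp_apply, Submodule.subtype_apply, h2]
  exact congrArg φ (Subtype.ext (hp y))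

theorem exists_idempotent_of_isCompl {Q : Type*} [AddCommGroup Q] [Module R Q]
    (h : Module.End R Q) (hc : IsCompl (LinearMap.ker h) (LinearMap.range h)) :
    ∃ q : Module.End R Q, (∀ x, q (q x) = q x) ∧ LinearMap.range q = LinearMap.range h ∧
      (∀ x, h (q x) = h x) ∧ ∀ x ∈ LinearMap.range h, h x = 0 → x = 0 := by
  let q := (LinearMap.range h).projection (LinearMap.ker h) hc.symm
  have hmem : ∀ x, q x ∈ LinearMap.range h := fun x => Submodule.coe_mem _
  have hid : ∀ x ∈ LinearMap.range h, q x = x := fun x hx =>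
    Submodule.projection_apply_left hc.symm ⟨x, hx⟩
  refine ⟨q, fun x => hid _ (hmem x), le_antisymm ?_ fun x hx => ⟨x, hid x hx⟩, fun x => ?_, ?_⟩
  · rintro _ ⟨x, rfl⟩
    exact hmem x
  · rw [← sub_eq_zero, ← map_sub]
    have h1 : q (q x - x) = 0 := by rw [map_sub, hid _ (hmem x), sub_self]
    exact (Submodule.projection_apply_eq_zero_iff hc.symm).mp h1
  · intro x hx h0
    exact Submodule.disjoint_def.mp hc.disjoint x h0 hx

variable [CharZero K] [IsNoetherianRing R]

/-- For N large, the summands of Q_N generated by the image of 1 in weight -c(W) have the lifting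
property. A minimal one that maps nontrivially to L(W) is a cover: if Y maps nontrivially too,
lifting through Y and applying Fitting's lemma produces such a summand inside Y. -/
theorem exists_projective_cover (W : T.Irr) :
    ∃ (N : ℕ) (P : Submodule R (T.quotQ N)) (f : P →ₗ[R] simpleQuot W),
      T.LiftsInO P ∧ f ≠ 0 ∧ (∀ Y : Submodule R P, Y.map f ≠ ⊥ → Y = ⊤) ∧
      (∃ x ∈ T.wt P (-T.c W), Submodule.span R {x} = ⊤) ∧ T.LowFree P := by
  classical
  set μ := -T.c W with hμ
  obtain ⟨N₀, hN₀⟩ := T.exists_wt_le_killed μ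
  -- N ≥ 1 is needed so that a vector of L(W) killed by B_{≥ 1} defines a map from Q_N.
  let N := max N₀ 1
  have hN : ∀ (M : Type u) [AddCommGroup M] [Module R M] [Module K M] [IsScalarTower K R M],
      T.IsO M → T.wt M μ ≤ T.killed M N := fun M _ _ _ _ hM =>
    (hN₀ M hM).trans (killed_anti (le_max_left _ _))
  have hQ := isO_quotQ (T := T) N
  let x₀ := T.toQ N 1
  have hspan : ∀ (p : Module.End R (T.quotQ N)) (L : Type u) [AddCommGroup L] [Module R L]
      (f : T.quotQ N →ₗ[R] L), f (p x₀) = 0 → ∀ x, f (p x) = 0 := by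
    intro p L _ _ f h x
    have : f ∘ₗ p = 0 := quotQ_hom_ext h
    exact LinearMap.congr_fun this x
  have hnt := IsSimpleModule.nontrivial T.H W.rep
  obtain ⟨v, hv⟩ := exists_ne (0 : W.rep)
  let f₀ : T.quotQ N →ₗ[R] simpleQuot W :=
    quotLift (killed_anti (le_max_right _ _) (simpleIncl_mem_killed W v))
  have hf₀ : f₀ x₀ = simpleIncl W v := 
    (quotLift_toQ _ 1).trans (one_smul _ _)
  let good (p : Module.End R (T.quotQ N)) : Prop :=
    (∀ x, p (p x) = p x) ∧ p x₀ ∈ T.wt (T.quotQ N) μ ∧ f₀ (p x₀) ≠ 0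
  let e : Module.End R (T.quotQ N) :=
    -- The μ-component of the generator is killed by B_{≥ N}, so it defines an endomorphism of Q_N.
    -- This endomorphism is idempotent, because it commutes with the projection to weight μ.
    quotLift (hN _ hQ (internalProj_mem (ws_isInternal hQ.ws_eq_top) μ x₀))
  have hex : e x₀ = internalProj (ws_isInternal hQ.ws_eq_top) μ x₀ :=
    (quotLift_toQ _ 1).trans (one_smul _ _)
  have he : good e := by
    refine ⟨?_, ?_, ?_⟩
    · have : e ∘ₗ e = e := by
        refine quotQ_hom_ext ?_
        change e (e x₀) = e x₀
        conv_lhs => rw [hex]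
        rw [proj_map hQ.ws_eq_top hQ.ws_eq_top, hex, internalProj_of_mem _ (internalProj_mem _ _ _)]
      exact LinearMap.congr_fun this
    · rw [hex]; exact internalProj_mem _ _ _
    · rw [hex, proj_map hQ.ws_eq_top (isO_simpleQuot W).ws_eq_top, hf₀,
        internalProj_of_mem _ (simpleIncl_mem_wt W v)]
      exact simpleIncl_ne_zero W hv
  have hart := hQ.isArtinian
  have hnoeth : IsNoetherian R (T.quotQ N) := by
    have := hQ.finite
    exact isNoetherian_of_isNoetherianRing_of_finite R _
  obtain ⟨P, ⟨p, ⟨hp, hpμ, hpf⟩, rfl⟩, hmin⟩ :=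
    (IsWellFounded.wf (r := ((· < ·) : Submodule R (T.quotQ N) → _ → Prop))).has_min
      {P | ∃ p, good p ∧ LinearMap.range p = P} ⟨_, e, he, rfl⟩
  have hpid : ∀ x ∈ LinearMap.range p, p x = x := by
    rintro _ ⟨x, rfl⟩
    exact hp x
  have hlift := liftsInO_range hN p hp hpμ
  let f : LinearMap.range p →ₗ[R] simpleQuot W := f₀ ∘ₗ (LinearMap.range p).subtype
  let x : LinearMap.range p := ⟨p x₀, x₀, rfl⟩
  refine ⟨N, LinearMap.range p, f, hlift, ?_, ?_, ⟨x, ?_, ?_⟩, ?_⟩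
  · intro h
    exact hpf (LinearMap.congr_fun h x)
  · intro Y hY
    let fY : Y →ₗ[R] simpleQuot W := f ∘ₗ Y.subtype
    have hfY : fY ≠ 0 := by
      intro h
      refine hY (eq_bot_iff.mpr ?_)
      rintro _ ⟨y, hy, rfl⟩
      exact LinearMap.congr_fun h ⟨y, hy⟩
    have hYO : T.IsO Y := (hQ.submodule _).submodule Y
    -- L(W) is simple, so Y maps onto it and f factors through Y. The resulting endomorphism h has
    -- image in Y and satisfies f₀ h = f₀ p.
    obtain ⟨h₀, hh₀⟩ := hlift Y (simpleQuot W) hYO fY (LinearMap.surjective_of_ne_zero hfY) f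
    let ι : Y →ₗ[R] T.quotQ N := (LinearMap.range p).subtype ∘ₗ Y.subtype
    have hι : ∀ y, ι y ∈ LinearMap.range p := fun y => (y : LinearMap.range p).2
    let h : Module.End R (T.quotQ N) := ι ∘ₗ h₀ ∘ₗ p.rangeRestrict
    have hfh : ∀ z, f₀ (h z) = f₀ (p z) := fun z => LinearMap.congr_fun hh₀ (p.rangeRestrict z)
    have hfpow : ∀ k z, f₀ ((h ^ (k + 1)) z) = f₀ (p z) := by
      intro k
      induction k with
      | zero => intro z; rw [zero_add, pow_one]; exact hfh z
      | succ k ih =>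
        intro z
        rw [pow_succ, Module.End.mul_apply, ih, show p (h z) = h z from hpid _ (hι _)]
        exact hfh z
    -- Fitting: for a large power, kernel and range are complementary, and the projection q to the
    -- range is an idempotent with range inside Y. Minimality then forces the range of q to be that
    -- of p.
    obtain ⟨k, hk⟩ := (Filter.eventually_atTop.mp h.eventually_isCompl_ker_pow_range_pow)
    obtain ⟨q, hqq, hqr, hqh, hqi⟩ := exists_idempotent_of_isCompl (h ^ (k + 1)) (hk _ k.le_succ)
    have hxwt : ∀ j, (h ^ (j + 1)) x₀ ∈ T.wt (T.quotQ N) μ := by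
      intro j
      rw [pow_succ, Module.End.mul_apply]
      refine map_mem_wt (h ^ j) ?_
      refine map_mem_wt (ι ∘ₗ h₀) (?_ : x ∈ T.wt _ μ)
      exact mem_wt_of_injective (LinearMap.range p).subtype Subtype.val_injective hpμ
    have hqgood : good q := by
      refine ⟨hqq, ?_, ?_⟩
      · let hr : LinearMap.range (h ^ (k + 1)) →ₗ[R] T.quotQ N :=
          (h ^ (k + 1)) ∘ₗ (LinearMap.range (h ^ (k + 1))).subtype
        have hri : Function.Injective hr := (injective_iff_map_eq_zero _).mpr fun z hz =>
          Subtype.ext (hqi z z.2 hz)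
        have hqmem : q x₀ ∈ LinearMap.range (h ^ (k + 1)) := hqr ▸ ⟨x₀, rfl⟩
        have h1 : (⟨q x₀, hqmem⟩ : LinearMap.range (h ^ (k + 1))) ∈ T.wt _ μ := by
          refine mem_wt_of_injective hr hri ?_
          change (h ^ (k + 1)) (q x₀) ∈ _
          rw [hqh]
          exact hxwt k
        exact map_mem_wt (LinearMap.range (h ^ (k + 1))).subtype h1
      · intro h0
        have h1 := hspan q _ f₀ h0
        obtain ⟨z, hz⟩ : ∃ z, q z = (h ^ (k + 1)) x₀ := by
          have : (h ^ (k + 1)) x₀ ∈ LinearMap.range q := hqr ▸ ⟨x₀, rfl⟩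
          exact this
        have h2 := h1 z
        rw [hz, hfpow] at h2
        exact hpf h2
    have hle : ∀ z ∈ LinearMap.range q, ∃ y, ι y = z := by
      intro z hz
      rw [hqr] at hz
      obtain ⟨z, rfl⟩ := hz
      rw [pow_succ']
      exact ⟨_, rfl⟩
    have hle' : LinearMap.range q ≤ LinearMap.range p := fun z hz => by
      obtain ⟨y, rfl⟩ := hle z hz
      exact hι y
    have heq : LinearMap.range q = LinearMap.range p := by
      by_contra hne
      exact hmin _ ⟨q, hqgood, rfl⟩ (lt_of_le_of_ne hle' hne)
    refine (Submodule.eq_top_iff').mpr fun z => ?_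
    obtain ⟨y, hy⟩ := hle z (by rw [heq]; exact z.2)
    have : z = (y : LinearMap.range p) := Subtype.ext hy.symm
    rw [this]
    exact y.2
  · exact mem_wt_of_injective (LinearMap.range p).subtype Subtype.val_injective hpμ
  · refine (Submodule.eq_top_iff').mpr ?_
    rintro ⟨_, y, rfl⟩
    obtain ⟨r, rfl⟩ := toQ_surjective N y
    refine Submodule.mem_span_singleton.mpr ⟨r, Subtype.ext ?_⟩
    change r • p x₀ = p (T.toQ N r)
    rw [toQ_eq_smul N r, map_smul]
  · exact (lowFree_quotQ N).of_retract (LinearMap.range p).subtype p.rangeRestrict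
      fun z => Subtype.ext (hpid z z.2)

end Projective

/-! ### Filtrations by Verma modules -/

section Filtration

open ModuleCat

variable {M : Type u} [AddCommGroup M] [Module R M] [Module K M] [IsScalarTower K R M]

variable (T M) in
/-- A submodule of `M` has a finite filtration with subquotients `Δ(E)`, `E` satisfying `p`. -/
inductive VermaFiltration (p : T.Irr → Prop) : Submodule R M → Prop
  | bot : VermaFiltration p ⊥
  | step (N N' : Submodule R M) (hle : N' ≤ N) (E : T.Irr) (hE : p E)
      (f : N →ₗ[R] T.verma E.rep) (hf : Function.Surjective f)
      (hker : ∀ x, f x = 0 ↔ (x : M) ∈ N') (h : VermaFiltration p N') : VermaFiltration p N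

/-- The vectors of an `H`-submodule of a weight space. -/
def wtSub {ν : K} (U : Submodule T.H (T.wtH M ν)) : Submodule K M where
  carrier := {m | ∃ h : m ∈ T.wtH M ν, (⟨m, h⟩ : T.wtH M ν) ∈ U}
  add_mem' := fun ⟨h, hU⟩ ⟨h', hU'⟩ => ⟨add_mem h h', add_mem hU hU'⟩
  zero_mem' := ⟨zero_mem _, zero_mem U⟩
  smul_mem' c m := fun ⟨h, hU⟩ => by
    have h1 := U.smul_mem (algebraMap K T.H c) hU
    have h2 : c • m = ((algebraMap K T.H c • (⟨m, h⟩ : T.wtH M ν) : T.wtH M ν) : M) :=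
      (algebraMap_smul R c m).symm
    rw [h2]
    exact ⟨Subtype.coe_prop _, h1⟩

theorem mem_wtSub {ν : K} {U : Submodule T.H (T.wtH M ν)} (m : T.wtH M ν) :
    (m : M) ∈ wtSub U ↔ m ∈ U := ⟨fun ⟨_, h⟩ => h, fun h => ⟨m.2, h⟩⟩

theorem wtSub_le {ν : K} (U : Submodule T.H (T.wtH M ν)) : wtSub U ≤ T.wt M ν := fun _ ⟨h, _⟩ => h

theorem smul_mem_wtSub {ν : K} {U : Submodule T.H (T.wtH M ν)} {h : R} (hh : h ∈ T.H) {m : M}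
    (hm : m ∈ wtSub U) : h • m ∈ wtSub U := by
  obtain ⟨h1, h2⟩ := hm
  have := U.smul_mem (⟨h, hh⟩ : T.H) h2
  exact ⟨Subtype.coe_prop ((⟨h, hh⟩ : T.H) • (⟨m, h1⟩ : T.wtH M ν)), this⟩

variable (T M) in
/-- The vectors of weight `ν` in `low ν`. -/
def lowH (ν : K) : Submodule T.H (T.wtH M ν) where
  carrier := {m | (m : M) ∈ T.low M ν}
  add_mem' hx hy := (T.low M ν).add_mem hx hy
  zero_mem' := zero_mem (T.low M ν)
  smul_mem' h _ hm := (T.low M ν).smul_mem (h : R) hm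

theorem mem_lowH {ν : K} {m : T.wtH M ν} : m ∈ T.lowH M ν ↔ (m : M) ∈ T.low M ν := Iff.rfl

/-- The submodule generated by `low ν` and an `H`-submodule of the weight space `M^ν`. -/
def lowSup {ν : K} (U : Submodule T.H (T.wtH M ν)) : Submodule R M :=
  T.low M ν ⊔ Submodule.span R (wtSub U : Set M)

theorem lowSup_mono {ν : K} {U V : Submodule T.H (T.wtH M ν)} (h : U ≤ V) :
    lowSup U ≤ lowSup V := by
  have : wtSub U ≤ wtSub V := fun m ⟨h1, h2⟩ => ⟨h1, h h2⟩
  exact sup_le_sup_left (Submodule.span_mono this) _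

theorem degB_smul_mem_low {ν : K} {m : M} (hm : m ∈ T.wt M ν) {n : ℕ} (hn : 1 ≤ n) {b : R}
    (hb : b ∈ T.degB n) : b • m ∈ T.low M ν := by
  obtain ⟨k, rfl⟩ := Nat.exists_eq_add_of_le' hn
  refine Submodule.subset_span ⟨k, ?_⟩
  have := smul_mem_wt hb.2 hm
  push_cast at this
  convert this using 2
  ring

theorem lowSup_lowH (ν : K) : lowSup (T.lowH M ν) = T.low M ν := by
  refine sup_eq_left.mpr (Submodule.span_le.mpr ?_)
  rintro m ⟨h, hm⟩
  exact hm

theorem lowSup_top (ν : K) : lowSup (⊤ : Submodule T.H (T.wtH M ν)) = T.low M (ν + 1) := by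
  refine le_antisymm (sup_le (Submodule.span_le.mpr ?_) (Submodule.span_le.mpr ?_))
    (Submodule.span_le.mpr ?_)
  · rintro m ⟨n, hn⟩
    refine Submodule.subset_span ⟨n + 1, ?_⟩
    convert hn using 2
    push_cast
    ring
  · rintro m ⟨h, -⟩
    refine Submodule.subset_span ⟨0, ?_⟩
    convert h using 1
    rw [mem_wtH]
    simp
  · rintro m ⟨n, hn⟩
    rcases n with _ | n
    · refine Submodule.mem_sup_right (Submodule.subset_span ⟨?_, Submodule.mem_top⟩)
      rw [mem_wtH]
      simpa using hn
    · refine Submodule.mem_sup_left (Submodule.subset_span ⟨n, ?_⟩)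
      convert hn using 2
      push_cast
      ring

/-- H preserves U, and B moves it, apart from scalars, into `low ν`; by R = AHB only coefficients
from A are needed on U. -/
theorem mem_lowSup {ν : K} {U : Submodule T.H (T.wtH M ν)} {m : M} (hm : m ∈ lowSup U) :
    ∃ l ∈ T.low M ν, ∃ t ∈ Submodule.span T.A (wtSub U : Set M), l + t = m := by
  let X : Set M := {m | m ∈ wtSub U ∨ ∃ n : ℕ, m ∈ T.wt M (ν - (n + 1))}
  have h1 : m ∈ Submodule.span R X := by
    have hle : lowSup U ≤ Submodule.span R X := sup_le (Submodule.span_mono fun _ h => Or.inr h)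
      (Submodule.span_mono fun _ h => Or.inl h)
    exact hle hm
  have h2 : m ∈ Submodule.span T.A X := by
    refine span_le_span_A ?_ ?_ h1
    · rintro h hh x (hx | hx)
      · exact Or.inl (smul_mem_wtSub hh hx)
      · exact Or.inr (low_weight_closed le_rfl (mem_gr_zero hh) hx)
    · rintro n b hb x (hx | hx)
      · rcases n with _ | n
        · rw [degB_zero_eq] at hb
          obtain ⟨c, rfl⟩ := Submodule.mem_one.mp hb
          exact Or.inl (smul_mem_wtSub (T.H.algebraMap_mem c) hx)
        · refine Or.inr ⟨n, ?_⟩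
          have := smul_mem_wt hb.2 (wtSub_le U hx)
          push_cast at this
          convert this using 2
          ring
      · exact Or.inr (low_weight_closed (by omega) hb.2 hx)
  clear h1 hm
  induction h2 using Submodule.span_induction with
  | mem x hx =>
    rcases hx with hx | hx
    · exact ⟨0, zero_mem _, x, Submodule.subset_span hx, zero_add _⟩
    · exact ⟨x, Submodule.subset_span hx, 0, zero_mem _, add_zero _⟩
  | zero => exact ⟨0, zero_mem _, 0, zero_mem _, add_zero _⟩
  | add x y _ _ hx hy =>
    obtain ⟨l, hl, t, ht, rfl⟩ := hx
    obtain ⟨l', hl', t', ht', rfl⟩ := hy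
    exact ⟨l + l', add_mem hl hl', t + t', add_mem ht ht', by abel⟩
  | smul a x _ hx =>
    obtain ⟨l, hl, t, ht, rfl⟩ := hx
    exact ⟨a • l, (T.low M ν).smul_mem (a : R) hl, a • t, Submodule.smul_mem _ a ht,
      (smul_add _ _ _).symm⟩

variable [CharZero K]

/-- π kills U', so its restriction to U factors through θ. The images are killed by B_{≥ 1} because
negative degrees send M^ν into `low ν`; the universal property of Δ(W) then applies. -/
theorem exists_verma_map {Q : Type u} [AddCommGroup Q] [Module R Q] [Module K Q]
    [IsScalarTower K R Q] {ν : K} {U U' : Submodule T.H (T.wtH M ν)} {π : M →ₗ[R] Q}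
    (hπ : ∀ m ∈ lowSup U', π m = 0) {W : T.Irr} {θ : U →ₗ[T.H] W.rep}
    (hθ : Function.Surjective θ) (hker : ∀ x, θ x = 0 ↔ (x : T.wtH M ν) ∈ U') :
    ∃ g : T.verma W.rep →ₗ[R] Q,
      ∀ u : U, g (vermaIncl W.rep (θ u)) = π (u : T.wtH M ν) := by
  obtain ⟨j, hj⟩ : ∃ j : U →ₗ[T.H] Q, ∀ u, j u = π (u : T.wtH M ν) := ⟨
    { toFun := fun u => π (u : T.wtH M ν)
      map_add' := fun _ _ => map_add π _ _
      map_smul' := fun h u => map_smul π (h : R) ((u : T.wtH M ν) : M) }, fun _ => rfl⟩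
  have hj' : LinearMap.ker θ ≤ LinearMap.ker j := by
    intro u hu
    have h1 : ((u : T.wtH M ν) : M) ∈ wtSub U' := (mem_wtSub _).mpr ((hker u).mp hu)
    rw [LinearMap.mem_ker, hj]
    exact hπ _ (Submodule.mem_sup_right (Submodule.subset_span h1))
  have hφ := exists_factor_of_surjective (S := T.H) (U := U) (V := W.rep) (N := Q) hθ hj'
  obtain ⟨φ, hφθ⟩ := hφ
  have hφ : ∀ v, φ v ∈ T.killed Q 1 := by
    intro v
    obtain ⟨u, rfl⟩ := hθ v
    rw [hφθ u, hj]
    refine mem_killed_iff.mpr fun k hk b hb => ?_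
    rw [← map_smul]
    exact hπ _ (Submodule.mem_sup_left (degB_smul_mem_low (u : T.wtH M ν).2 hk hb))
  exact ⟨vermaLift φ hφ, fun u => (vermaLift_vermaIncl φ hφ _).trans ((hφθ u).trans (hj u))⟩

/-- Write an element of the kernel as Σ a_k y_k with y_k in W, where (a_k) is a K-basis of A, and
lift each y_k to U. The lifted sum lies in `low ν` + A U', and `LowFree` puts each lift in U', so
y_k = 0. -/
theorem injective_verma_map (hF : T.LowFree M) {ν : K} {U U' : Submodule T.H (T.wtH M ν)}
    {W : T.Irr} {θ : U →ₗ[T.H] W.rep} (hθ : Function.Surjective θ)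
    (hker : ∀ x, θ x = 0 ↔ (x : T.wtH M ν) ∈ U')
    (hlow : T.lowH M ν ≤ U') (g : T.verma W.rep →ₗ[R] (M ⧸ lowSup U'))
    (hgθ : ∀ u : U, g (vermaIncl W.rep (θ u)) = (lowSup U').mkQ (u : T.wtH M ν)) :
    Function.Injective g := by
  let π := (lowSup U').mkQ
  -- The lifts to U are chosen without linearity; only 0 ↦ 0 is required, so that they can be
  -- applied to finitely supported families.
  have hs : ∀ y : T.verma W.rep, ∃ m : M, (y = 0 → m = 0) ∧
      (y ∈ T.wt (T.verma W.rep) (-T.c W) →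
        m ∈ wtSub U ∧ g y = π m ∧ (m ∈ wtSub U' → y = 0)) := by
    intro y
    by_cases hy0 : y = 0
    · exact ⟨0, fun _ => rfl, fun _ => ⟨zero_mem _, by rw [hy0, map_zero, map_zero],
        fun _ => hy0⟩⟩
    by_cases hy : y ∈ T.wt (T.verma W.rep) (-T.c W)
    · obtain ⟨v, rfl⟩ := wt_verma_eq W hy
      obtain ⟨u, rfl⟩ := hθ v
      refine ⟨(u : T.wtH M ν), fun h => absurd h hy0, fun _ => ⟨(mem_wtSub _).mpr u.2, hgθ u, ?_⟩⟩
      intro h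
      rw [(hker u).mpr ((mem_wtSub _).mp h), map_zero]
    · exact ⟨0, fun _ => rfl, fun h => absurd h hy⟩
  choose s hs0 hs using hs
  refine (injective_iff_map_eq_zero _).mpr fun x hx => ?_
  have hx' : x ∈ Submodule.span T.A (T.wt (T.verma W.rep) (-T.c W) : Set (T.verma W.rep)) := by
    have h1 : x ∈ Submodule.span T.A (Set.range (vermaIncl W.rep)) :=
      span_A_vermaIncl W ▸ Submodule.mem_top
    refine Submodule.span_mono ?_ h1
    rintro _ ⟨v, rfl⟩
    exact vermaIncl_mem_wt W v
  obtain ⟨y, hy, rfl⟩ := exists_finsupp_of_mem_span_A _ hx'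
  let z := y.mapRange s (hs0 0 rfl)
  have hz : ∀ k, z k = s (y k) := fun k => Finsupp.mapRange_apply ..
  have h1 : (z.sum fun k m => (T.basisA k : R) • m) ∈ lowSup U' := by
    refine (Submodule.Quotient.mk_eq_zero _).mp ?_
    change π _ = 0
    rw [← hx, Finsupp.sum_mapRange_index fun _ => smul_zero _, Finsupp.sum, Finsupp.sum, map_sum,
      map_sum]
    refine Finset.sum_congr rfl fun k _ => ?_
    rw [map_smul, map_smul, (hs _ (hy k)).2.1]
  obtain ⟨l, hl, t, ht, hlt⟩ := mem_lowSup h1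
  obtain ⟨t', ht', rfl⟩ := exists_finsupp_of_mem_span_A _ ht
  -- The lifts z and the coefficients t' of the part in A U' have the same sum up to `low ν`, so
  -- their difference is a relation to which `LowFree` applies.
  have h2 := hF ν (z - t') (fun k => by
    rw [Finsupp.sub_apply, hz]
    exact sub_mem (wtSub_le _ (hs _ (hy k)).1) (wtSub_le _ (ht' k))) (by
    rw [Finsupp.sum_sub_index fun _ => smul_sub _, ← hlt, add_sub_cancel_right]
    exact hl)
  have h3 : y = 0 := by
    ext k
    refine (hs _ (hy k)).2.2 ?_
    have h4 := h2 k
    rw [Finsupp.sub_apply, hz] at h4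
    have h5 : s (y k) - t' k ∈ wtSub U' :=
      ⟨sub_mem (wtSub_le _ (hs _ (hy k)).1) (wtSub_le _ (ht' k)), hlow h4⟩
    have := add_mem h5 (ht' k)
    rwa [sub_add_cancel] at this
  rw [h3, Finsupp.sum_zero_index]

/-- A simple quotient of `H`-submodules of `M^ν` gives a Verma module as subquotient. -/
theorem exists_verma_subquotient (hF : T.LowFree M) {ν : K} {U U' : Submodule T.H (T.wtH M ν)}
    (hlow : T.lowH M ν ≤ U') {W : T.Irr} (θ : U →ₗ[T.H] W.rep) (hθ : Function.Surjective θ)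
    (hker : ∀ x, θ x = 0 ↔ (x : T.wtH M ν) ∈ U') :
    -T.c W = ν ∧ ∃ f : lowSup U →ₗ[R] T.verma W.rep, Function.Surjective f ∧
      (∀ x, f x = 0 ↔ (x : M) ∈ lowSup U') ∧
      ∀ (u : U) (hu : ((u : T.wtH M ν) : M) ∈ lowSup U), f ⟨_, hu⟩ = vermaIncl W.rep (θ u) := by
  obtain ⟨g, hgθ⟩ := exists_verma_map (π := (lowSup U').mkQ)
    (fun m hm => (Submodule.Quotient.mk_eq_zero _).mpr hm) hθ hker
  have hginj := injective_verma_map hF hθ hker hlow g hgθ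
  let π := (lowSup U').mkQ
  have hc : -T.c W = ν := by
    have hnt := IsSimpleModule.nontrivial T.H W.rep
    obtain ⟨v, hv⟩ := exists_ne (0 : W.rep)
    obtain ⟨u, rfl⟩ := hθ v
    refine eq_of_mem_maxGenEigenspace (v := g (vermaIncl W.rep (θ u))) ?_
      (map_mem_wt g (vermaIncl_mem_wt W _)) ?_
    · intro h
      exact hv (vermaIncl_injective W.2 ((hginj (h.trans (map_zero g).symm)).trans (map_zero _).symm))
    · rw [hgθ]
      exact map_mem_wt π (u : T.wtH M ν).2
  refine ⟨hc, ?_⟩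
  have hrange : ∀ x : lowSup U, π (x : M) ∈ LinearMap.range g := by
    have hle : lowSup U ≤ (LinearMap.range g).comap π := by
      refine sup_le (fun l hl => ⟨0, ?_⟩) (Submodule.span_le.mpr ?_)
      · rw [map_zero]
        exact ((Submodule.Quotient.mk_eq_zero _).mpr (Submodule.mem_sup_left hl)).symm
      · rintro m ⟨h, hm⟩
        exact ⟨_, hgθ ⟨⟨m, h⟩, hm⟩⟩
    exact fun x => hle x.2
  let e := LinearEquiv.ofInjective g hginj
  let f : lowSup U →ₗ[R] T.verma W.rep :=
    e.symm.toLinearMap ∘ₗ (π ∘ₗ (lowSup U).subtype).codRestrict (LinearMap.range g) hrange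
  have hgf : ∀ x, g (f x) = π (x : M) := fun x =>
    congrArg Subtype.val (e.apply_symm_apply ⟨π (x : M), hrange x⟩)
  have hfu : ∀ (u : U) (hu : ((u : T.wtH M ν) : M) ∈ lowSup U),
      f ⟨_, hu⟩ = vermaIncl W.rep (θ u) := fun u hu => hginj (by rw [hgf, hgθ])
  refine ⟨f, ?_, fun x => ?_, hfu⟩
  · rw [← LinearMap.range_eq_top, eq_top_iff, ← span_vermaIncl W.rep, Submodule.span_le]
    rintro _ ⟨v, rfl⟩
    obtain ⟨u, rfl⟩ := hθ v
    exact ⟨_, hfu u (Submodule.mem_sup_right (Submodule.subset_span ((mem_wtSub _).mpr u.2)))⟩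
  · constructor
    · intro h
      have := hgf x
      rw [h, map_zero] at this
      exact (Submodule.Quotient.mk_eq_zero _).mp this.symm
    · intro h
      apply hginj
      rw [hgf, map_zero]
      exact (Submodule.Quotient.mk_eq_zero _).mpr h

variable (hM : T.IsO M)
include hM

theorem IsO.isNoetherian_wtH (ν : K) : IsNoetherian T.H (T.wtH M ν) := by
  have h1 := hM.finite_wt ν
  have h2 : Module.Finite K (T.wtH M ν) := h1
  exact isNoetherian_of_tower K inferInstance

/-- Noetherian induction upwards on U: a simple submodule of M^ν / U enlarges U by one step, which
adds a single Verma module to the filtration, until U is all of M^ν. -/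
theorem IsO.vermaFiltration_lowSup (hF : T.LowFree M) {p : T.Irr → Prop} {ν : K}
    (hp : ∀ E, -T.c E = ν → p E) (U : Submodule T.H (T.wtH M ν)) (hlow : T.lowH M ν ≤ U)
    (h : VermaFiltration T M p (lowSup U)) : VermaFiltration T M p (T.low M (ν + 1)) := by
  have := isSemisimpleRing_H T
  have := hM.isNoetherian_wtH ν
  revert hlow h
  refine WellFoundedGT.induction (motive := fun U => T.lowH M ν ≤ U → VermaFiltration T M p (lowSup U) →
    VermaFiltration T M p (T.low M (ν + 1))) U ?_
  intro U ih hlow h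
  by_cases htop : U = ⊤
  · rwa [htop, lowSup_top] at h
  have hnt : Nontrivial (T.wtH M ν ⧸ U) := Submodule.Quotient.nontrivial_iff.mpr htop
  obtain ⟨S, hS⟩ := IsSemisimpleModule.exists_simple_submodule T.H (T.wtH M ν ⧸ U)
  obtain ⟨W, ⟨e⟩⟩ := exists_rep (T := T) S
  let V := S.comap U.mkQ
  have hUV : U ≤ V := fun x hx => by
    rw [Submodule.mem_comap, Submodule.mkQ_apply, (Submodule.Quotient.mk_eq_zero _).mpr hx]
    exact zero_mem _
  let θ : V →ₗ[T.H] W.rep :=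
    e.symm.toLinearMap ∘ₗ (U.mkQ ∘ₗ V.subtype).codRestrict S fun x => x.2
  have hθ : Function.Surjective θ := by
    refine e.symm.surjective.comp ?_
    rintro ⟨y, hy⟩
    obtain ⟨x, rfl⟩ := U.mkQ_surjective y
    exact ⟨⟨x, hy⟩, rfl⟩
  have hker : ∀ x, θ x = 0 ↔ (x : T.wtH M ν) ∈ U := fun x => by
    refine e.symm.map_eq_zero_iff.trans ?_
    rw [← Submodule.Quotient.mk_eq_zero (p := U)]
    exact ⟨fun h => congrArg Subtype.val h, fun h => Subtype.ext h⟩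
  obtain ⟨hc, f, hf, hfker, -⟩ := exists_verma_subquotient hF hlow θ hθ hker
  refine ih V (lt_of_le_of_ne hUV ?_) (hlow.trans hUV) (.step _ _ ?_ W (hp W hc) f hf hfker h)
  · intro heq
    have hSn := IsSimpleModule.nontrivial T.H W.rep
    obtain ⟨v, hv⟩ := exists_ne (0 : W.rep)
    obtain ⟨x, rfl⟩ := hθ v
    exact hv ((hker x).mpr (heq.ge x.2))
  · exact lowSup_mono hUV

/-- The weights are bounded below in each coset of ℤ, so `low` vanishes far down. From there one
climbs to ν in steps of one. -/
theorem IsO.vermaFiltration_low (hF : T.LowFree M) {p : T.Irr → Prop} {ν : K}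
    (hp : ∀ E, ∀ n : ℕ, -T.c E = ν - (n + 1) → p E) : VermaFiltration T M p (T.low M ν) := by
  obtain ⟨N, hN⟩ := T.exists_roots_bound ν
  have key : ∀ k ≤ N, VermaFiltration T M p (T.low M (ν - (N - k : ℕ))) := by
    intro k
    induction k with
    | zero =>
      intro _
      have : T.low M (ν - (N - 0 : ℕ)) = ⊥ := by
        refine eq_bot_iff.mpr (Submodule.span_le.mpr ?_)
        rintro m ⟨n, hn⟩
        by_contra hne
        obtain ⟨z, hz, j, hj⟩ := hM.exists_root_of_mem_wt hn hne
        refine hN (N + (n + 1)) (by omega) z hz j ?_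
        rw [← hj]
        push_cast
        rw [Nat.sub_zero]
        ring
      rw [this]
      exact .bot
    | succ k ih =>
      intro hk
      have h1 := ih (by omega)
      obtain ⟨j, hj⟩ : ∃ j, N - (k + 1) = j := ⟨_, rfl⟩
      have hj' : N - k = j + 1 := by omega
      rw [hj'] at h1
      rw [hj]
      have h2 : ν - (j : ℕ) = (ν - (j + 1 : ℕ)) + 1 := by push_cast; ring
      rw [h2]
      refine hM.vermaFiltration_lowSup hF (fun E hE => hp E j (by rw [hE]; push_cast; rfl)) _
        le_rfl ?_
      rwa [lowSup_lowH]
  have := key N le_rfl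
  simpa using this

/-- The vectors of weight `ν` in the module generated by an `H`-submodule of `M^ν`. -/
theorem IsO.mem_of_mem_span_wtSub {ν : K} {U : Submodule T.H (T.wtH M ν)} {m : M}
    (hm : m ∈ Submodule.span R (wtSub U : Set M)) (hν : m ∈ T.wt M ν) :
    ∃ x ∈ wtSub U, ∃ l ∈ T.low M ν, x + l = m := by
  classical
  let P := wtSub U ⊔ (T.low M ν).restrictScalars K
  suffices h : internalProj (ws_isInternal hM.ws_eq_top) ν m ∈ P by
    rw [internalProj_of_mem _ hν] at h
    exact Submodule.mem_sup.mp h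
  clear hν
  have hPlow : ∀ x ∈ T.low M ν, internalProj (ws_isInternal hM.ws_eq_top) ν x ∈ P := fun x hx =>
    Submodule.mem_sup_right (proj_mem_submodule hM.ws_eq_top _ hx ν)
  induction hm using Submodule.closure_induction with
  | zero => rw [map_zero]; exact zero_mem _
  | add x y _ _ hx hy => rw [map_add]; exact add_mem hx hy
  | smul_mem r m hm =>
    have hr : r ∈ T.SA * T.SH * T.SB := by rw [A_mul_H_mul_B]; trivial
    induction hr using Submodule.mul_induction_on' with
    | mem_mul_mem x hx b hb =>
      have hb' := T.B_graded hb
      clear hb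
      induction hb' using Submodule.iSup_induction' with
      | mem n b hb =>
        rcases n with _ | n
        · change b ∈ T.degB 0 at hb
          rw [degB_zero_eq] at hb
          obtain ⟨c, rfl⟩ := Submodule.mem_one.mp hb
          induction hx using Submodule.mul_induction_on' with
          | mem_mul_mem a ha h hh =>
            rw [mul_smul, mul_smul]
            have hy := smul_mem_wtSub hh (smul_mem_wtSub (T.H.algebraMap_mem c) hm)
            have ha' := SA_le ha
            clear ha
            induction ha' using Submodule.iSup_induction' with
            | mem k a ha =>
              rcases k with _ | k
              · rw [degA_zero_eq] at ha
                obtain ⟨d, rfl⟩ := Submodule.mem_one.mp ha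
                have hy' := smul_mem_wtSub (T.H.algebraMap_mem d) hy
                rw [internalProj_of_mem _ (wtSub_le _ hy')]
                exact Submodule.mem_sup_left hy'
              · rw [internalProj_of_mem_ne _ _ (smul_mem_wt ha.2 (wtSub_le _ hy))]
                · exact zero_mem _
                · intro h
                  have : ((k + 1 : ℕ) : K) = 0 := by
                    have h' : ν + ((k + 1 : ℕ) : K) = ν := by simpa using h
                    linear_combination h'
                  exact absurd (Nat.cast_eq_zero.mp this) (by omega)
            | zero => rw [zero_smul, map_zero]; exact zero_mem _
            | add x y _ _ hx hy => rw [add_smul, map_add]; exact add_mem hx hy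
          | add x _ y _ hx hy => rw [add_mul, add_smul, map_add]; exact add_mem hx hy
        · refine hPlow _ ?_
          rw [mul_smul]
          exact (T.low M ν).smul_mem x
            (degB_smul_mem_low (wtSub_le _ hm) (Nat.succ_pos n) hb)
      | zero => rw [mul_zero, zero_smul, map_zero]; exact zero_mem _
      | add y z _ _ hy hz => rw [mul_add, add_smul, map_add]; exact add_mem hy hz
    | add x _ y _ hx hy => rw [add_smul, map_add]; exact add_mem hx hy

end Filtration

/-! ### Standard filtrations of the projective covers -/

section ProjectiveFiltration

open ModuleCat

variable [CharZero K] [IsNoetherianRing R]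

/-- The lift g : P → Δ(W) of f is onto, since a proper image would lie in the radical. Its kernel
turns out to be `low` at the weight -c(W), whose filtration involves only Verma modules of strictly
smaller lowest weight, that is with larger c. -/
theorem exists_projective_cover_filtration (W : T.Irr) :
    ∃ (N : ℕ) (P : Submodule R (T.quotQ N)) (f : P →ₗ[R] simpleQuot W)
      (g : P →ₗ[R] T.verma W.rep),
      T.LiftsInO P ∧ f ≠ 0 ∧ (∀ Y : Submodule R P, Y.map f ≠ ⊥ → Y = ⊤) ∧
      Function.Surjective g ∧ VermaFiltration T P (fun E => T.lt W E) (LinearMap.ker g) := by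
  obtain ⟨N, P, f, hlift, hf, hess, ⟨x, hx, hspan⟩, hF⟩ := exists_projective_cover W
  have hP : T.IsO P := (isO_quotQ N).submodule P
  obtain ⟨g, hg⟩ := hlift _ _ (isO_verma_rep W) (vermaRad W).mkQ (vermaRad W).mkQ_surjective f
  have hgf : ∀ y, f y = (vermaRad W).mkQ (g y) := fun y => (LinearMap.congr_fun hg y).symm
  have hgsurj : Function.Surjective g := by
    rw [← LinearMap.range_eq_top]
    by_contra hne
    have := le_vermaRad W hne
    refine hf (LinearMap.ext fun y => ?_)
    rw [hgf]
    exact (Submodule.Quotient.mk_eq_zero _).mpr (this ⟨y, rfl⟩)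
  refine ⟨N, P, f, g, hlift, hf, hess, hgsurj, ?_⟩
  set μ := -T.c W with hμ
  have hglow : ∀ y ∈ T.low P μ, g y = 0 := by
    have : T.low P μ ≤ LinearMap.ker g := by
      refine Submodule.span_le.mpr ?_
      rintro y ⟨n, hn⟩
      by_contra hne
      obtain ⟨k, hk⟩ := exists_weight_verma W (map_mem_wt g hn) hne
      have h0 : ((n + 1 + k : ℕ) : K) = 0 := by
        push_cast
        linear_combination -hk
      exact absurd (Nat.cast_eq_zero.mp h0) (by omega)
    exact fun y hy => this hy
  let G : T.wtH P μ →ₗ[T.H] T.verma W.rep :=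
    { toFun := fun y => g y
      map_add' := fun _ _ => map_add g _ _
      map_smul' := fun h y => map_smul g (h : R) (y : P) }
  let U := LinearMap.ker G
  have hUlow : U = T.lowH P μ := by
    refine le_antisymm (fun y hy => ?_) (fun y hy => ?_)
    swap
    · exact hglow _ (mem_lowH.mp hy)
    have := isSemisimpleRing_H T
    -- An H-complement V of the kernel U in P^μ maps nontrivially to L(W), so it generates P by
    -- essentiality. A vector of U is then the sum of a vector of V and one of `low`; the former
    -- lies in U ∩ V = 0.
    obtain ⟨V, hV⟩ := exists_isCompl U
    have hYtop : Submodule.span R (wtSub V : Set P) = ⊤ := by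
      refine hess _ fun hbot => hf ?_
      have hfV : ∀ y ∈ V, f y = 0 := fun y hy => by
        have : f y ∈ (Submodule.span R (wtSub V : Set P)).map f :=
          ⟨y, Submodule.subset_span ((mem_wtSub y).mpr hy), rfl⟩
        rwa [hbot] at this
      have hfx : f x = 0 := by
        have hx' : (⟨x, hx⟩ : T.wtH P μ) ∈ U ⊔ V := hV.sup_eq_top ▸ Submodule.mem_top
        obtain ⟨a, ha, b, hb, hab⟩ := Submodule.mem_sup.mp hx'
        have h1 : x = (a : P) + b := (congrArg Subtype.val hab).symm
        have ha' : g a = 0 := ha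
        rw [h1, map_add, hfV b hb, hgf, ha', map_zero, add_zero]
      refine LinearMap.ext_on hspan ?_
      rintro _ rfl
      exact hfx
    obtain ⟨a, ha, l, hl, hal⟩ := hP.mem_of_mem_span_wtSub (U := V) (m := (y : P))
      (hYtop ▸ Submodule.mem_top) y.2
    obtain ⟨ha', haV⟩ := ha
    have h1 : (⟨a, ha'⟩ : T.wtH P μ) ∈ U := by
      change g a = 0
      have h2 : g y = 0 := hy
      rw [← hal, map_add, hglow l hl, add_zero] at h2
      exact h2
    have h3 := Submodule.disjoint_def.mp hV.disjoint _ h1 haV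
    have h4 : a = 0 := congrArg Subtype.val h3
    rw [h4, zero_add] at hal
    rw [mem_lowH, ← hal]
    exact hl
  have hGsurj : ∀ v, ∃ y, G y = vermaIncl W.rep v := fun v => by
    obtain ⟨y, hy, h⟩ := exists_wt_lift hP.ws_eq_top g hgsurj (vermaIncl_mem_wt W v)
    exact ⟨⟨y, hy⟩, h⟩
  have hGmem : ∀ y, ∃ v, vermaIncl W.rep v = G y := fun y =>
    wt_verma_eq W (map_mem_wt g y.2)
  let e := LinearEquiv.ofInjective (vermaIncl W.rep) (vermaIncl_injective W.2)
  let θ : (⊤ : Submodule T.H (T.wtH P μ)) →ₗ[T.H] W.rep :=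
    e.symm.toLinearMap ∘ₗ G.codRestrict (LinearMap.range (vermaIncl W.rep)) hGmem ∘ₗ
      (⊤ : Submodule T.H (T.wtH P μ)).subtype
  have hθ : ∀ y, vermaIncl W.rep (θ y) = G y := fun y =>
    congrArg Subtype.val (e.apply_symm_apply ⟨G y, hGmem y⟩)
  have hinj := vermaIncl_injective (W := W.rep) W.2
  obtain ⟨-, f', -, hf', hf'u⟩ := exists_verma_subquotient hF (U := ⊤) (U' := U) hUlow.ge θ
    (fun v => by
      obtain ⟨y, hy⟩ := hGsurj v
      exact ⟨⟨y, Submodule.mem_top⟩, hinj (by rw [hθ, hy])⟩)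
    (fun y => by
      rw [← hinj.eq_iff, hθ, map_zero]
      rfl)
  have htop : lowSup (⊤ : Submodule T.H (T.wtH P μ)) = ⊤ := by
    rw [eq_top_iff, ← hspan, Submodule.span_le]
    rintro _ rfl
    exact Submodule.mem_sup_right (Submodule.subset_span ⟨hx, Submodule.mem_top⟩)
  have hker : LinearMap.ker g = T.low P μ := by
    refine le_antisymm (fun y hy => ?_) hglow
    -- P is cyclic on x, and both maps send x to the same vector. Hence g inherits the kernel of f',
    -- which is `low`.
    have hall : ∀ y (hy : y ∈ lowSup (⊤ : Submodule T.H (T.wtH P μ))), f' ⟨y, hy⟩ = g y := by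
      intro y hy
      have hy' : y ∈ Submodule.span R {x} := hspan ▸ Submodule.mem_top
      obtain ⟨r, rfl⟩ := Submodule.mem_span_singleton.mp hy'
      have hxm : x ∈ lowSup (⊤ : Submodule T.H (T.wtH P μ)) := htop ▸ Submodule.mem_top
      have h1 := hf'u ⟨⟨x, hx⟩, Submodule.mem_top⟩ hxm
      rw [hθ] at h1
      change f' (r • ⟨x, hxm⟩) = _
      rw [map_smul, map_smul, h1]
      rfl
    have hym : y ∈ lowSup (⊤ : Submodule T.H (T.wtH P μ)) := htop ▸ Submodule.mem_top
    have h1 := (hf' ⟨y, hym⟩).mp ((hall y hym).trans hy)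
    rw [hUlow, lowSup_lowH] at h1
    exact h1
  rw [hker]
  refine hP.vermaFiltration_low hF fun E n hE => ⟨n + 1, Nat.succ_pos n, ?_⟩
  push_cast
  linear_combination -hE

end ProjectiveFiltration

end TriangularDecomposition

/-! ### Bounded bilinear maps and the completed tensor product -/

section ProjTensor

variable {K : Type*} [NontriviallyNormedField K]
variable {V W : Type*} [SeminormedAddCommGroup V] [NormedSpace K V]
  [SeminormedAddCommGroup W] [NormedSpace K W]
  {Z : Type*} [NormedAddCommGroup Z] [NormedSpace K Z] [IsUltrametricDist Z]

/-- The linear map on `V ⊗ W` given by a bilinear map. -/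
def ProjTensor.lift (f : V →ₗ[K] W →ₗ[K] Z) : ProjTensor K V W →ₗ[K] Z :=
  (TensorProduct.lift f : V ⊗[K] W →ₗ[K] Z)

theorem ProjTensor.lift_tmul (f : V →ₗ[K] W →ₗ[K] Z) (v : V) (w : W) :
    ProjTensor.lift f (ProjTensor.tmul (K := K) v w) = f v w :=
  TensorProduct.lift.tmul v w

/-- The ultrametric inequality in Z bounds the value by the maximum over the terms of any
presentation; then one passes to the infimum. -/
theorem ProjTensor.norm_lift_le (f : V →ₗ[K] W →ₗ[K] Z) {C : ℝ} (hC : 0 ≤ C)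
    (hf : ∀ v w, ‖f v w‖ ≤ C * (‖v‖ * ‖w‖)) (t : ProjTensor K V W) :
    ‖ProjTensor.lift f t‖ ≤ C * ‖t‖ := by
  have key : ∀ r ∈ ProjTensor.bounds t, ‖ProjTensor.lift f t‖ ≤ C * r := by
    rintro r ⟨hr, n, v, w, rfl, h⟩
    rw [map_sum]
    refine IsUltrametricDist.norm_sum_le_of_forall_le_of_nonneg (by positivity) fun i _ => ?_
    rw [ProjTensor.lift_tmul]
    exact (hf _ _).trans (mul_le_mul_of_nonneg_left (h i) hC)
  change _ ≤ C * sInf (ProjTensor.bounds t)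
  rcases hC.eq_or_lt with rfl | hC'
  · obtain ⟨r, hr⟩ := ProjTensor.bounds_nonempty t
    simpa using key r hr
  · rw [← div_le_iff₀' hC']
    refine le_csInf (ProjTensor.bounds_nonempty t) fun r hr => ?_
    rw [div_le_iff₀' hC']
    exact key r hr

/-- The continuous linear map on `U ⊗̂ V ⊗̂ W` given by two continuous functionals. -/
theorem exists_slice_completedTensor {U : Type*} [NormedAddCommGroup U] [NormedSpace K U]
    [IsUltrametricDist U] [CompleteSpace U] (φ : V →L[K] K) (β : W →L[K] K) :
    ∃ S : CompletedTensor₃ K U V W →L[K] U, ∀ (a : U) (v : V) (b : W),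
      S ((ProjTensor.tmul (K := K) (ProjTensor.tmul (K := K) a v) b :
        ProjTensor K (ProjTensor K U V) W)) = (φ v * β b) • a := by
  let f₁ : U →ₗ[K] V →ₗ[K] U := (LinearMap.lsmul K U).flip.compl₂ φ.toLinearMap
  have hf₁ : ∀ a v, ‖f₁ a v‖ ≤ ‖φ‖ * (‖a‖ * ‖v‖) := fun a v => by
    change ‖φ v • a‖ ≤ _
    rw [norm_smul]
    calc _ ≤ (‖φ‖ * ‖v‖) * ‖a‖ := mul_le_mul_of_nonneg_right (φ.le_opNorm v) (norm_nonneg a)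
      _ = _ := by ring
  let f₂ : ProjTensor K U V →ₗ[K] W →ₗ[K] U :=
    ((LinearMap.lsmul K U).flip.compl₂ β.toLinearMap) ∘ₗ ProjTensor.lift f₁
  have hf₂ : ∀ t b, ‖f₂ t b‖ ≤ (‖φ‖ * ‖β‖) * (‖t‖ * ‖b‖) := fun t b => by
    change ‖β b • ProjTensor.lift f₁ t‖ ≤ _
    rw [norm_smul]
    calc _ ≤ (‖β‖ * ‖b‖) * (‖φ‖ * ‖t‖) :=
          mul_le_mul (β.le_opNorm b) (ProjTensor.norm_lift_le f₁ (norm_nonneg φ) hf₁ t)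
            (norm_nonneg _) (by positivity)
      _ = _ := by ring
  let S₁ : ProjTensor K (ProjTensor K U V) W →L[K] U := (ProjTensor.lift f₂).mkContinuous
    (‖φ‖ * ‖β‖) (ProjTensor.norm_lift_le f₂ (by positivity) hf₂)
  let ι : ProjTensor K (ProjTensor K U V) W →L[K] CompletedTensor₃ K U V W :=
    UniformSpace.Completion.toComplL
  have hd : DenseRange ι := UniformSpace.Completion.denseRange_coe
  have hu : IsUniformInducing ι := UniformSpace.Completion.isUniformInducing_coe _
  refine ⟨S₁.extend ι, fun a v b => ?_⟩
  refine (S₁.extend_eq hd hu _).trans ?_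
  change ProjTensor.lift f₂ (ProjTensor.tmul (K := K) (ProjTensor.tmul (K := K) a v) b) = _
  rw [ProjTensor.lift_tmul]
  change β b • ProjTensor.lift f₁ (ProjTensor.tmul (K := K) a v) = _
  rw [ProjTensor.lift_tmul, mul_comm, mul_smul]
  rfl

end ProjTensor

/-! ### Expansions of the elements of `𝓐` and `𝓑` -/

section Closure

variable {K : Type w} [NontriviallyNormedField K] [CharZero K]
  {𝓡 : Type u} [NormedRing 𝓡] [NormedAlgebra K 𝓡]

/-- The degree `n` part of `S`, as a subspace of the closure of `S`. -/
def closurePiece {R : Subalgebra K 𝓡} (T : TriangularDecomposition K R) (S : Subalgebra K R)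
    (n : ℤ) : Submodule K (closureIn R S) :=
  ((Subalgebra.toSubmodule S ⊓ T.gr n).map R.val.toLinearMap).comap
    (closureIn R S).val.toLinearMap

theorem mem_closurePiece {R : Subalgebra K 𝓡} {T : TriangularDecomposition K R}
    {S : Subalgebra K R} {n : ℤ} {x : closureIn R S} :
    x ∈ closurePiece T S n ↔ ∃ s ∈ S, s ∈ T.gr n ∧ (s : 𝓡) = x := by
  constructor
  · rintro ⟨s, ⟨h1, h2⟩, h3⟩
    exact ⟨s, h1, h2, h3⟩
  · rintro ⟨s, h1, h2, h3⟩
    exact ⟨s, ⟨h1, h2⟩, h3⟩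

theorem coe_mem_closureIn {R : Subalgebra K 𝓡} {S : Subalgebra K R} {s : R} (hs : s ∈ S) :
    (s : 𝓡) ∈ closureIn R S :=
  Subalgebra.le_topologicalClosure _ ⟨s, hs, rfl⟩

theorem adClosure_closurePiece {R : Subalgebra K 𝓡} {T : TriangularDecomposition K R}
    {S : Subalgebra K R} (hS : ∀ x ∈ S, T.del * x - x * T.del ∈ S) {n : ℤ} {x : closureIn R S}
    (hx : x ∈ closurePiece T S n) : adClosure T.del hS x = (n : K) • x := by
  obtain ⟨s, -, h2, h3⟩ := mem_closurePiece.mp hx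
  refine Subtype.ext ?_
  change (T.del : 𝓡) * x - x * T.del = (n : K) • (x : 𝓡)
  rw [← h3, Int.cast_smul_eq_zsmul]
  exact congrArg Subtype.val ((T.mem_gr n s).mp h2)

/-- The hypothesis `hws` places x in S itself, not merely in its closure. There x has a nonzero
homogeneous component, whose degree must be the eigenvalue. -/
theorem mem_closurePiece_of_eigenvector {R : Subalgebra K 𝓡} (T : TriangularDecomposition K R)
    {S : Subalgebra K R} {d : ℕ → ℤ}
    (hS : Subalgebra.toSubmodule S ≤ ⨆ n : ℕ, Subalgebra.toSubmodule S ⊓ T.gr (d n))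
    (hws : (ws (adClosure T.del fun _ hx => T.ad_mem hS hx)).map
      (closureIn R S).val.toLinearMap = Subalgebra.toSubmodule (S.map R.val))
    {c : K} {x : closureIn R S} (hx : adClosure T.del (fun _ hx => T.ad_mem hS hx) x = c • x)
    (hne : x ≠ 0) : ∃ n : ℕ, c = d n ∧ x ∈ closurePiece T S (d n) := by
  have hxw : x ∈ ws (adClosure T.del fun _ hx => T.ad_mem hS hx) :=
    Submodule.mem_iSup_of_mem c (Module.End.mem_maxGenEigenspace _ _ _ |>.mpr
      ⟨1, by simp [hx]⟩)
  have h1 : (x : 𝓡) ∈ Subalgebra.toSubmodule (S.map R.val) :=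
    hws ▸ Submodule.mem_map_of_mem (f := (closureIn R S).val.toLinearMap) hxw
  obtain ⟨s, hs, hsx⟩ := h1
  replace hsx : (s : 𝓡) = x := hsx
  have hne' : s ≠ 0 := by
    rintro rfl
    exact hne (Subtype.ext hsx.symm)
  have hc : T.del * s - s * T.del = c • s := by
    refine Subtype.ext ?_
    have := congrArg Subtype.val hx
    change (T.del : 𝓡) * x - x * T.del = c • (x : 𝓡) at this
    rw [← hsx] at this
    exact this
  have hpm : ∀ m, T.proj m (T.del * s - s * T.del) = (m : K) • T.proj m s := by
    intro m
    have hs' : s ∈ ⨆ n, T.gr n := by rw [T.isInternal.submodule_iSup_eq_top]; trivial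
    clear hs hsx hne' hc
    induction hs' using Submodule.iSup_induction' with
    | mem n s hs =>
      rw [(T.mem_gr n s).mp hs, map_zsmul]
      rcases eq_or_ne n m with rfl | hnm
      · rw [Int.cast_smul_eq_zsmul]
      · rw [TriangularDecomposition.proj_of_mem_ne hnm hs, smul_zero, smul_zero]
    | zero => simp
    | add s s' _ _ h h' =>
      rw [show T.del * (s + s') - (s + s') * T.del =
        (T.del * s - s * T.del) + (T.del * s' - s' * T.del) by noncomm_ring, map_add, h, h',
        map_add, smul_add]
  have hex : ∃ n : ℕ, T.proj (d n) s ≠ 0 := by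
    by_contra! hcon
    refine hne' ?_
    obtain ⟨F, hF⟩ := internalProj_sum T.isInternal s
    rw [hF]
    refine Finset.sum_eq_zero fun m _ => ?_
    by_cases hm : ∃ n, d n = m
    · obtain ⟨n, rfl⟩ := hm
      exact hcon n
    · have : (⨆ n : ℕ, Subalgebra.toSubmodule S ⊓ T.gr (d n)) ≤ LinearMap.ker (T.proj m) :=
        iSup_le fun n y hy => TriangularDecomposition.proj_of_mem_ne (fun h => hm ⟨n, h⟩) hy.2
      exact this (hS hs)
  obtain ⟨n, hn⟩ := hex
  have hcd : c = d n := by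
    have := hpm (d n)
    rw [hc, map_smul, ← sub_eq_zero, ← sub_smul] at this
    exact sub_eq_zero.mp ((smul_eq_zero.mp this).resolve_right hn)
  refine ⟨n, hcd, mem_closurePiece.mpr ⟨s, hs, (T.mem_gr _ _).mpr ?_, hsx⟩⟩
  rw [hc, hcd, Int.cast_smul_eq_zsmul]

/-- Only eigenvalues in the range of d contribute nonzero terms, so the expansion can be reindexed
by ℕ. -/
theorem exists_hasSum_of_semisimple {V : Type*} [AddCommGroup V] [Module K V] [TopologicalSpace V]
    {D : Module.End K V} (hss : HasSemisimpleWeightDecomposition D) {P : ℕ → Submodule K V}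
    {d : ℕ → K} (hd : Function.Injective d)
    (key : ∀ (c : K) (x : V), D x = c • x → x ≠ 0 → ∃ n : ℕ, c = d n ∧ x ∈ P n) (a : V) :
    ∃ f : ℕ → V, (∀ n, f n ∈ P n) ∧ HasSum f a := by
  obtain ⟨I, ⟨-, hdec⟩, hs⟩ := hss
  obtain ⟨g, hg, hsum⟩ := hdec a
  let G : K → V := Function.extend Subtype.val g 0
  have hG : HasSum G a := (hasSum_extend_zero Subtype.val_injective).mpr hsum
  have hG' : ∀ c, G c ≠ 0 → ∃ n : ℕ, c = d n ∧ G c ∈ P n := by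
    intro c hc
    by_cases hcI : c ∈ I
    · have h1 : G c = g ⟨c, hcI⟩ := Subtype.val_injective.extend_apply g 0 ⟨c, hcI⟩
      rw [h1] at hc ⊢
      exact key c _ (hs c hcI _ (hg ⟨c, hcI⟩)) hc
    · refine absurd (Function.extend_apply' _ _ _ ?_) hc
      rintro ⟨x, rfl⟩
      exact hcI x.2
  refine ⟨fun n => G (d n), fun n => ?_, (hd.hasSum_iff fun c hc => ?_).mpr hG⟩
  · change G (d n) ∈ P n
    by_cases h0 : G (d n) = 0
    · rw [h0]; exact zero_mem _
    · obtain ⟨m, hm, hGm⟩ := hG' _ h0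
      rwa [← hd hm] at hGm
  · by_contra hne
    obtain ⟨n, rfl, -⟩ := hG' c hne
    exact hc ⟨n, rfl⟩

theorem exists_hasSum_closurePiece {R : Subalgebra K 𝓡} (T : TriangularDecomposition K R)
    {S : Subalgebra K R} {d : ℕ → ℤ} (hd : Function.Injective d)
    (hS : Subalgebra.toSubmodule S ≤ ⨆ n : ℕ, Subalgebra.toSubmodule S ⊓ T.gr (d n))
    (hss : HasSemisimpleWeightDecomposition (adClosure T.del fun _ hx => T.ad_mem hS hx))
    (hws : (ws (adClosure T.del fun _ hx => T.ad_mem hS hx)).map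
      (closureIn R S).val.toLinearMap = Subalgebra.toSubmodule (S.map R.val))
    (a : closureIn R S) :
    ∃ f : ℕ → closureIn R S, (∀ n, f n ∈ closurePiece T S (d n)) ∧ HasSum f a :=
  exists_hasSum_of_semisimple hss (P := fun n => closurePiece T S (d n)) (d := fun n => (d n : K))
    (Int.cast_injective.comp hd)
    (fun _ _ hx hne => mem_closurePiece_of_eigenvector T hS hws hx hne) a

namespace BanachTriangularDecomposition

variable (D : BanachTriangularDecomposition K 𝓡)

/-- The derivation `ad(∂)` of `𝓐`. -/
abbrev adA : Module.End K D.A := adClosure D.T.del fun _ hx => D.T.ad_mem D.T.A_graded hx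

/-- The derivation `ad(∂)` of `𝓑`. -/
abbrev adB : Module.End K D.B := adClosure D.T.del fun _ hx => D.T.ad_mem D.T.B_graded hx

/-- `A_n ⊆ 𝓐`. -/
abbrev pieceA (n : ℕ) : Submodule K D.A := closurePiece D.T D.T.A n

/-- `B_{-n} ⊆ 𝓑`. -/
abbrev pieceB (n : ℕ) : Submodule K D.B := closurePiece D.T D.T.B (-n)

theorem isExpanding_A : IsExpanding D.adA D.pieceA where
  apply n a ha := by simpa using adClosure_closurePiece _ ha
  exists_hasSum := exists_hasSum_closurePiece D.T Nat.cast_injective D.T.A_graded D.semisimple_A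
    D.ws_A

theorem isExpanding_B : IsExpanding (-D.adB) D.pieceB where
  apply n a ha := by
    rw [LinearMap.neg_apply, adClosure_closurePiece _ ha]
    simp
  exists_hasSum := exists_hasSum_closurePiece D.T
    (fun m n h => by simpa using h) D.T.B_graded D.semisimple_B D.ws_B

variable {D}

theorem continuous_adClosure {R : Subalgebra K 𝓡} (d : R) {S : Subalgebra K R}
    (hS : ∀ x ∈ S, d * x - x * d ∈ S) : Continuous (adClosure d hS) := by
  refine Continuous.subtype_mk (f := fun x : closureIn R S => (d : 𝓡) * x - x * d) ?_ _
  fun_prop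

end BanachTriangularDecomposition

end Closure

/-! ### Slices of `𝓡` and the left ideals generated by `⨁_{n ≥ N} B_{-n}` -/

/-- A functional on a finite dimensional complement of a closed subspace extends continuously by
zero. -/
theorem exists_functional_of_isCompl {K : Type*} [NontriviallyNormedField K] [CompleteSpace K]
    {V : Type*} [NormedAddCommGroup V] [NormedSpace K V] {J C : Submodule K V}
    (hJ : IsClosed (J : Set V)) [Module.Finite K C] (hdisj : ∀ x ∈ C, x ∈ J → x = 0)
    (hsup : ∀ x : V, ∃ y ∈ C, x - y ∈ J) (l : C →ₗ[K] K) :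
    ∃ β : V →L[K] K, (∀ c : C, β c = l c) ∧ ∀ x ∈ J, β x = 0 := by
  have : IsClosed (J : Set V) := hJ
  let j : C →ₗ[K] V ⧸ J := J.mkQ ∘ₗ C.subtype
  have hj : Function.Bijective j := by
    constructor
    · rw [injective_iff_map_eq_zero]
      intro c hc
      exact Subtype.ext (hdisj c c.2 ((Submodule.Quotient.mk_eq_zero J).mp hc))
    · intro x
      induction x using Submodule.Quotient.induction_on with
      | _ x =>
        obtain ⟨y, hy, hxy⟩ := hsup x
        exact ⟨⟨y, hy⟩, ((Submodule.Quotient.eq J).mpr hxy).symm⟩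
  let e := LinearEquiv.ofBijective j hj
  have : Module.Finite K (V ⧸ J) := Module.Finite.equiv e
  let l' : (V ⧸ J) →L[K] K := LinearMap.toContinuousLinearMap (l ∘ₗ e.symm.toLinearMap)
  refine ⟨l'.comp J.mkQL, fun c => ?_, fun x hx => ?_⟩
  · change l (e.symm (j c)) = l c
    rw [show e.symm (j c) = c from e.symm_apply_apply c]
  · change l (e.symm (J.mkQ x)) = 0
    rw [show J.mkQ x = 0 from (Submodule.Quotient.mk_eq_zero J).mpr hx, map_zero, map_zero]

namespace TriangularDecomposition

variable {K : Type w} [Field K] {R : Type u} [Ring R] [Algebra K R]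
  {T : TriangularDecomposition K R}

theorem mul_mul_induction {U V W : Submodule K R} {p : R → Prop}
    (hmul : ∀ u ∈ U, ∀ v ∈ V, ∀ w ∈ W, p (u * v * w)) (hadd : ∀ x y, p x → p y → p (x + y)) {r : R}
    (hr : r ∈ U * V * W) : p r := by
  induction hr using Submodule.mul_induction_on' with
  | mem_mul_mem x hx w hw =>
    induction hx using Submodule.mul_induction_on' with
    | mem_mul_mem u hu v hv => exact hmul u hu v hv w hw
    | add x _ y _ hx hy => rw [add_mul]; exact hadd _ _ hx hy
  | add x _ y _ hx hy => exact hadd _ _ hx hy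

end TriangularDecomposition

section Slices

variable {K : Type w} [NontriviallyNormedField K] [CharZero K] [CompleteSpace K]
  {𝓡 : Type u} [NormedRing 𝓡] [NormedAlgebra K 𝓡] [CompleteSpace 𝓡] [IsUltrametricDist 𝓡]

instance completeSpace_closureIn (R : Subalgebra K 𝓡) (S : Subalgebra K R) :
    CompleteSpace (closureIn R S) :=
  (Subalgebra.isClosed_topologicalClosure (S.map R.val)).completeSpace_coe

instance isUltrametricDist_closureIn (R : Subalgebra K 𝓡) (S : Subalgebra K R) :
    IsUltrametricDist (closureIn R S) :=
  IsUltrametricDist.subtype _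

namespace BanachTriangularDecomposition

open TriangularDecomposition

variable (D : BanachTriangularDecomposition K 𝓡)

/-- The left ideal of `𝓑` generated by `⨁_{n ≥ N} B_{-n}`. -/
def highB (N : ℕ) : Submodule D.B D.B :=
  Submodule.span D.B {b | ∃ k, N ≤ k ∧ b ∈ D.pieceB k}

variable {D}

theorem pieceB_mul {m n : ℕ} {x y : D.B} (hx : x ∈ D.pieceB m) (hy : y ∈ D.pieceB n) :
    x * y ∈ D.pieceB (m + n) := by
  obtain ⟨s, hs, hs', hsx⟩ := mem_closurePiece.mp hx
  obtain ⟨t, ht, ht', hty⟩ := mem_closurePiece.mp hy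
  have h := degB_mul_mem (T := D.T) ⟨hs, hs'⟩ ⟨ht, ht'⟩
  refine mem_closurePiece.mpr ⟨s * t, h.1, h.2, ?_⟩
  rw [Subalgebra.coe_mul, hsx, hty]
  rfl

/-- Multiplying the expansion of a coefficient by a generator of degree -k, with k ≥ N, shifts all
its degrees by k. -/
theorem exists_hasSum_highB {N : ℕ} {x : D.B} (hx : x ∈ D.highB N) :
    ∃ f : ℕ → D.B, (∀ n, f n ∈ D.pieceB n) ∧ (∀ n < N, f n = 0) ∧ HasSum f x := by
  have hx' : x ∈ Submodule.span D.B {b | ∃ k, N ≤ k ∧ b ∈ D.pieceB k} := hx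
  clear hx
  induction hx' using Submodule.closure_induction with
  | zero => exact ⟨0, fun _ => zero_mem _, fun _ _ => rfl, hasSum_zero⟩
  | add x y _ _ hx hy =>
    obtain ⟨f, hf, hf0, hfs⟩ := hx
    obtain ⟨g, hg, hg0, hgs⟩ := hy
    exact ⟨f + g, fun n => add_mem (hf n) (hg n), fun n hn => by simp [hf0 n hn, hg0 n hn],
      hfs.add hgs⟩
  | smul_mem a b hb =>
    obtain ⟨k, hk, hb⟩ := hb
    obtain ⟨f, hf, hfs⟩ := D.isExpanding_B.exists_hasSum a
    have hinj : Function.Injective fun n : ℕ => n + k := add_left_injective k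
    refine ⟨Function.extend (fun n : ℕ => n + k) (fun n => f n * b) 0, fun n => ?_,
      fun n hn => Function.extend_apply' _ _ _ ?_, (hasSum_extend_zero hinj).mpr (hfs.mul_right b)⟩
    · by_cases h : ∃ m, m + k = n
      · obtain ⟨m, rfl⟩ := h
        rw [hinj.extend_apply]
        exact pieceB_mul (hf m) hb
      · rw [Function.extend_apply' _ _ _ h]
        exact zero_mem _
    · rintro ⟨m, rfl⟩
      omega

theorem eq_zero_of_hasSum_pieceB {f : ℕ → D.B} (hf : ∀ n, f n ∈ D.pieceB n) (h : HasSum f 0) :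
    f = 0 :=
  eq_zero_of_hasSum_eigenvectors (D := -D.adB) (w := 0)
    (continuous_adClosure _ _).neg
    (fun n => by rw [zero_add]; exact D.isExpanding_B.apply n _ (hf n)) h

/-- `⨁_{n < N} B_{-n}`, as a subspace of `𝓑`. -/
def lowBClosure (D : BanachTriangularDecomposition K 𝓡) (N : ℕ) : Submodule K D.B :=
  ((D.T.lowB N).map D.R.val.toLinearMap).comap D.B.val.toLinearMap

theorem exists_hasSum_lowBClosure {N : ℕ} {x : D.B} (hx : x ∈ D.lowBClosure N) :
    ∃ f : ℕ → D.B, (∀ n, f n ∈ D.pieceB n) ∧ (∀ n, N ≤ n → f n = 0) ∧ HasSum f x := by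
  obtain ⟨s, hs, hsx⟩ := hx
  replace hsx : (s : 𝓡) = x := hsx
  have key : ∀ s ∈ ⨆ n : Fin N, D.T.degB n, ∃ (f : ℕ → D.B) (y : D.B), (y : 𝓡) = s ∧
      (∀ n, f n ∈ D.pieceB n) ∧ (∀ n, N ≤ n → f n = 0) ∧ HasSum f y := by
    intro s hs
    induction hs using Submodule.iSup_induction' with
    | mem n s hs' =>
      refine ⟨Pi.single (n : ℕ) ⟨s, coe_mem_closureIn hs'.1⟩, ⟨s, coe_mem_closureIn hs'.1⟩, rfl,
        fun m => ?_, fun m hm => ?_, hasSum_pi_single _ _⟩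
      · rcases eq_or_ne m n with rfl | hne
        · rw [Pi.single_eq_same]
          exact mem_closurePiece.mpr ⟨s, hs'.1, hs'.2, rfl⟩
        · rw [Pi.single_eq_of_ne hne]
          exact zero_mem _
      · have := n.2
        exact Pi.single_eq_of_ne (by omega) _
    | zero => exact ⟨0, 0, rfl, fun _ => zero_mem _, fun _ _ => rfl, hasSum_zero⟩
    | add s t _ _ hx hy =>
      obtain ⟨f, y, hy', hf, hf0, hfs⟩ := hx
      obtain ⟨g, z, hz', hg, hg0, hgs⟩ := hy
      exact ⟨f + g, y + z, by rw [Subalgebra.coe_add, Subalgebra.coe_add, hy', hz'],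
        fun n => add_mem (hf n) (hg n), fun n hn => by simp [hf0 n hn, hg0 n hn], hfs.add hgs⟩
  obtain ⟨f, y, hy, hf, hf0, hfs⟩ := key s hs
  refine ⟨f, hf, hf0, ?_⟩
  rwa [show y = x from Subtype.ext (hy.trans hsx)] at hfs

/-- Such an x has one expansion supported below N and one supported from N on; uniqueness leaves
nothing. -/
theorem lowBClosure_disjoint {N : ℕ} {x : D.B} (hx : x ∈ D.lowBClosure N) (hx' : x ∈ D.highB N) :
    x = 0 := by
  obtain ⟨f, hf, hf0, hfs⟩ := exists_hasSum_lowBClosure hx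
  obtain ⟨g, hg, hg0, hgs⟩ := exists_hasSum_highB hx'
  have h := hfs.sub hgs
  rw [sub_self] at h
  have hz := eq_zero_of_hasSum_pieceB (f := fun n => f n - g n)
    (fun n => sub_mem (hf n) (hg n)) h
  have : f = 0 := by
    funext n
    have hn := congrFun hz n
    rcases lt_or_ge n N with h | h
    · simpa [hg0 n h] using hn
    · exact hf0 n h
  rw [this] at hfs
  exact hfs.unique hasSum_zero

theorem pieceB_le_lowBClosure {n N : ℕ} (h : n < N) : D.pieceB n ≤ D.lowBClosure N := by
  intro x hx
  obtain ⟨s, hs, hs', hsx⟩ := mem_closurePiece.mp hx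
  exact ⟨s, le_iSup (fun n : Fin N => D.T.degB n) ⟨n, h⟩ ⟨hs, hs'⟩, hsx⟩

variable [IsNoetherianRing D.B]

/-- Cut the expansion of x at N. The tail converges inside the left ideal, which is closed because 𝓑
is noetherian. -/
theorem exists_lowBClosure_sub_mem (N : ℕ) (x : D.B) :
    ∃ y ∈ D.lowBClosure N, x - y ∈ D.highB N := by
  obtain ⟨f, hf, hfs⟩ := D.isExpanding_B.exists_hasSum x
  refine ⟨∑ n ∈ Finset.range N, f n, sum_mem fun n hn =>
    pieceB_le_lowBClosure (Finset.mem_range.mp hn) (hf n), ?_⟩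
  have h := (hasSum_nat_add_iff' N).mpr hfs
  have hc : IsClosed (D.highB N : Set D.B) := isClosed_submodule_of_isNoetherian (K := K) _
  exact hc.mem_of_tendsto h (Filter.Eventually.of_forall fun s => sum_mem fun n _ =>
    Submodule.subset_span ⟨n + N, Nat.le_add_left _ _, hf _⟩)

theorem Bge_mem_highB {N : ℕ} {b : D.R} (hb : b ∈ D.T.Bge N) :
    (⟨b, coe_mem_closureIn (Bge_le_B N hb)⟩ : D.B) ∈ D.highB N := by
  have key : ∀ b ∈ D.T.Bge N, ∃ y ∈ D.highB N, (y : 𝓡) = b := by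
    intro b hb
    have : D.T.Bge N ≤ (((D.highB N).restrictScalars K).map D.B.val.toLinearMap).comap
        D.R.val.toLinearMap :=
      iSup₂_le fun k hk b hb => ⟨⟨b, coe_mem_closureIn hb.1⟩,
        Submodule.subset_span ⟨k, hk, mem_closurePiece.mpr ⟨b, hb.1, hb.2, rfl⟩⟩, rfl⟩
    exact this hb
  obtain ⟨y, hy, hyb⟩ := key b hb
  rwa [show (⟨(b : 𝓡), coe_mem_closureIn (Bge_le_B N hb)⟩ : D.B) = y from Subtype.ext hyb.symm]

/-- Functionals on `⨁_{n < N} B_{-n}` extend by zero to continuous functionals on `𝓑`. -/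
theorem exists_functional_B (N : ℕ) (l : D.T.lowB N →ₗ[K] K) :
    ∃ β : D.B →L[K] K,
      (∀ (b : D.R) (hb : b ∈ D.T.lowB N), β ⟨b, coe_mem_closureIn (lowB_le N hb)⟩ = l ⟨b, hb⟩) ∧
      ∀ (b : D.R) (hb : b ∈ D.T.Bge N), β ⟨b, coe_mem_closureIn (Bge_le_B N hb)⟩ = 0 := by
  let j : D.T.lowB N →ₗ[K] D.lowBClosure N :=
    { toFun := fun b => ⟨⟨b, coe_mem_closureIn (lowB_le N b.2)⟩, ⟨b, b.2, rfl⟩⟩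
      map_add' := fun _ _ => rfl
      map_smul' := fun _ _ => rfl }
  have hj : Function.Bijective j := by
    constructor
    · intro b b' h
      exact Subtype.ext (Subtype.ext (congrArg (fun x : D.lowBClosure N => ((x : D.B) : 𝓡)) h))
    · rintro ⟨x, s, hs, hsx⟩
      exact ⟨⟨s, hs⟩, Subtype.ext (Subtype.ext hsx)⟩
  let e := LinearEquiv.ofBijective j hj
  have : Module.Finite K (D.T.lowB N) := Module.Finite.iff_fg.mpr (lowB_fg N)
  have : Module.Finite K (D.lowBClosure N) := Module.Finite.equiv e
  have hJ : IsClosed (((D.highB N).restrictScalars K : Submodule K D.B) : Set D.B) :=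
    isClosed_submodule_of_isNoetherian (K := K) (D.highB N)
  obtain ⟨β, hβ, hβ0⟩ := exists_functional_of_isCompl (C := D.lowBClosure N) hJ
    (fun x hx hx' => lowBClosure_disjoint hx hx') (exists_lowBClosure_sub_mem N)
    (l ∘ₗ e.symm.toLinearMap)
  refine ⟨β, fun b hb => ?_, fun b hb => hβ0 _ (Bge_mem_highB hb)⟩
  have h := hβ (j ⟨b, hb⟩)
  change β _ = l (e.symm (j ⟨b, hb⟩)) at h
  rw [show e.symm (j ⟨b, hb⟩) = ⟨b, hb⟩ from e.symm_apply_apply _] at h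
  exact h

omit [IsNoetherianRing D.B] in
/-- The slice map `a h b ↦ φ(h) β(b) a`. -/
theorem exists_slice (φ : D.T.H →ₗ[K] K) (β : D.B →L[K] K) :
    ∃ S : 𝓡 →L[K] D.A, ∀ (a : D.A) (h : D.T.H) (b : D.B),
      S ((a : 𝓡) * (h : D.R) * b) = (φ h * β b) • a := by
  obtain ⟨e, he⟩ := D.decomposition
  let i := D.T.H.equivMapOfInjective D.R.val Subtype.val_injective
  have : Module.Finite K D.T.H := finite_H
  have : Module.Finite K (D.T.H.map D.R.val) := Module.Finite.equiv i.toLinearEquiv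
  let φ' : (D.T.H.map D.R.val) →L[K] K :=
    LinearMap.toContinuousLinearMap (φ ∘ₗ i.symm.toLinearEquiv.toLinearMap)
  obtain ⟨S, hS⟩ := exists_slice_completedTensor (U := D.A) φ' β
  refine ⟨S.comp (e.symm : 𝓡 →L[K] _), fun a h b => ?_⟩
  have h1 := he a (i h) b
  have h2 : ((i h : D.T.H.map D.R.val) : 𝓡) = (h : D.R) := rfl
  rw [h2] at h1
  rw [← h1]
  change S (e.symm (e _)) = _
  rw [e.symm_apply_apply, hS]
  change (φ (i.symm (i h)) * β b) • a = _
  rw [i.symm_apply_apply]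

/-- The maps read off the coefficient in 𝓐 of each h_i b_k, for bases of H and of ⨁_{n < N} B_{-n}.
The functionals on 𝓑 vanish on B_{≥ N}, so what they miss in R is exactly R B_{≥ N}. -/
theorem exists_slices (N : ℕ) :
    ∃ (ι : Type) (_ : Fintype ι) (g : ι → D.R) (S : ι → 𝓡 →L[K] D.A),
      (∀ i, g i ∈ D.T.SH * D.T.lowB N) ∧
      (∀ r : D.R, ∃ l ∈ D.T.leftIdeal N, (r : 𝓡) = ∑ i, (S i r : 𝓡) * g i + l) ∧
      ∀ r ∈ D.T.leftIdeal N, ∀ i, S i (r : 𝓡) = 0 := by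
  have : Module.Finite K (D.T.lowB N) := Module.Finite.iff_fg.mpr (lowB_fg N)
  have : Module.Finite K D.T.H := finite_H
  let bH := Module.finBasis K D.T.H
  let bB := Module.finBasis K (D.T.lowB N)
  choose β hβ hβ0 using fun k => exists_functional_B N (bB.coord k)
  choose S hS using fun ik : Fin _ × Fin _ => exists_slice (bH.coord ik.1) (β ik.2)
  refine ⟨_, inferInstance, fun ik => bH ik.1 * bB ik.2, S,
    fun ik => Submodule.mul_mem_mul (bH ik.1).2 (bB ik.2).2, fun r => ?_, fun r hr ik => ?_⟩
  · have hr : r ∈ D.T.SA * D.T.SH * D.T.SB := by rw [A_mul_H_mul_B]; trivial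
    refine mul_mul_induction (p := fun r : D.R => ∃ l ∈ D.T.leftIdeal N, (r : 𝓡) =
      ∑ ik : Fin _ × Fin _, (S ik r : 𝓡) * ((bH ik.1 * bB ik.2 : D.R) : 𝓡) + (l : 𝓡)) ?_ ?_ hr
    · intro a ha h hh b hb
      rw [← lowB_sup_Bge N] at hb
      obtain ⟨b₁, hb₁, b₂, hb₂, rfl⟩ := Submodule.mem_sup.mp hb
      refine ⟨a * h * b₂, Submodule.smul_mem _ _ (Submodule.subset_span hb₂), ?_⟩
      have hval : ∀ ik : Fin _ × Fin _, (S ik ((a * h * (b₁ + b₂) : D.R) : 𝓡) : 𝓡) =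
          (bH.repr ⟨h, hh⟩ ik.1 * bB.repr ⟨b₁, hb₁⟩ ik.2) • (a : 𝓡) := by
        intro ik
        have h1 := hS ik ⟨a, coe_mem_closureIn ha⟩ ⟨h, hh⟩
          (⟨b₁, coe_mem_closureIn (lowB_le N hb₁)⟩ + ⟨b₂, coe_mem_closureIn (Bge_le_B N hb₂)⟩)
        rw [map_add, hβ _ b₁ hb₁, hβ0 _ b₂ hb₂, add_zero] at h1
        exact congrArg Subtype.val h1
      have hsum : h * b₁ = ∑ ik : Fin _ × Fin _,
          (bH.repr ⟨h, hh⟩ ik.1 * bB.repr ⟨b₁, hb₁⟩ ik.2) • (bH ik.1 * bB ik.2 : D.R) := by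
        have e1 : h = ∑ i, bH.repr ⟨h, hh⟩ i • (bH i : D.R) := by
          have := congrArg Subtype.val (bH.sum_repr ⟨h, hh⟩)
          rw [AddSubmonoidClass.coe_finsetSum] at this
          exact this.symm
        have e2 : b₁ = ∑ i, bB.repr ⟨b₁, hb₁⟩ i • (bB i : D.R) := by
          have := congrArg Subtype.val (bB.sum_repr ⟨b₁, hb₁⟩)
          rw [AddSubmonoidClass.coe_finsetSum] at this
          exact this.symm
        conv_lhs => rw [e1, e2]
        rw [Finset.sum_mul_sum, Fintype.sum_prod_type]
        simp_rw [smul_mul_smul_comm]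
      have hfin : ∑ ik : Fin _ × Fin _, (S ik ((a * h * (b₁ + b₂) : D.R) : 𝓡) : 𝓡) *
          ((bH ik.1 * bB ik.2 : D.R) : 𝓡) = ((a * (h * b₁) : D.R) : 𝓡) := by
        change _ = D.R.val (a * (h * b₁))
        rw [hsum, map_mul, map_sum, Finset.mul_sum]
        refine Finset.sum_congr rfl fun ik _ => ?_
        rw [hval, map_smul, smul_mul_assoc, mul_smul_comm]
        rfl
      rw [hfin, ← Subalgebra.coe_add]
      congr 1
      noncomm_ring
    · rintro x y ⟨l, hl, hx⟩ ⟨l', hl', hy⟩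
      refine ⟨l + l', add_mem hl hl', ?_⟩
      rw [Subalgebra.coe_add, Subalgebra.coe_add]
      simp only [map_add, Subalgebra.coe_add, add_mul, Finset.sum_add_distrib]
      nth_rewrite 1 [hx, hy]
      abel
  · have hr' : r ∈ D.T.SA * D.T.SH * D.T.Bge N := leftIdeal_eq (T := D.T) N ▸ hr
    refine mul_mul_induction (p := fun r : D.R => S ik (r : 𝓡) = 0) ?_ ?_ hr'
    · intro a ha h hh b hb
      have h1 := hS ik ⟨a, coe_mem_closureIn ha⟩ ⟨h, hh⟩ ⟨b, coe_mem_closureIn (Bge_le_B N hb)⟩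
      rw [hβ0 _ b hb, mul_zero, zero_smul] at h1
      exact h1
    · intro x y hx hy
      rw [Subalgebra.coe_add, map_add, hx, hy, add_zero]

/-- The left ideal of `𝓡` generated by `⨁_{n ≥ N} B_{-n}`. -/
def highIdeal (D : BanachTriangularDecomposition K 𝓡) (N : ℕ) : Submodule 𝓡 𝓡 :=
  Submodule.span 𝓡 (Subtype.val '' (D.T.Bge N : Set D.R))

omit [IsNoetherianRing D.B] in
theorem coe_mem_highIdeal {N : ℕ} {l : D.R} (hl : l ∈ D.T.leftIdeal N) : (l : 𝓡) ∈ D.highIdeal N := by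
  have hl' : l ∈ Submodule.span D.R (D.T.Bge N : Set D.R) := hl
  clear hl
  induction hl' using Submodule.closure_induction with
  | zero => exact zero_mem _
  | add x y _ _ hx hy => exact add_mem hx hy
  | smul_mem r b hb => exact Submodule.smul_mem _ _ (Submodule.subset_span ⟨b, hb, rfl⟩)

/-- By density and continuity the slices vanish on all of 𝓡 B_{≥ N}, and an element of R with
vanishing slices lies in R B_{≥ N}. -/
theorem mem_leftIdeal_of_coe_mem_highIdeal {N : ℕ} {r : D.R} (hr : (r : 𝓡) ∈ D.highIdeal N) :
    r ∈ D.T.leftIdeal N := by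
  obtain ⟨ι, _, g, S, -, hS, hS0⟩ := exists_slices (D := D) N
  have hzero : ∀ x ∈ D.highIdeal N, ∀ i, S i x = 0 := by
    intro x hx i
    have hx' : x ∈ Submodule.span 𝓡 (Subtype.val '' (D.T.Bge N : Set D.R)) := hx
    clear hx
    induction hx' using Submodule.closure_induction with
    | zero => exact map_zero _
    | add x y _ _ hx hy => rw [map_add, hx, hy, add_zero]
    | smul_mem x b hb =>
      obtain ⟨b, hb, rfl⟩ := hb
      have hc : IsClosed {x : 𝓡 | S i (x * b) = 0} :=
        isClosed_eq ((S i).continuous.comp (continuous_mul_const _)) continuous_const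
      have : (Set.univ : Set 𝓡) ⊆ {x : 𝓡 | S i (x * b) = 0} := by
        rw [← D.dense.closure_eq]
        refine closure_minimal (fun y hy => ?_) hc
        exact hS0 (⟨y, hy⟩ * b) (Submodule.smul_mem _ _ (Submodule.subset_span hb)) i
      exact this (Set.mem_univ x)
  obtain ⟨l, hl, hrl⟩ := hS r
  have : r = l := by
    refine Subtype.ext ?_
    rw [hrl]
    simp [hzero _ hr]
  exact this ▸ hl

/-- The expansion by slices holds on R; it extends to 𝓡 by density, because the left ideal is closed
in the noetherian algebra 𝓡. -/
theorem exists_sub_mem_highIdeal [IsNoetherianRing 𝓡] (N : ℕ) (x : 𝓡) :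
    ∃ (ι : Type) (_ : Fintype ι) (g : ι → D.R) (a : ι → D.A),
      (∀ i, g i ∈ D.T.SH * D.T.lowB N) ∧ x - ∑ i, (a i : 𝓡) * g i ∈ D.highIdeal N := by
  obtain ⟨ι, hι, g, S, hg, hS, hS0⟩ := exists_slices (D := D) N
  refine ⟨ι, hι, g, fun i => S i x, hg, ?_⟩
  have hc : IsClosed (D.highIdeal N : Set 𝓡) := isClosed_submodule_of_isNoetherian (K := K) _
  have hcont : Continuous fun x : 𝓡 => x - ∑ i, (S i x : 𝓡) * g i :=
    continuous_id.sub (continuous_finsetSum _ fun i _ =>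
      (continuous_subtype_val.comp (S i).continuous).mul continuous_const)
  have : (Set.univ : Set 𝓡) ⊆ {x : 𝓡 | x - ∑ i, (S i x : 𝓡) * g i ∈ D.highIdeal N} := by
    rw [← D.dense.closure_eq]
    refine closure_minimal (fun y hy => ?_) (hc.preimage hcont)
    obtain ⟨l, hl, hyl⟩ := hS ⟨y, hy⟩
    have h1 : y - ∑ i, (S i y : 𝓡) * g i = l := by
      rw [sub_eq_iff_eq_add']
      exact hyl
    change y - ∑ i, (S i y : 𝓡) * g i ∈ D.highIdeal N
    rw [h1]
    exact coe_mem_highIdeal hl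
  exact this (Set.mem_univ x)

end BanachTriangularDecomposition

end Slices

/-! ### The modules of `Ô` -/

theorem exists_forall_sub_natCast_ne {K : Type*} [Field K] [CharZero K] (F : Finset K) (μ : K) :
    ∃ N : ℕ, ∀ k : ℕ, N ≤ k → ∀ z ∈ F, ∀ n : ℕ, μ - k ≠ z + n := by
  rw [← Filter.eventually_atTop, Filter.eventually_all_finset]
  intro z _
  rw [Filter.eventually_atTop]
  by_cases h : ∃ k n : ℕ, μ - k = z + n
  · obtain ⟨k, n, h⟩ := h
    refine ⟨k + n + 1, fun k' hk' n' h' => ?_⟩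
    have h2 : ((k' + n' : ℕ) : K) = ((k + n : ℕ) : K) := by
      push_cast
      linear_combination h - h'
    have := Nat.cast_injective h2
    omega
  · exact ⟨0, fun k _ n hn => h ⟨k, n, hn⟩⟩

theorem map_mem_ws {K M N : Type*} [Field K] [AddCommGroup M] [Module K M]
    [AddCommGroup N] [Module K N] {D : Module.End K M} {D' : Module.End K N} (f : M →ₗ[K] N)
    (h : ∀ x, f (D x) = D' (f x)) {m : M} (hm : m ∈ ws D) : f m ∈ ws D' := by
  unfold ws at hm
  induction hm using Submodule.iSup_induction' with
  | mem a m hm => exact Submodule.mem_iSup_of_mem a (map_mem_maxGenEigenspace f h hm)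
  | zero => rw [map_zero]; exact zero_mem _
  | add m m' _ _ h h' => rw [map_add]; exact add_mem h h'

section HatModules

variable {K : Type w} [NontriviallyNormedField K] [CharZero K] [CompleteSpace K]
  {𝓡 : Type u} [NormedRing 𝓡] [NormedAlgebra K 𝓡] [CompleteSpace 𝓡] [IsUltrametricDist 𝓡]

namespace BanachTriangularDecomposition

open TriangularDecomposition

variable {D : BanachTriangularDecomposition K 𝓡}
  {M : Type u} [AddCommGroup M] [Module 𝓡 M] [Module K M] [IsScalarTower K 𝓡 M]

/-- Membership in the category `Ô`, without reference to the topology. -/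
structure IsOHat (D : BanachTriangularDecomposition K 𝓡) (M : Type u) [AddCommGroup M]
    [Module 𝓡 M] [Module K M] [IsScalarTower K 𝓡 M] : Prop where
  finite : Module.Finite 𝓡 M
  finite_A : Module.Finite D.A M
  span_weightVectors : Submodule.span D.A (weightVectors (act K D.del M)) = ⊤

theorem act_smul (a : D.A) (m : M) :
    act K D.del M (a • m) = D.adA a • m + a • act K D.del M m := by
  change D.del • (a : 𝓡) • m = ((D.T.del : 𝓡) * a - a * (D.T.del : 𝓡)) • m + (a : 𝓡) • D.del • m
  rw [sub_smul, mul_smul, mul_smul]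
  exact (sub_add_cancel _ _).symm

theorem mem_pieceA {n : ℕ} {a : D.A} (ha : a ∈ D.pieceA n) : ∃ s ∈ D.T.degA n, (s : 𝓡) = a := by
  obtain ⟨s, h1, h2, h3⟩ := mem_closurePiece.mp ha
  exact ⟨s, ⟨h1, h2⟩, h3⟩

variable [IsNoetherianRing D.A]

theorem isModuleTopology_of_closure [Module.Finite 𝓡 M] [Module.Finite D.A M] [IsNoetherianRing 𝓡]
    [TopologicalSpace M] [h : IsModuleTopology D.A M] : IsModuleTopology 𝓡 M :=
  ⟨h.eq_moduleTopology'.trans (moduleTopology_eq_of_finite (K := K) D.A)⟩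

variable [IsNoetherianRing 𝓡]

theorem continuous_act [Module.Finite 𝓡 M] [Module.Finite D.A M]
    [TopologicalSpace M] [IsModuleTopology D.A M] : Continuous (act K D.del M) := by
  have := isModuleTopology_of_closure (D := D) (M := M)
  have := IsModuleTopology.toContinuousSMul 𝓡 M
  exact continuous_const_smul D.del

theorem IsOHat.exists_weight_generators (hM : D.IsOHat M) :
    ∃ S : Finset M, (S : Set M) ⊆ weightVectors (act K D.del M) ∧
      Submodule.span D.A (S : Set M) = ⊤ := by
  have hfg : (Submodule.span D.A (weightVectors (act K D.del M))).FG :=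
    hM.span_weightVectors ▸ hM.finite_A.fg_top
  obtain ⟨S, hS, hS'⟩ := (Submodule.fg_span_iff_fg_span_finset_subset _).mp hfg
  exact ⟨S, hS, hS'.symm.trans hM.span_weightVectors⟩

theorem IsOHat.wt_le_productWeightSpan (hM : D.IsOHat M) {S : Set M}
    (hS : S ⊆ weightVectors (act K D.del M)) (hspan : Submodule.span D.A S = ⊤) (μ : K) :
    D.T.wt M μ ≤ productWeightSpan D.pieceA (act K D.del M) S μ := by
  have := hM.finite
  have := hM.finite_A
  let _ : TopologicalSpace M := moduleTopology D.A M
  have : IsModuleTopology D.A M := ⟨rfl⟩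
  exact maxGenEigenspace_le_productWeightSpan (E := D.A) (M := M) continuous_act D.isExpanding_A
    act_smul hS hspan μ

/-- The components of x lie in N because N is stable under ∂. Their convergent sum stays in the
𝓐-span of the weight vectors of N, since that span is closed. -/
theorem IsOHat.mem_span_inter (hM : D.IsOHat M) {N : Submodule 𝓡 M} {x : M} (hx : x ∈ N) :
    x ∈ Submodule.span D.A ((N : Set M) ∩ weightVectors (act K D.del M)) := by
  have := hM.finite
  have := hM.finite_A
  let _ : TopologicalSpace M := moduleTopology D.A M
  have : IsModuleTopology D.A M := ⟨rfl⟩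
  have := IsModuleTopology.topologicalAddGroup D.A M
  have := IsModuleTopology.toContinuousSMul D.A M
  obtain ⟨g, hg, hgs⟩ := exists_hasSum_productWeightSpan (M := M) D.isExpanding_A
    (Set.Subset.refl (weightVectors (act K D.del M))) (v := x)
    (hM.span_weightVectors ▸ Submodule.mem_top)
  have hg' := fun μ => productWeightSpan_le D.isExpanding_A act_smul _ μ (hg μ)
  have hmem := mem_of_hasSum_weights (E := D.A) (M := M) continuous_act D.isExpanding_A
    act_smul hM.span_weightVectors (N := N.restrictScalars D.A)
    (fun y hy => N.smul_mem D.del hy) hg' hx hgs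
  have hc := isClosed_submodule_of_finite (K := K) (E := D.A)
    (Submodule.span D.A ((N : Set M) ∩ weightVectors (act K D.del M)))
  exact hc.mem_of_tendsto hgs (Filter.Eventually.of_forall fun s => sum_mem fun μ _ =>
    Submodule.subset_span ⟨hmem μ, μ, hg' μ⟩)

theorem IsOHat.submodule (hM : D.IsOHat M) (N : Submodule 𝓡 M) : D.IsOHat N where
  finite := by
    have := hM.finite
    have : IsNoetherian 𝓡 M := isNoetherian_of_isNoetherianRing_of_finite 𝓡 M
    infer_instance
  finite_A := by
    have := hM.finite_A
    have : IsNoetherian D.A M := isNoetherian_of_isNoetherianRing_of_finite D.A M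
    exact Module.Finite.of_injective (N.subtype.restrictScalars D.A) N.subtype_injective
  span_weightVectors := by
    refine Submodule.eq_top_iff'.mpr fun x => ?_
    let f : N →ₗ[D.A] M := N.subtype.restrictScalars D.A
    have hle : (N : Set M) ∩ weightVectors (act K D.del M) ⊆
        f '' weightVectors (act K D.del N) := by
      rintro y ⟨hyN, μ, hy⟩
      exact ⟨⟨y, hyN⟩, ⟨μ, mem_wt_of_injective (T := D.T) (N.subtype.restrictScalars D.R)
        N.subtype_injective hy⟩, rfl⟩
    have h1 := Submodule.span_mono hle (hM.mem_span_inter x.2)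
    rw [← Submodule.map_span] at h1
    obtain ⟨z, hz, hzx⟩ := h1
    rwa [show z = x from Subtype.ext hzx] at hz

theorem IsOHat.of_surjective {M' : Type u} [AddCommGroup M'] [Module 𝓡 M'] [Module K M']
    [IsScalarTower K 𝓡 M'] (hM : D.IsOHat M) (f : M →ₗ[𝓡] M') (hf : Function.Surjective f) :
    D.IsOHat M' where
  finite := by
    have := hM.finite
    exact Module.Finite.of_surjective f hf
  finite_A := by
    have := hM.finite_A
    exact Module.Finite.of_surjective (f.restrictScalars D.A) hf
  span_weightVectors := by
    have hr : (f.restrictScalars D.A).range = ⊤ := LinearMap.range_eq_top.mpr hf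
    rw [eq_top_iff, ← hr,
      LinearMap.range_eq_map, ← hM.span_weightVectors, Submodule.map_span]
    refine Submodule.span_mono ?_
    rintro _ ⟨m, ⟨μ, hm⟩, rfl⟩
    exact ⟨μ, map_mem_wt (T := D.T) (f.restrictScalars D.R) hm⟩

theorem IsOHat.of_injective {M' : Type u} [AddCommGroup M'] [Module 𝓡 M'] [Module K M']
    [IsScalarTower K 𝓡 M'] (hM : D.IsOHat M) (f : M' →ₗ[𝓡] M) (hf : Function.Injective f) :
    D.IsOHat M' :=
  (hM.submodule f.range).of_surjective (LinearEquiv.ofInjective f hf).symm.toLinearMap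
    (LinearEquiv.ofInjective f hf).symm.surjective

theorem IsOHat.pi {n : ℕ} {M : Fin n → Type u} [∀ i, AddCommGroup (M i)] [∀ i, Module 𝓡 (M i)]
    [∀ i, Module K (M i)] [∀ i, IsScalarTower K 𝓡 (M i)] (hM : ∀ i, D.IsOHat (M i)) :
    D.IsOHat (∀ i, M i) where
  finite := by
    have := fun i => (hM i).finite
    infer_instance
  finite_A := by
    have := fun i => (hM i).finite_A
    exact inferInstanceAs (Module.Finite D.A (∀ i, M i))
  span_weightVectors := by
    classical
    refine Submodule.eq_top_iff'.mpr fun x => ?_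
    have hx : x = ∑ i, LinearMap.single D.A M i (x i) := by
      simp [LinearMap.single_apply, Finset.univ_sum_single]
    rw [hx]
    refine sum_mem fun i _ => ?_
    have h1 : x i ∈ Submodule.span D.A (weightVectors (act K D.del (M i))) :=
      (hM i).span_weightVectors ▸ Submodule.mem_top
    have h2 := Submodule.mem_map_of_mem (f := LinearMap.single D.A M i) h1
    rw [Submodule.map_span] at h2
    refine Submodule.span_mono ?_ h2
    rintro _ ⟨m, ⟨μ, hm⟩, rfl⟩
    exact ⟨μ, map_mem_wt (T := D.T) (LinearMap.single D.R M i) hm⟩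

/-- The submodule `M^ws` over `R`. -/
def wsSub (D : BanachTriangularDecomposition K 𝓡) (M : Type u) [AddCommGroup M]
    [Module 𝓡 M] [Module K M] [IsScalarTower K 𝓡 M] : Submodule D.R M where
  carrier := ws (act K D.del M)
  add_mem' := add_mem
  zero_mem' := zero_mem _
  smul_mem' x _ hm := smul_mem_ws D.R D.T M x hm

theorem mem_wsSub_of_mem_wt {μ : K} {m : M} (hm : m ∈ D.T.wt M μ) : m ∈ D.wsSub M :=
  Submodule.mem_iSup_of_mem (p := fun c => (act K D.del M).maxGenEigenspace c) μ hm

/-- `M^ws` lies in `O`. -/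
theorem IsOHat.isO_wsSub (hM : D.IsOHat M) : D.T.IsO (D.wsSub M) := by
  classical
  obtain ⟨S, hS, hspan⟩ := hM.exists_weight_generators
  have hwt := hM.wt_le_productWeightSpan hS hspan
  have hSw : ∀ m ∈ S, ∃ μ, m ∈ D.T.wt M μ := fun m hm => hS hm
  choose! ω hω using hSw
  -- All weights of M lie in the finitely many sets ω(m) + ℕ for m in S, so elements of B of
  -- sufficiently negative degree send a given weight vector into a zero weight space.
  have hzero : ∀ μ : K, (∀ z ∈ S.image ω, ∀ n : ℕ, μ ≠ z + n) → ∀ v ∈ D.T.wt M μ, v = 0 := by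
    intro μ hμ v hv
    have hle : productWeightSpan D.pieceA (act K D.del M) S μ ≤ ⊥ := by
      refine Submodule.span_le.mpr ?_
      rintro _ ⟨n, w, a, m, -, hm, hmw, rfl, rfl⟩
      by_cases h0 : m = 0
      · rw [h0, smul_zero]; exact zero_mem _
      · refine absurd rfl (hμ w ?_ n)
        rw [eq_of_mem_maxGenEigenspace h0 hmw (hω m hm)]
        exact Finset.mem_image_of_mem ω hm
    exact (Submodule.mem_bot K).mp (hle (hwt μ hv))
  have hkilled : ∀ m ∈ ws (act K D.del M), ∃ N, ∀ k, N ≤ k → ∀ b ∈ D.T.degB k, b • m = 0 := by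
    intro m hm
    unfold ws at hm
    induction hm using Submodule.iSup_induction' with
    | mem μ m hm =>
      obtain ⟨N, hN⟩ := exists_forall_sub_natCast_ne (S.image ω) μ
      refine ⟨N, fun k hk b hb => hzero (μ - k) (hN k hk) _ ?_⟩
      have := smul_mem_wt (T := D.T) hb.2 hm
      rwa [show μ + ((-(k : ℤ) : ℤ) : K) = μ - k by push_cast; ring] at this
    | zero => exact ⟨0, fun k _ b _ => smul_zero b⟩
    | add x y _ _ hx hy =>
      obtain ⟨N, hN⟩ := hx
      obtain ⟨N', hN'⟩ := hy
      refine ⟨max N N', fun k hk b hb => ?_⟩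
      rw [smul_add, hN k ((le_max_left _ _).trans hk) b hb,
        hN' k ((le_max_right _ _).trans hk) b hb, add_zero]
  refine ⟨?_, fun m => ?_⟩
  · have hSsub : ∀ m : S, (m : M) ∈ D.wsSub M := fun m => mem_wsSub_of_mem_wt (hω m m.2)
    -- Weight spaces are spanned by products with homogeneous elements of A, which lie in R; no
    -- completion is needed to generate M^ws.
    have heq : D.wsSub M = Submodule.span D.R (S : Set M) := by
      refine le_antisymm ?_ (Submodule.span_le.mpr fun m hm => hSsub ⟨m, hm⟩)
      have hle : ws (act K D.del M) ≤ (Submodule.span D.R (S : Set M)).restrictScalars K := by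
        refine iSup_le fun μ => (hwt μ).trans (Submodule.span_le.mpr ?_)
        rintro _ ⟨n, w, a, m, ha, hm, -, -, rfl⟩
        obtain ⟨s, -, hs⟩ := mem_pieceA ha
        have : a • m = s • m := by
          change (a : 𝓡) • m = (s : 𝓡) • m
          rw [hs]
        rw [this]
        exact Submodule.smul_mem _ s (Submodule.subset_span hm)
      exact hle
    exact Module.Finite.iff_fg.mpr (heq ▸ ⟨S, rfl⟩)
  · obtain ⟨N, hN⟩ := hkilled m m.2
    exact ⟨N, mem_killed_iff.mpr fun k hk b hb => Subtype.ext (hN k hk b hb)⟩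

theorem IsOHat.span_wsSub (hM : D.IsOHat M) : Submodule.span 𝓡 (D.wsSub M : Set M) = ⊤ := by
  have h : Submodule.span D.A (weightVectors (act K D.del M)) ≤
      (Submodule.span 𝓡 (D.wsSub M : Set M)).restrictScalars D.A := by
    refine Submodule.span_le.mpr ?_
    rintro m ⟨μ, hm⟩
    exact Submodule.subset_span (mem_wsSub_of_mem_wt hm)
  rw [hM.span_weightVectors] at h
  exact eq_top_iff.mpr fun m _ => h Submodule.mem_top

/-! ### Modules generated by a module in `O` -/

section Generated

variable [IsNoetherianRing D.B] {N : Type u} [AddCommGroup N] [Module D.R N] [Module K N]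
  [IsScalarTower K D.R N]

theorem highIdeal_smul {k : ℕ} {x : M} (hx : ∀ b ∈ D.T.Bge k, b • x = 0) {y : 𝓡}
    (hy : y ∈ D.highIdeal k) : y • x = 0 := by
  have : D.highIdeal k ≤ LinearMap.ker (LinearMap.toSpanSingleton 𝓡 M x) := by
    refine Submodule.span_le.mpr ?_
    rintro _ ⟨b, hb, rfl⟩
    exact hx b hb
  exact this hy

/-- Given n, the left ideal 𝓡 B_{≥ k} kills j n for k large. Modulo this ideal an element of 𝓡 is a
finite sum of a · g with a in 𝓐 and g in R, and g can be moved inside j. -/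
theorem span_A_image (hN : D.T.IsO N) (j : N →ₗ[D.R] M)
    (hj : Submodule.span 𝓡 (Set.range j) = ⊤) {S : Set N} (hS : Submodule.span D.T.A S = ⊤) :
    Submodule.span D.A (j '' S) = ⊤ := by
  have h1 : ∀ n, j n ∈ Submodule.span D.A (j '' S) := by
    intro n
    have hn : n ∈ Submodule.span D.T.A S := hS ▸ Submodule.mem_top
    induction hn using Submodule.closure_induction with
    | zero => rw [map_zero]; exact zero_mem _
    | add x y _ _ hx hy => rw [map_add]; exact add_mem hx hy
    | smul_mem a s hs =>
      have : j (a • s) = (⟨(a : D.R), coe_mem_closureIn a.2⟩ : D.A) • j s := map_smul j (a : D.R) s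
      rw [this]
      exact Submodule.smul_mem _ _ (Submodule.subset_span ⟨s, hs, rfl⟩)
  refine Submodule.eq_top_iff'.mpr fun x => ?_
  have hx : x ∈ Submodule.span 𝓡 (Set.range j) := hj ▸ Submodule.mem_top
  induction hx using Submodule.closure_induction with
  | zero => exact zero_mem _
  | add x y _ _ hx hy => exact add_mem hx hy
  | smul_mem r m hm =>
    obtain ⟨n, rfl⟩ := hm
    obtain ⟨k, hk⟩ := hN.exists_killed n
    obtain ⟨ι, _, g, a, -, hr⟩ := exists_sub_mem_highIdeal (D := D) k r
    have h2 := highIdeal_smul (x := j n) (fun b hb => by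
      rw [← map_smul, hk b hb, map_zero]) hr
    rw [sub_smul, sub_eq_zero] at h2
    rw [h2, Finset.sum_smul]
    refine sum_mem fun i _ => ?_
    have : ((a i : 𝓡) * g i) • j n = a i • j (g i • n) := by
      rw [mul_smul, map_smul]
      rfl
    rw [this]
    exact Submodule.smul_mem _ _ (h1 _)

theorem isOHat_of_generated (hN : D.T.IsO N) (j : N →ₗ[D.R] M)
    (hj : Submodule.span 𝓡 (Set.range j) = ⊤) : D.IsOHat M := by
  classical
  obtain ⟨S, hS, hspan⟩ := hN.exists_weight_generators
  have h := span_A_image hN j hj hspan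
  refine ⟨?_, ⟨⟨S.image j, by rw [Finset.coe_image, h]⟩⟩, eq_top_iff.mpr ?_⟩
  · refine ⟨⟨S.image j, eq_top_iff.mpr fun x _ => ?_⟩⟩
    have h' : Submodule.span D.A (j '' S) ≤
        (Submodule.span 𝓡 (j '' S)).restrictScalars D.A := Submodule.span_le_restrictScalars _ _ _
    rw [Finset.coe_image]
    exact h' (h ▸ Submodule.mem_top)
  · rw [← h]
    refine Submodule.span_mono ?_
    rintro _ ⟨s, hs, rfl⟩
    obtain ⟨μ, hμ⟩ := hS hs
    exact ⟨μ, map_mem_wt (T := D.T) j hμ⟩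

/-- The weight spaces of M are spanned by products of homogeneous elements of A with images of
weight generators of N; all of these lie in the image of j. -/
theorem exists_of_mem_ws (hN : D.T.IsO N) (j : N →ₗ[D.R] M)
    (hj : Submodule.span 𝓡 (Set.range j) = ⊤) {x : M} (hx : x ∈ D.wsSub M) : ∃ n, j n = x := by
  obtain ⟨S, hS, hspan⟩ := hN.exists_weight_generators
  have h := span_A_image hN j hj hspan
  have hS' : j '' S ⊆ weightVectors (act K D.del M) := by
    rintro _ ⟨s, hs, rfl⟩
    obtain ⟨μ, hμ⟩ := hS hs
    exact ⟨μ, map_mem_wt (T := D.T) j hμ⟩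
  have hle : ws (act K D.del M) ≤ j.range.restrictScalars K := by
    refine iSup_le fun μ =>
      ((isOHat_of_generated hN j hj).wt_le_productWeightSpan hS' h μ).trans
        (Submodule.span_le.mpr ?_)
    rintro _ ⟨n, w, a, _, ha, ⟨s, -, rfl⟩, -, -, rfl⟩
    obtain ⟨t, -, ht⟩ := mem_pieceA ha
    refine ⟨t • s, ?_⟩
    rw [map_smul]
    change (t : 𝓡) • j s = (a : 𝓡) • j s
    rw [ht]
  exact hle hx

/-- The weight part of the 𝓡-module generated by j(S) is j(S) itself. Every vector of N is a sum of
weight vectors, so j q belongs to that weight part. -/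
theorem mem_of_map_mem_span [IsNoetherianRing D.R] (hN : D.T.IsO N) (j : N →ₗ[D.R] M)
    (hj : Function.Injective j) (S : Submodule D.R N) {q : N}
    (hq : j q ∈ Submodule.span 𝓡 (j '' S)) : q ∈ S := by
  let Y := Submodule.span 𝓡 (j '' S)
  let P : Submodule D.R N := (Y.restrictScalars D.R).comap j
  let jS : S →ₗ[D.R] Y :=
    { toFun := fun s => ⟨j s.1, Submodule.subset_span ⟨s, s.2, rfl⟩⟩
      map_add' := fun s t => Subtype.ext (map_add j s.1 t.1)
      map_smul' := fun r s => Subtype.ext (map_smul j r s.1) }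
  let jP : P →ₗ[D.R] Y :=
    { toFun := fun s => ⟨j s.1, s.2⟩
      map_add' := fun s t => Subtype.ext (map_add j s.1 t.1)
      map_smul' := fun r s => Subtype.ext (map_smul j r s.1) }
  have hspan : Submodule.span 𝓡 (Set.range jS) = ⊤ := by
    refine Submodule.map_injective_of_injective Y.subtype_injective ?_
    rw [Submodule.map_span, Submodule.map_top, Submodule.range_subtype]
    congr 1
    ext x
    constructor
    · rintro ⟨_, ⟨s, rfl⟩, rfl⟩
      exact ⟨s, s.2, rfl⟩
    · rintro ⟨s, hs, rfl⟩
      exact ⟨_, ⟨⟨s, hs⟩, rfl⟩, rfl⟩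
  have hPw : (⟨q, hq⟩ : P) ∈ ws (act K D.T.del P) := (hN.submodule P).ws_eq_top ▸ Submodule.mem_top
  have hYw : jP ⟨q, hq⟩ ∈ D.wsSub Y :=
    map_mem_ws (D' := act K D.del Y) (jP.restrictScalars K) (fun x => map_smul jP D.T.del x) hPw
  obtain ⟨s, hs⟩ := exists_of_mem_ws (hN.submodule S) jS hspan hYw
  have : (s : N) = q := hj (congrArg Subtype.val hs)
  exact this ▸ s.2

/-- `Q_N` embeds into an `𝓡`-module. -/
theorem exists_quotQ_embedding (D : BanachTriangularDecomposition K 𝓡) [IsNoetherianRing D.B]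
    (k : ℕ) : ∃ j : D.T.quotQ k →ₗ[D.R] 𝓡 ⧸ D.highIdeal k, Function.Injective j := by
  let v : D.R →ₗ[D.R] 𝓡 := ⟨⟨fun r => r, fun _ _ => rfl⟩, fun _ _ => rfl⟩
  let φ : D.R →ₗ[D.R] 𝓡 ⧸ D.highIdeal k := (D.highIdeal k).mkQ.restrictScalars D.R ∘ₗ v
  have hφ : D.T.leftIdeal k ≤ φ.ker := fun l hl =>
    (Submodule.Quotient.mk_eq_zero _).mpr (coe_mem_highIdeal hl)
  refine ⟨(D.T.leftIdeal k).liftQ φ hφ, ?_⟩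
  have h0 : φ.ker ≤ D.T.leftIdeal k := fun l hl =>
    mem_leftIdeal_of_coe_mem_highIdeal ((Submodule.Quotient.mk_eq_zero _).mp hl)
  exact LinearMap.ker_eq_bot.mp ((Submodule.ker_liftQ_eq_bot _ _ _ h0))

/-- Present N as a quotient of Q_k^n by a submodule, embed Q_k^n into (𝓡 / 𝓡 B_{≥ k})^n, and divide
by the 𝓡-module generated by the relations; by `mem_of_map_mem_span` this adds no new relations. -/
theorem exists_embedding [IsNoetherianRing D.R] (hN : D.T.IsO N) :
    ∃ (X : Type u) (_ : AddCommGroup X) (_ : Module 𝓡 X) (j : N →ₗ[D.R] X),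
      Function.Injective j := by
  have := hN.finite
  obtain ⟨n, s, hs⟩ := Module.Finite.exists_fin (R := D.R) (M := N)
  choose k₀ hk₀ using fun i => hN.exists_killed (s i)
  let k := Finset.univ.sup k₀
  have hk : ∀ i, s i ∈ D.T.killed N k := fun i =>
    killed_anti (Finset.le_sup (Finset.mem_univ i)) (hk₀ i)
  let f : (Fin n → D.T.quotQ k) →ₗ[D.R] N := ∑ i, quotLift (hk i) ∘ₗ LinearMap.proj i
  have hf : Function.Surjective f := by
    rw [← LinearMap.range_eq_top, eq_top_iff, ← hs, Submodule.span_le]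
    rintro _ ⟨i, rfl⟩
    refine ⟨Pi.single i (D.T.toQ k 1), ?_⟩
    rw [LinearMap.sum_apply, Finset.sum_eq_single i]
    · simp [quotLift_toQ]
    · intro i' _ hne
      simp [Pi.single_eq_of_ne hne]
    · simp
  obtain ⟨j, hj⟩ := exists_quotQ_embedding D k
  let J : (Fin n → D.T.quotQ k) →ₗ[D.R] (Fin n → 𝓡 ⧸ D.highIdeal k) := j.compLeft (Fin n)
  have hJ : Function.Injective J := fun x y h => funext fun i => hj (congrFun h i)
  have hQ : D.T.IsO (Fin n → D.T.quotQ k) := IsO.pi fun _ => isO_quotQ k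
  let Y : Submodule 𝓡 (Fin n → 𝓡 ⧸ D.highIdeal k) := Submodule.span 𝓡 (J '' f.ker)
  let φ : (Fin n → D.T.quotQ k) →ₗ[D.R] (Fin n → 𝓡 ⧸ D.highIdeal k) ⧸ Y :=
    Y.mkQ.restrictScalars D.R ∘ₗ J
  have hφ : f.ker ≤ φ.ker := fun q hq =>
    (Submodule.Quotient.mk_eq_zero _).mpr (Submodule.subset_span ⟨q, hq, rfl⟩)
  have hφ' : φ.ker ≤ f.ker := fun q hq =>
    mem_of_map_mem_span hQ J hJ f.ker ((Submodule.Quotient.mk_eq_zero _).mp hq)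
  refine ⟨_, inferInstance, inferInstance,
    f.ker.liftQ φ hφ ∘ₗ (f.quotKerEquivOfSurjective hf).symm.toLinearMap, ?_⟩
  have hinj : Function.Injective (f.ker.liftQ φ hφ) :=
    LinearMap.ker_eq_bot.mp (Submodule.ker_liftQ_eq_bot _ _ hφ hφ')
  exact hinj.comp (f.quotKerEquivOfSurjective hf).symm.injective

/-- An embedding of N into some 𝓡-module factors through 𝓡 ⊗_R N. -/
theorem btmul_one_injective [IsNoetherianRing D.R] (hN : D.T.IsO N) :
    Function.Injective fun n : N => btmul D.incl 1 n := by
  obtain ⟨X, _, _, j, hj⟩ := exists_embedding hN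
  intro n n' h
  let φ : BaseChange D.incl N →ₗ[𝓡] X :=
    baseChangeLift (f := D.incl) j.toAddMonoidHom fun r m => map_smul j r m
  have hφ : ∀ n, φ (btmul D.incl 1 n) = j n := fun n =>
    (baseChangeLift_btmul _ _ 1 n).trans (one_smul 𝓡 (j n))
  exact hj ((hφ n).symm.trans ((congrArg φ h).trans (hφ n')))

/-- The kernel of g is contained in the 𝓐-span of its weight vectors, and weight vectors of M come
from N, where g ∘ j has trivial kernel. -/
theorem injective_of_comp_injective (hN : D.T.IsO N) (j : N →ₗ[D.R] M)
    (hj : Submodule.span 𝓡 (Set.range j) = ⊤) {M' : Type u} [AddCommGroup M'] [Module 𝓡 M']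
    (g : M →ₗ[𝓡] M') (hg : ∀ n, g (j n) = 0 → n = 0) : Function.Injective g := by
  rw [← LinearMap.ker_eq_bot, eq_bot_iff]
  intro x hx
  have h := (isOHat_of_generated hN j hj).mem_span_inter hx
  have hle : Submodule.span D.A ((g.ker : Set M) ∩ weightVectors (act K D.del M)) ≤ ⊥ := by
    refine Submodule.span_le.mpr ?_
    rintro y ⟨hy, μ, hyμ⟩
    obtain ⟨n, rfl⟩ := exists_of_mem_ws hN j hj (mem_wsSub_of_mem_wt hyμ)
    have := hg n hy
    simp [this]
  exact hle h

end Generated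

end BanachTriangularDecomposition

end HatModules

/-! ### Full subcategories of `Mod(S)` closed under subquotients and finite products -/

section Subcategory

variable {S : Type u} [Ring S]

/-- Closure under submodules, quotients and finite products. -/
class IsSubquotientClosed (P : ObjectProperty (ModuleCat.{u} S)) : Prop where
  of_injective : ∀ {M N : ModuleCat.{u} S} (f : N →ₗ[S] M), Function.Injective f → P M → P N
  of_surjective : ∀ {M N : ModuleCat.{u} S} (f : M →ₗ[S] N), Function.Surjective f → P M → P N
  pi : ∀ (n : ℕ) (M : Fin n → ModuleCat.{u} S), (∀ i, P (M i)) → P (ModuleCat.of S (∀ i, M i))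

variable (P : ObjectProperty (ModuleCat.{u} S)) [hP : IsSubquotientClosed P]

instance isClosedUnderSubobjects_of_isSubquotientClosed : P.IsClosedUnderSubobjects where
  prop_of_mono f _ hY := hP.of_injective f.hom ((ModuleCat.mono_iff_injective f).mp inferInstance) hY

instance isClosedUnderQuotients_of_isSubquotientClosed : P.IsClosedUnderQuotients where
  prop_of_epi f _ hX := hP.of_surjective f.hom ((ModuleCat.epi_iff_surjective f).mp inferInstance) hX

instance containsZero_of_isSubquotientClosed : P.ContainsZero where
  exists_zero := by
    refine ⟨ModuleCat.of S (∀ i : Fin 0, (fun _ => ModuleCat.of S S : Fin 0 → ModuleCat.{u} S) i),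
      ModuleCat.isZero_of_subsingleton _, hP.pi 0 _ fun i => i.elim0⟩

instance isClosedUnderFiniteProducts_of_isSubquotientClosed : P.IsClosedUnderFiniteProducts where
  isClosedUnderLimitsOfShape J _ := ⟨by
    rintro X ⟨p⟩
    obtain ⟨n, ⟨e⟩⟩ := Finite.exists_equiv_fin J
    refine hP.of_injective (LinearMap.pi fun i : Fin n => (p.π.app ⟨e.symm i⟩).hom) ?_
      (hP.pi n (fun i => p.diag.obj ⟨e.symm i⟩) fun i => p.prop_diag_obj _)
    intro x y hxy
    -- Elements of X are maps S → X, so the limit property shows that the projections separate them;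
    -- X thus embeds into the explicit product.
    have h : ModuleCat.ofHom (LinearMap.toSpanSingleton S X x) =
        ModuleCat.ofHom (LinearMap.toSpanSingleton S X y) := by
      refine p.isLimit.hom_ext fun ⟨j⟩ => ?_
      obtain ⟨i, rfl⟩ := e.symm.surjective j
      have := congrFun hxy i
      simp only [LinearMap.pi_apply] at this
      refine ModuleCat.hom_ext (LinearMap.ext_ring ?_)
      simpa using this
    simpa using congrArg (fun f => f.hom 1) h⟩

theorem isFullAbelianSubcategory : IsFullAbelianSubcategory P := by
  have h1 := P.preservesKernels_ι
  have h2 := P.preservesCokernels_ι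
  exact ⟨⟨inferInstance, rfl⟩, P.ι.preservesFiniteLimits_of_preservesKernels,
    P.ι.preservesFiniteColimits_of_preservesCokernels⟩

variable {P}

theorem mono_iff_injective {X Y : P.FullSubcategory} (f : X ⟶ Y) :
    Mono f ↔ Function.Injective f.hom.hom := by
  have := P.preservesMonomorphisms_ι_of_isNormalEpiCategory
  rw [← ModuleCat.mono_iff_injective]
  exact ⟨fun h => P.ι.map_mono f, fun h => P.ι.mono_of_mono_map h⟩

theorem epi_iff_surjective {X Y : P.FullSubcategory} (f : X ⟶ Y) :
    Epi f ↔ Function.Surjective f.hom.hom := by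
  have := P.preservesEpimorphisms_ι_of_isNormalMonoCategory
  rw [← ModuleCat.epi_iff_surjective]
  exact ⟨fun h => P.ι.map_epi f, fun h => P.ι.epi_of_epi_map h⟩

theorem shortExact_of_injective_surjective {X Y Z : P.FullSubcategory} (i : X ⟶ Y) (q : Y ⟶ Z)
    (w : i ≫ q = 0) (hi : Function.Injective i.hom.hom) (hq : Function.Surjective q.hom.hom)
    (hiq : ∀ y, q.hom.hom y = 0 → ∃ x, i.hom.hom x = y) : (ShortComplex.mk i q w).ShortExact := by
  refine ShortExact.reflects_shortExact_of_faithful P.ι ?_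
  refine ModuleCat.shortComplex_shortExact _ ?_ hi hq
  intro y
  refine ⟨hiq y, ?_⟩
  rintro ⟨x, rfl⟩
  exact LinearMap.congr_fun (congrArg (fun f => f.hom.hom) w) x

/-- Subobjects of X formed in Mod(S) stay in the subcategory, so simplicity means the same in both.
-/
theorem simple_iff {X : P.FullSubcategory} : Simple X ↔ IsSimpleModule S X.obj := by
  rw [← simple_iff_isSimpleModule']
  constructor
  · intro h
    refine ⟨fun {Y} f hf => ?_⟩
    let Y' : P.FullSubcategory := ⟨Y, P.prop_of_mono f X.property⟩
    let f' : Y' ⟶ X := P.homMk f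
    have hf' : Mono f' := P.ι.mono_of_mono_map hf
    have h1 := h.mono_isIso_iff_nonzero f'
    have h2 : IsIso f' ↔ IsIso f := ⟨fun h => P.ι.map_isIso f', fun h =>
      have : IsIso (P.ι.map f') := h
      isIso_of_reflects_iso f' P.ι⟩
    rw [← h2, h1]
    exact not_congr ⟨fun h => congrArg (fun f => f.hom) h, fun h => ObjectProperty.hom_ext _ h⟩
  · intro h
    have := P.preservesMonomorphisms_ι_of_isNormalEpiCategory
    have : Simple (P.ι.obj X) := h
    exact P.ι.simple_of_simple_obj X

end Subcategory

/-! ### Transport of the structure of a highest weight category along an equivalence -/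

section Transport

universe v₁ v₂ u₁ u₂ l

variable {C : Type u₁} [Category.{v₁} C] [Abelian C] {C' : Type u₂} [Category.{v₂} C'] [Abelian C']
  (F : C ⥤ C') [F.IsEquivalence] {I : Type l}

theorem HasFiltration.map {Δ : I → C} {p : I → Prop} {X : C} (h : HasFiltration Δ p X) :
    HasFiltration (fun x => F.obj (Δ x)) p (F.obj X) := by
  induction h with
  | zero X h => exact .zero _ (F.map_isZero h)
  | extend E hE x hx e _ ih =>
    exact .extend (E.map F) (hE.map_of_exact F) x hx ⟨F.mapIso e.some⟩ ih

theorem IsSubquotient.of_map {S X : C} (h : IsSubquotient (F.obj S) (F.obj X)) :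
    IsSubquotient S X := by
  obtain ⟨Y, i, q, hi, hq⟩ := h
  let e := F.objObjPreimageIso Y
  refine ⟨F.objPreimage Y, F.preimage (e.hom ≫ i), F.preimage (e.hom ≫ q),
    F.mono_of_mono_map ?_, F.epi_of_epi_map ?_⟩
  · rw [F.map_preimage]; infer_instance
  · rw [F.map_preimage]; infer_instance

/-- The existence of simple objects and projective covers required of a highest weight category. -/
def HasStandardCovers (lt : I → I → Prop) (Δ : I → C) : Prop :=
  ∃ L P : I → C,
    (∀ x, Simple (L x)) ∧
    (∀ x y, Nonempty (L x ≅ L y) → x = y) ∧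
    (∀ S : C, Simple S → ∃ x, Nonempty (S ≅ L x)) ∧
    (∀ x, ∃ (N : C) (i : N ⟶ Δ x) (q : Δ x ⟶ L x) (w : i ≫ q = 0),
      (ShortComplex.mk i q w).ShortExact ∧ ∀ y, IsSubquotient (L y) N → lt y x) ∧
    (∀ x, Projective (P x) ∧
      (∃ f : P x ⟶ L x, Epi f ∧ ∀ (Y : C) (g : Y ⟶ P x), Epi (g ≫ f) → Epi g) ∧
      ∃ (N : C) (i : N ⟶ P x) (q : P x ⟶ Δ x) (w : i ≫ q = 0),
        (ShortComplex.mk i q w).ShortExact ∧ HasFiltration Δ (fun y => lt x y) N)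

/-- An equivalence is exact and preserves and reflects simplicity and projectivity; test objects of
the target are pulled back along essential surjectivity. -/
theorem HasStandardCovers.map {lt : I → I → Prop} {Δ : I → C} (h : HasStandardCovers lt Δ) :
    HasStandardCovers lt fun x => F.obj (Δ x) := by
  obtain ⟨L, P, h1, h2, h3, h4, h5⟩ := h
  refine ⟨fun x => F.obj (L x), fun x => F.obj (P x), fun x => ?_, fun x y => ?_, fun S hS => ?_,
    fun x => ?_, fun x => ⟨?_, ?_, ?_⟩⟩
  · have := h1 x
    exact simple_obj F (L x)
  · rintro ⟨e⟩
    exact h2 x y ⟨F.preimageIso e⟩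
  · let e := F.objObjPreimageIso S
    have h6 : Simple (F.obj (F.objPreimage S)) := Simple.of_iso e
    obtain ⟨x, ⟨e'⟩⟩ := h3 (F.objPreimage S) ((simple_obj_iff F _).mp h6)
    exact ⟨x, ⟨e.symm ≪≫ F.mapIso e'⟩⟩
  · obtain ⟨N, i, q, w, hs, hN⟩ := h4 x
    exact ⟨F.obj N, F.map i, F.map q, by rw [← F.map_comp, w, F.map_zero], hs.map_of_exact F,
      fun y hy => hN y (hy.of_map F)⟩
  · exact (F.asEquivalence.map_projective_iff (P x)).mpr (h5 x).1
  · obtain ⟨f, hf, hess⟩ := (h5 x).2.1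
    refine ⟨F.map f, inferInstance, fun Y g hg => ?_⟩
    let e := F.objObjPreimageIso Y
    have h6 : Epi (F.preimage (e.hom ≫ g) ≫ f) := F.epi_of_epi_map (by
      rw [F.map_comp, F.map_preimage, Category.assoc]
      infer_instance)
    have h7 := hess _ _ h6
    have h8 : Epi (F.map (F.preimage (e.hom ≫ g))) := inferInstance
    rw [F.map_preimage] at h8
    exact epi_of_epi e.hom g
  · obtain ⟨N, i, q, w, hs, hN⟩ := (h5 x).2.2
    exact ⟨F.obj N, F.map i, F.map q, by rw [← F.map_comp, w, F.map_zero], hs.map_of_exact F,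
      hN.map F⟩

end Transport

namespace TriangularDecomposition

/-! ### The category `O` -/

variable {K : Type w} [Field K] {R : Type u} [Ring R] [Algebra K R]
  {T : TriangularDecomposition K R}

theorem catO_of (M : Type u) [AddCommGroup M] [Module R M] [Module K M] [IsScalarTower K R M] :
    T.catO (ModuleCat.of R M) ↔ T.IsO M := by
  constructor
  · rintro ⟨h1, h2⟩
    refine ⟨h1, fun m => ?_⟩
    obtain ⟨n, hn⟩ := h2 m
    exact ⟨n + 1, mem_killed_iff.mpr fun k hk b hb => hn k hk b hb.1 hb.2⟩
  · rintro ⟨h1, h2⟩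
    refine ⟨h1, fun m => ?_⟩
    obtain ⟨N, hN⟩ := h2 m
    exact ⟨N, fun k hk b hb hb' => mem_killed_iff.mp hN k hk.le b ⟨hb, hb'⟩⟩

section CatO

open ModuleCat

theorem catO_iff {M : ModuleCat.{u} R} : T.catO M ↔ T.IsO M := catO_of M

theorem isO_of_catO {M : ModuleCat.{u} R} (h : T.catO M) : T.IsO M := catO_iff.mp h

variable [IsNoetherianRing R]

instance isSubquotientClosed_catO : IsSubquotientClosed T.catO where
  of_injective f hf hM := (catO_of _).mpr ((isO_of_catO hM).of_injective f hf)
  of_surjective f hf hM := (catO_of _).mpr ((isO_of_catO hM).of_surjective f hf)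
  pi _ M hM := (catO_of (∀ i, M i)).mpr (IsO.pi fun i => isO_of_catO (hM i))

/-- The object of `O` given by a module. -/
abbrev IsO.toCatO {M : Type u} [AddCommGroup M] [Module R M] [Module K M] [IsScalarTower K R M]
    (hM : T.IsO M) : T.catO.FullSubcategory :=
  ⟨ModuleCat.of R M, (catO_of M).mpr hM⟩

theorem catO_verma (W : T.Irr) : T.catO (T.verma W.rep) := catO_iff.mpr (isO_verma_rep W)

/-- The object `Δ(W)` of `O`. -/
abbrev vermaO (W : T.Irr) : T.catO.FullSubcategory := ⟨T.verma W.rep, catO_verma W⟩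

theorem VermaFiltration.hasFiltration {M : Type u} [AddCommGroup M] [Module R M] [Module K M]
    [IsScalarTower K R M] (hM : T.IsO M) {p : T.Irr → Prop} {N : Submodule R M}
    (h : VermaFiltration T M p N) :
    HasFiltration vermaO p
      (hM.submodule N).toCatO := by
  induction h with
  | bot =>
    refine .zero _ ((IsZero.iff_id_eq_zero _).mpr (ObjectProperty.hom_ext _ (ModuleCat.hom_ext ?_)))
    exact LinearMap.ext fun x => Subsingleton.elim (α := (⊥ : Submodule R M)) _ _
  | step N N' hle E hE f hf hker _ ih =>
    let i : (hM.submodule N').toCatO ⟶ (hM.submodule N).toCatO :=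
      T.catO.homMk (ModuleCat.ofHom (Submodule.inclusion hle))
    let q : (hM.submodule N).toCatO ⟶ vermaO E :=
      T.catO.homMk (ModuleCat.ofHom f)
    have w : i ≫ q = 0 := ObjectProperty.hom_ext _ (ModuleCat.hom_ext (LinearMap.ext fun x =>
      (hker (Submodule.inclusion hle x)).mpr x.2))
    exact .extend (ShortComplex.mk i q w)
      (shortExact_of_injective_surjective i q w (Submodule.inclusion_injective hle) hf
        fun y hy => ⟨⟨y, (hker y).mp hy⟩, rfl⟩) E hE ⟨Iso.refl _⟩ ih

theorem hasStandardCovers_catO [CharZero K] :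
    HasStandardCovers T.lt (vermaO (T := T)) := by
  choose N P f g hlift hf hess hg hfil using fun W : T.Irr => exists_projective_cover_filtration W
  have hP : ∀ W, T.IsO (P W) := fun W => (isO_quotQ (N W)).submodule (P W)
  refine ⟨fun W => (isO_simpleQuot W).toCatO, fun W => (hP W).toCatO, fun W => ?_, fun W E => ?_,
    fun S hS => ?_, fun W => ?_, fun W => ⟨⟨fun {E X} φ e he => ?_⟩, ?_, ?_⟩⟩
  · exact simple_iff.mpr (isSimpleModule_simpleQuot W)
  · rintro ⟨e⟩
    exact eq_of_simpleQuot_equiv (T.catO.ι.mapIso e).toLinearEquiv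
  · have := simple_iff.mp hS
    obtain ⟨W, ⟨e⟩⟩ := exists_equiv_simpleQuot (isO_of_catO S.property)
    exact ⟨W, ⟨T.catO.ι.preimageIso e.toModuleIso⟩⟩
  · let i : ((isO_verma_rep W).submodule (vermaRad W)).toCatO ⟶
        vermaO W :=
      T.catO.homMk (ModuleCat.ofHom (vermaRad W).subtype)
    let q : vermaO W ⟶
        (isO_simpleQuot W).toCatO := T.catO.homMk (ModuleCat.ofHom (vermaRad W).mkQ)
    have w : i ≫ q = 0 := ObjectProperty.hom_ext _ (ModuleCat.hom_ext (LinearMap.ext fun x =>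
      (Submodule.Quotient.mk_eq_zero _).mpr x.2))
    refine ⟨_, i, q, w, shortExact_of_injective_surjective i q w (vermaRad W).subtype_injective
      (vermaRad W).mkQ_surjective fun y hy => ⟨⟨y, (Submodule.Quotient.mk_eq_zero _).mp hy⟩, rfl⟩,
      fun E => ?_⟩
    rintro ⟨Y, j, r, hj, hr⟩
    exact lt_of_subquotient W j.hom.hom ((mono_iff_injective j).mp hj) r.hom.hom
      ((epi_iff_surjective r).mp hr)
  · obtain ⟨h, hh⟩ := hlift W _ _ (isO_of_catO E.property) e.hom.hom
      ((epi_iff_surjective e).mp he) φ.hom.hom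
    exact ⟨T.catO.homMk (ModuleCat.ofHom h), ObjectProperty.hom_ext _ (ModuleCat.hom_ext hh)⟩
  · let f' : (hP W).toCatO ⟶ (isO_simpleQuot W).toCatO := T.catO.homMk (ModuleCat.ofHom (f W))
    refine ⟨f', (epi_iff_surjective f').mpr (LinearMap.surjective_of_ne_zero (hf W)),
      fun Y k hk => (epi_iff_surjective k).mpr ?_⟩
    rw [← LinearMap.range_eq_top]
    refine hess W _ fun hbot => ?_
    have h1 := (epi_iff_surjective (k ≫ f')).mp hk
    have := IsSimpleModule.nontrivial R (simpleQuot W)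
    obtain ⟨x, hx⟩ := exists_ne (0 : simpleQuot W)
    obtain ⟨y, rfl⟩ := h1 x
    refine hx ((Submodule.mem_bot R).mp (hbot ▸ ?_))
    exact ⟨k.hom.hom y, ⟨y, rfl⟩, rfl⟩
  · let i : ((hP W).submodule (LinearMap.ker (g W))).toCatO ⟶ (hP W).toCatO :=
      T.catO.homMk (ModuleCat.ofHom (LinearMap.ker (g W)).subtype)
    let q : (hP W).toCatO ⟶ vermaO W :=
      T.catO.homMk (ModuleCat.ofHom (g W))
    have w : i ≫ q = 0 := ObjectProperty.hom_ext _ (ModuleCat.hom_ext (LinearMap.ext fun x => x.2))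
    exact ⟨_, i, q, w, shortExact_of_injective_surjective i q w (Submodule.subtype_injective _)
      (hg W) fun y hy => ⟨⟨y, hy⟩, rfl⟩, (hfil W).hasFiltration (hP W)⟩

end CatO

end TriangularDecomposition

/-! ### The category `Ô`: finite length, the equivalence with `O`, the highest weight structure -/

section HatCategory

variable {K : Type w} [NontriviallyNormedField K] [CharZero K] [CompleteSpace K]
  {𝓡 : Type u} [NormedRing 𝓡] [NormedAlgebra K 𝓡] [CompleteSpace 𝓡] [IsUltrametricDist 𝓡]
  [IsNoetherianRing 𝓡]

namespace BanachTriangularDecomposition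

open TriangularDecomposition

variable {D : BanachTriangularDecomposition K 𝓡} [IsNoetherianRing D.A]

section FiniteLength

variable {M : Type u} [AddCommGroup M] [Module 𝓡 M] [Module K M] [IsScalarTower K 𝓡 M]

theorem IsOHat.finite_wt (hM : D.IsOHat M) (μ : K) : Module.Finite K (D.T.wt M μ) := by
  have h1 := hM.isO_wsSub.finite_wt μ
  have h2 : D.T.wt M μ =
      (D.T.wt (D.wsSub M) μ).map ((D.wsSub M).subtype.restrictScalars K) := by
    refine le_antisymm (fun m hm => ?_) ?_
    · exact ⟨⟨m, mem_wsSub_of_mem_wt hm⟩,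
        mem_wt_of_injective (T := D.T) (D.wsSub M).subtype Subtype.val_injective hm, rfl⟩
    · rintro _ ⟨m, hm, rfl⟩
      exact map_mem_wt (T := D.T) (D.wsSub M).subtype hm
  rw [h2]
  infer_instance

/-- N ↦ N ∩ M^ws is strictly increasing because N lies in the 𝓐-span of its weight vectors, and M^ws
is artinian as an object of O. -/
theorem IsOHat.isArtinian (hM : D.IsOHat M) : IsArtinian 𝓡 M := by
  have h1 := hM.isO_wsSub.isArtinian
  let φ : Submodule 𝓡 M → Submodule D.R (D.wsSub M) := fun N =>
    (N.restrictScalars D.R).comap (D.wsSub M).subtype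
  have hle : ∀ N N', φ N ≤ φ N' → N ≤ N' := by
    intro N N' h x hx
    have h2 : Submodule.span D.A ((N : Set M) ∩ weightVectors (act K D.del M)) ≤
        N'.restrictScalars D.A := by
      refine Submodule.span_le.mpr ?_
      rintro y ⟨hy, μ, hyμ⟩
      exact h (show (⟨y, mem_wsSub_of_mem_wt hyμ⟩ : D.wsSub M) ∈ φ N from hy)
    exact h2 (hM.mem_span_inter hx)
  have hmono : Monotone φ := fun N N' h x hx => h hx
  have hφ : StrictMono φ := fun N N' h =>
    lt_of_le_not_ge (hmono h.le) fun h' => h.not_ge (hle _ _ h')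
  exact hφ.wellFoundedLT

theorem IsOHat.catO_wsSub (hM : D.IsOHat M) : D.T.catO (ModuleCat.of D.R (D.wsSub M)) :=
  (catO_of (D.wsSub M)).mpr hM.isO_wsSub

end FiniteLength

open ModuleCat

/-- A convergent sum of weight vectors lies in their 𝓐-span because this span is closed. Conversely,
expanding the coefficients in 𝓐 of a finite combination of weight vectors gives a convergent weight
expansion. The topologies of M over 𝓡 and over 𝓐 agree. -/
theorem catOHat_iff {M : ModuleCat.{u} 𝓡} : D.catOHat M ↔ D.IsOHat M := by
  constructor
  · rintro ⟨h1, h2, I, hI, hdec⟩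
    refine ⟨h1, h2, Submodule.eq_top_iff'.mpr fun x => ?_⟩
    obtain ⟨f, hf, hfs⟩ := hdec x
    let _ : TopologicalSpace M := canonicalTopology 𝓡 M
    have : IsModuleTopology D.A M := ⟨(moduleTopology_eq_of_finite (K := K) D.A).symm⟩
    have hc := isClosed_submodule_of_finite (K := K) (E := D.A)
      (Submodule.span D.A (weightVectors (act K D.del M)))
    exact hc.mem_of_tendsto hfs (Filter.Eventually.of_forall fun s => sum_mem fun μ _ =>
      Submodule.subset_span ⟨_, hf μ⟩)
  · intro hM
    have := hM.finite
    have := hM.finite_A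
    refine ⟨hM.finite, hM.finite_A, weights (act K D.del M), subset_rfl, fun v => ?_⟩
    let _ : TopologicalSpace M := canonicalTopology 𝓡 M
    have : IsModuleTopology D.A M := ⟨(moduleTopology_eq_of_finite (K := K) D.A).symm⟩
    have := IsModuleTopology.topologicalAddGroup D.A M
    have := IsModuleTopology.toContinuousSMul D.A M
    obtain ⟨g, hg, hgs⟩ := exists_hasSum_productWeightSpan (M := M) D.isExpanding_A
      (Set.Subset.refl (weightVectors (act K D.del M))) (v := v)
      (hM.span_weightVectors ▸ Submodule.mem_top)
    have hg' := fun μ => productWeightSpan_le D.isExpanding_A act_smul _ μ (hg μ)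
    refine ⟨fun c => g c, fun c => hg' c, (hasSum_subtype_iff_of_support_subset ?_).mpr hgs⟩
    intro μ hμ hbot
    exact hμ ((Submodule.mem_bot K).mp (hbot ▸ hg' μ))

instance isSubquotientClosed_catOHat : IsSubquotientClosed D.catOHat where
  of_injective f hf hM := catOHat_iff.mpr ((catOHat_iff.mp hM).of_injective f hf)
  of_surjective f hf hM := catOHat_iff.mpr ((catOHat_iff.mp hM).of_surjective f hf)
  pi _ _ hM := catOHat_iff.mpr
    ((IsOHat.pi fun i => catOHat_iff.mp (hM i)).of_surjective LinearMap.id Function.surjective_id)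

/-- The map `m ↦ 1 ⊗ m`. -/
def toExt (D : BanachTriangularDecomposition K 𝓡) (M : ModuleCat.{u} D.R) :
    M →ₗ[D.R] D.extFunctor.obj M where
  toFun := btmulOne D.incl
  map_add' := map_add _
  map_smul' r m := btmul_one_smul D.incl r m

omit [CompleteSpace K] [CompleteSpace 𝓡] [IsUltrametricDist 𝓡] [IsNoetherianRing 𝓡]
  [IsNoetherianRing D.A] [CharZero K] in
theorem span_range_toExt (M : ModuleCat.{u} D.R) :
    Submodule.span 𝓡 (Set.range (D.toExt M)) = ⊤ := by
  have h := span_btmulOne D.incl (M := M) (X := Set.univ) Submodule.span_univ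
  rw [Set.image_univ] at h
  exact h

theorem catO_wsFunctor (M : ModuleCat.{u} 𝓡) (hM : D.catOHat M) :
    D.T.catO (D.wsFunctor.obj M) :=
  (catOHat_iff.mp hM).catO_wsSub

variable [IsNoetherianRing D.B] [IsNoetherianRing D.R]

theorem catOHat_extFunctor (M : ModuleCat.{u} D.R) (hM : D.T.catO M) :
    D.catOHat (D.extFunctor.obj M) :=
  catOHat_iff.mpr (isOHat_of_generated (isO_of_catO hM) (D.toExt M) (span_range_toExt M))

theorem toExt_mem {M : ModuleCat.{u} D.R} (hM : D.T.catO M) (m : M) :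
    D.toExt M m ∈ D.wsModule (D.extFunctor.obj M) := by
  have h : m ∈ ws (act K D.T.del M) := (isO_of_catO hM).ws_eq_top ▸ Submodule.mem_top
  exact map_mem_ws (D' := act K D.del (D.extFunctor.obj M)) ((D.toExt M).restrictScalars K)
    (fun x => map_smul (D.toExt M) D.T.del x) h

/-- The isomorphism `M ≃ (𝓡 ⊗ M)^ws` for `M` in `O`. -/
def unitEquiv {M : ModuleCat.{u} D.R} (hM : D.T.catO M) :
    M ≃ₗ[D.R] D.wsModule (D.extFunctor.obj M) :=
  LinearEquiv.ofBijective
    { toFun := fun m => ⟨D.toExt M m, toExt_mem hM m⟩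
      map_add' := fun x y => Subtype.ext (map_add (D.toExt M) x y)
      map_smul' := fun r x => Subtype.ext (map_smul (D.toExt M) r x) }
    ⟨fun _ _ h => btmul_one_injective (isO_of_catO hM) (congrArg Subtype.val h), fun x => by
      obtain ⟨m, hm⟩ := exists_of_mem_ws (isO_of_catO hM) (D.toExt M) (span_range_toExt M)
        (x := x.1) x.2
      exact ⟨m, Subtype.ext hm⟩⟩

/-- The map `𝓡 ⊗ M^ws → M`, `x ⊗ m ↦ x m`. -/
def counitMap (D : BanachTriangularDecomposition K 𝓡) (M : ModuleCat.{u} 𝓡) :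
    BaseChange D.incl (D.wsModule M) →ₗ[𝓡] M :=
  baseChangeLift (f := D.incl) (D.wsModule M).subtype.toAddMonoidHom fun _ _ => rfl

theorem counitMap_btmul (M : ModuleCat.{u} 𝓡) (x : 𝓡) (m : D.wsModule M) :
    D.counitMap M (btmul D.incl x m) = x • (m : M) :=
  baseChangeLift_btmul _ _ x m

theorem counitMap_btmul_one (M : ModuleCat.{u} 𝓡) (m : D.wsModule M) :
    D.counitMap M (btmul D.incl 1 m) = m :=
  (counitMap_btmul M 1 m).trans (one_smul 𝓡 (m : M))

/-- It is injective on the weight part, hence injective, and onto because M^ws generates M. -/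
theorem bijective_counitMap {M : ModuleCat.{u} 𝓡} (hM : D.catOHat M) :
    Function.Bijective (D.counitMap M) := by
  have h1 := counitMap_btmul_one (D := D) M
  have hO := isO_of_catO (catO_wsFunctor M hM)
  constructor
  · refine injective_of_comp_injective hO (D.toExt (D.wsFunctor.obj M))
      (span_range_toExt _) (D.counitMap M) fun n hn => ?_
    exact Subtype.ext ((h1 n).symm.trans hn)
  · rw [← LinearMap.range_eq_top, eq_top_iff, ← (catOHat_iff.mp hM).span_wsSub, Submodule.span_le]
    intro m hm
    exact ⟨btmul D.incl 1 ⟨m, hm⟩, h1 ⟨m, hm⟩⟩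

/-- The natural isomorphism `M ≅ (𝓡 ⊗ M)^ws` on `O`. -/
def unitNatIso (D : BanachTriangularDecomposition K 𝓡) [IsNoetherianRing D.A] [IsNoetherianRing D.B]
    [IsNoetherianRing D.R] :
    𝟭 D.T.catO.FullSubcategory ≅
      D.extO (catOHat_extFunctor (D := D)) ⋙ D.wsO (catO_wsFunctor (D := D)) :=
  NatIso.ofComponents (fun M => D.T.catO.isoMk (unitEquiv M.property).toModuleIso) (by
    intro M N g
    refine ObjectProperty.hom_ext _ (ModuleCat.hom_ext (LinearMap.ext fun m => Subtype.ext ?_))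
    rfl)

/-- The natural isomorphism `𝓡 ⊗ M^ws ≅ M` on `Ô`. -/
def counitNatIso (D : BanachTriangularDecomposition K 𝓡) [IsNoetherianRing D.A]
    [IsNoetherianRing D.B] [IsNoetherianRing D.R] :
    D.wsO (catO_wsFunctor (D := D)) ⋙ D.extO (catOHat_extFunctor (D := D)) ≅
      𝟭 D.catOHat.FullSubcategory :=
  NatIso.ofComponents (fun M => D.catOHat.isoMk
    (LinearEquiv.ofBijective (D.counitMap M.obj) (bijective_counitMap M.property)).toModuleIso) (by
    intro M N g
    refine ObjectProperty.hom_ext _ (ModuleCat.hom_ext (baseChange_hom_ext ?_))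
    intro m
    exact (counitMap_btmul_one N.obj ((D.wsFunctor.map g.hom).hom m)).trans
      (congrArg g.hom.hom (counitMap_btmul_one M.obj m)).symm)

/-- A morphism is determined by the images of finitely many weight generators over 𝓐, and these lie
in finite dimensional weight spaces of Y. -/
theorem finite_hom (X Y : D.catOHat.FullSubcategory) : Module.Finite K (X ⟶ Y) := by
  have hX := catOHat_iff.mp X.property
  have hY := catOHat_iff.mp Y.property
  obtain ⟨S, hS, hspan⟩ := hX.exists_weight_generators
  choose ω hω using fun s : S => hS s.2
  have := fun s : S => hY.finite_wt (ω s)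
  let Φ : (X ⟶ Y) →ₗ[K] ∀ s : S, D.T.wt Y.obj (ω s) :=
    { toFun := fun f s => ⟨f.hom.hom s, map_mem_wt (T := D.T) (f.hom.hom.restrictScalars D.R) (hω s)⟩
      map_add' := fun f g => rfl
      map_smul' := fun c f => rfl }
  refine Module.Finite.of_injective Φ fun f g h => ?_
  refine ObjectProperty.hom_ext _ (ModuleCat.hom_ext ?_)
  have h1 : f.hom.hom.restrictScalars D.A = g.hom.hom.restrictScalars D.A :=
    LinearMap.ext_on hspan fun s hs => congrArg Subtype.val (congrFun h ⟨s, hs⟩)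
  exact LinearMap.ext fun x => LinearMap.congr_fun h1 x

/-- Taking images embeds the order of subobjects strictly into that of 𝓡-submodules, which satisfies
both chain conditions. -/
theorem finite_length (X : D.catOHat.FullSubcategory) :
    IsArtinianObject X ∧ IsNoetherianObject X := by
  have hX := catOHat_iff.mp X.property
  have h1 : IsArtinian 𝓡 X.obj := hX.isArtinian
  have := hX.finite
  have h2 : IsNoetherian 𝓡 X.obj := isNoetherian_of_isNoetherianRing_of_finite 𝓡 X.obj
  let φ : Subobject X → Submodule 𝓡 X.obj := fun Y => LinearMap.range Y.arrow.hom.hom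
  have hmono : Monotone φ := by
    intro Y Z h
    rintro _ ⟨y, rfl⟩
    refine ⟨(Subobject.ofLE Y Z h).hom.hom y, ?_⟩
    exact LinearMap.congr_fun (congrArg (fun f => f.hom.hom) (Subobject.ofLE_arrow h)) y
  have hle : ∀ Y Z, φ Y ≤ φ Z → Y ≤ Z := by
    intro Y Z h
    have hZ : Function.Injective Z.arrow.hom.hom := (mono_iff_injective Z.arrow).mp inferInstance
    let e := LinearEquiv.ofInjective Z.arrow.hom.hom hZ
    let k : (Subobject.underlying.obj Y).obj →ₗ[𝓡] (Subobject.underlying.obj Z).obj :=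
      e.symm.toLinearMap ∘ₗ Submodule.inclusion h ∘ₗ Y.arrow.hom.hom.rangeRestrict
    refine Subobject.le_of_comm (D.catOHat.homMk (ModuleCat.ofHom k))
      (ObjectProperty.hom_ext _ (ModuleCat.hom_ext (LinearMap.ext fun y => ?_)))
    exact congrArg Subtype.val (e.apply_symm_apply
      (Submodule.inclusion h (Y.arrow.hom.hom.rangeRestrict y)))
  have hφ : StrictMono φ := fun N N' h =>
    lt_of_le_not_ge (hmono h.le) fun h' => h.not_ge (hle _ _ h')
  exact ⟨⟨hφ.wellFoundedLT⟩, ⟨hφ.wellFoundedGT⟩⟩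

theorem isHighestWeightCategory_catOHat :
    IsHighestWeightCategory (C := D.catOHat.FullSubcategory) K D.T.lt
      (fun W => (D.extO catOHat_extFunctor).obj (vermaO W)) where
  abelian := ⟨inferInstance, rfl⟩
  finite_length := finite_length
  finite_hom := finite_hom
  strict_order := isStrictOrder_lt
  interval_finite x y := by
    have := finite_irr (T := D.T)
    exact Set.toFinite _
  structure_objects := by
    -- The simple objects, the covers and the filtrations of `O` are carried over by the
    -- equivalence, which sends Δ(W) to the required standard object.
    have : (D.extO (catOHat_extFunctor (D := D))).IsEquivalence :=
      (CategoryTheory.Equivalence.mk _ _ D.unitNatIso D.counitNatIso).isEquivalence_functor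
    exact (hasStandardCovers_catO (T := D.T)).map (D.extO catOHat_extFunctor)

end BanachTriangularDecomposition

end HatCategory

end TriO

end

/-! ### The theorem -/

theorem mainTheorem1
    (p : ℕ) [Fact p.Prime]
    (K : Type w) [NontriviallyNormedField K] [NormedAlgebra ℚ_[p] K] [CompleteSpace K]
    [IsUltrametricDist K] [IsDiscreteValuationRing (NormedField.valuation (K := K)).integer]
    (𝓡 : Type u) [NormedRing 𝓡] [NormedAlgebra K 𝓡] [CompleteSpace 𝓡] [IsUltrametricDist 𝓡]
    [IsNoetherianRing 𝓡] [IsNoetherianRing 𝓡ᵐᵒᵖ]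
    (D : TriO.BanachTriangularDecomposition K 𝓡)
    [IsNoetherianRing D.R] [IsNoetherianRing D.Rᵐᵒᵖ]
    [IsNoetherianRing D.A] [IsNoetherianRing D.Aᵐᵒᵖ]
    [IsNoetherianRing D.B] [IsNoetherianRing D.Bᵐᵒᵖ] :
    TriO.IsFullAbelianSubcategory D.catOHat ∧
    D.catOHat.IsClosedUnderSubobjects ∧
    (∀ (n : ℕ) (M : Fin n → ModuleCat.{u} 𝓡), (∀ i, D.catOHat (M i)) →
      D.catOHat (ModuleCat.of 𝓡 (∀ i, M i))) ∧
    TriO.IsFullAbelianSubcategory D.T.catO ∧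
    ∃ (hF : ∀ M, D.T.catO M → D.catOHat (D.extFunctor.obj M))
      (hG : ∀ M, D.catOHat M → D.T.catO (D.wsFunctor.obj M)),
      (∃ (η : 𝟭 D.T.catO.FullSubcategory ≅ D.extO hF ⋙ D.wsO hG)
          (ε : D.wsO hG ⋙ D.extO hF ≅ 𝟭 D.catOHat.FullSubcategory),
        (∀ (M : D.T.catO.FullSubcategory) (m : M.obj),
          (D.wsModule (D.extFunctor.obj M.obj)).subtype ((η.hom.app M).hom.hom m) = TriO.btmul D.incl 1 m) ∧
        (∀ (M : D.catOHat.FullSubcategory) (x : 𝓡) (m : D.wsModule M.obj),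
          (ε.hom.app M).hom.hom (TriO.btmul D.incl x m) = x • (m : M.obj))) ∧
      ∃ hV : ∀ W : D.T.Irr, D.T.catO (D.T.verma W.rep),
        TriO.IsHighestWeightCategory (C := D.catOHat.FullSubcategory) K D.T.lt
          (fun W => (D.extO hF).obj ⟨D.T.verma W.rep, hV W⟩) := by
  -- Of the p-adic structure of K, beyond completeness, only characteristic zero is needed: it keeps
  -- the weights w + n distinct.
  have : CharZero K := charZero_of_injective_algebraMap (algebraMap ℚ_[p] K).injective
  exact ⟨TriO.isFullAbelianSubcategory D.catOHat, inferInstance,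
    fun _ M hM => TriO.IsSubquotientClosed.pi _ M hM,
    TriO.isFullAbelianSubcategory D.T.catO,
    TriO.BanachTriangularDecomposition.catOHat_extFunctor,
    TriO.BanachTriangularDecomposition.catO_wsFunctor,
    ⟨D.unitNatIso, D.counitNatIso, fun _ _ => rfl,
      fun M x m => TriO.BanachTriangularDecomposition.counitMap_btmul M.obj x m⟩,
    TriO.TriangularDecomposition.catO_verma,
    TriO.BanachTriangularDecomposition.isHighestWeightCategory_catOHat⟩
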